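/- Let $N\ge 1$ and $p\ge 2$ be integers, $1/p<\alpha\le 1$, $T,a,b>0$, $q=\frac{p}{p-1}$, and let $V\in C([0,T],\mathbb R)$ be positive, $V^\infty=\max_{[0,T]}V$, $V_\infty=\min_{[0,T]}V$. Let ${}_0D_t^\alpha$, ${}_tD_T^\alpha$ be the left and right Riemann–Liouville derivatives and $\phi_p(s)=|s|^{p-2}s$. Consider, for $\lambda>0$, $$A(u)\left[{}_tD_T^\alpha\phi_p({}_0D_t^\alpha u)+V(t)\phi_p(u)\right]=\lambda\nabla F(t,u)\ \text{ a.e. on }[0,T],\qquad u(0)=u(T)=0,$$ $$A(u)=\left[a+b\int_0^T\left(|{}_0D_t^\alpha u|^p+V(t)|u|^p\right)dt\right]^{p-1},$$ for $u:[0,T]\to\mathbb R^N$. Let $E_0^{\alpha,p}$ be the closure of $C_0^\infty([0,T],\mathbb R^N)$ (smooth functions vanishing at $0$ and $T$) in the norm $\left(\int_0^T|{}_0D_t^\alpha u|^p+\int_0^T|u|^p\right)^{1/p}$, its elements being identified with their continuous representatives. A weak solution is a $u\in E_0^{\alpha,p}$ such that for all $v\in E_0^{\alpha,p}$ $$A(u)\left[\int_0^T(\phi_p({}_0D_t^\alpha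 u),{}_0D_t^\alpha v)\,dt+\int_0^TV(t)(\phi_p(u),v)\,dt\right]=\lambda\int_0^T(\nabla F(t,u),v)\,dt ,$$ where it is understood that $F(t,\cdot)$ is differentiable at $u(t)$ for a.e. $t$ and that the last integrand is integrable. Assume that there is $\delta>0$ such that: (H0) $F(t,x)$ is $C^1$ in $x$ on $|x|\le\delta$ for a.e. $t\in[0,T]$, measurable in $t$ for every $|x|\le\delta$, and there are a continuous $g:[0,\infty)\to[0,\infty)$ and a nonnegative $h\in L^1([0,T])$ with $|F(t,x)|,|\nabla F(t,x)|\le g(|x|)h(t)$ for $|x|\le\delta$ and a.e. $t$; (H1) there are $p^2<q_2<q_1$ and $M_1,M_2>0$ with $M_1|x|^{q_1}\le F(t,x)\le M_2|x|^{q_2}$ for $|x|\le\delta$ and a.e. $t$; (H2) there is $\beta>p^2$ with $0\le\beta F(t,x)\le(\nabla F(t,x),x)$ for $|x|\le\delta$ and a.e. $t$. Put $\theta=\min\{\beta,q_2\}$, $\kappa=\Gamma(\alpha)(\alpha q-q+1)^{1/q}$, $K=T^{\alpha-\frac1p}/\kappa$, $$D=\left(\tfrac{T^{p+1}}{\pi^{p+1}}\tfrac{2(p-1)!!}{p!!}\right)^{1/p}\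 (p\text{ odd}),\qquad D=\left(\tfrac{T^{p+1}}{\pi^{p}}\tfrac{(p-1)!!}{p!!}\right)^{1/p}\ (p\text{ even}),$$ $$G=\left(\frac{T^{p+1-p\alpha}}{\Gamma(2-\alpha)^p(p+1-p\alpha)}\right)^{1/p},\qquad G_0=KG,$$ $$C_*=\left(\frac1{p(M_1q_1)^{\frac p{q_1-p}}}-\frac{M_1}{(M_1q_1)^{\frac{q_1}{q_1-p}}}\right)\left(\frac{\max\{1,V^\infty\}^{1/p}(D^p+G^p)^{1/p}}{T^{\frac1{q_1}-\frac1p}D}\right)^{\frac{pq_1}{q_1-p}},\qquad B=\frac{p^2\theta}{a^{p-1}(\theta-p^2)}C_*,$$ $$\Lambda_1=\max\left\{\frac{V_\infty a^{p-1}(\kappa G_0)^{q_2-p}}{2p^2M_2T^{(\alpha-\frac1p)(q_2-p)}(\delta\min\{1,V_\infty\}D)^{q_2-p}},\ \frac{\frac1{bp^2}\left(a+\frac{b\delta^p}{G_0^p}\max\{1,V^\infty\}(D^p+G^p)\right)^p}{M_1\frac{\delta^{q_1}}{G_0^{q_1}}T^{1-\frac{q_1}p}D^{q_1}}\right\},$$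 $$\Lambda_2=\left[a+b\max\{1,V^\infty\}^p\frac{\delta^p}{G_0^p}(D^p+G^p)\right]^{q_1(p-1)},\qquad \Lambda_3=\left(\frac{T^{p\alpha-1}}{\kappa^p}\,B\,\frac{2^p}{\delta^p}\right)^{\frac{q_1-p}{p-1}},$$ and $\lambda^*=\max\{\Lambda_1,\Lambda_2,\Lambda_3\}$. Let $\|u\|_V=\left(\int_0^T|{}_0D_t^\alpha u|^p\,dt+\int_0^TV|u|^p\,dt\right)^{1/p}$ and $\|u\|_\infty=\max_{[0,T]}|u(t)|$. Then there is a family $(u_\lambda)_{\lambda>\lambda^*}$ such that for every $\lambda>\lambda^*$, $u_\lambda$ is a nontrivial weak solution of the system with parameter $\lambda$, and $$\|u_\lambda\|_V^p\le B\,\lambda^{-\frac{p-1}{q_1-p}}\le B\,(\lambda^*)^{-\frac{p-1}{q_1-p}},$$ $$\|u_\lambda\|_\infty\le K\left(B\,\lambda^{-\frac{p-1}{q_1-p}}\right)^{1/p}\le K\left(B\,(\lambda^*)^{-\frac{p-1}{q_1-p}}\right)^{1/p};$$ moreover $\lim_{\lambda\to\infty}\|u_\lambda\|_V=0=\lim_{\lambda\to\infty}\|u_\lambda\|_\infty$.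 -/

import Mathlib

open Set Filter Topology MeasureTheory

namespace FracKirchhoff

noncomputable section

/-- Left Riemann-Liouville fractional integral of order `γ > 0` with base point `0`:
`(1 / Γ(γ)) ∫₀ᵗ (t - s)^(γ - 1) f(s) ds`. -/
def rlIntegral {N : ℕ} (γ : ℝ) (f : ℝ → EuclideanSpace ℝ (Fin N)) (t : ℝ) :
    EuclideanSpace ℝ (Fin N) :=
  (1 / Real.Gamma γ) • ∫ s in (0 : ℝ)..t, (t - s) ^ (γ - 1) • f s

/-- Left Riemann-Liouville fractional derivative of order `γ ≥ 0` with base point `0`: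
the `n`-th derivative of the fractional integral of order `n - γ`, where `n - 1 ≤ γ < n`. -/
def rlDeriv {N : ℕ} (γ : ℝ) (f : ℝ → EuclideanSpace ℝ (Fin N)) (t : ℝ) :
    EuclideanSpace ℝ (Fin N) :=
  iteratedDeriv (⌊γ⌋₊ + 1) (rlIntegral (((⌊γ⌋₊ + 1 : ℕ) : ℝ) - γ) f) t

/-- The class `C₀^∞([0,T], ℝ^N)`: smooth on `[0,T]`, vanishing at both end points. -/
structure IsTestFunction {N : ℕ} (T : ℝ) (φ : ℝ → EuclideanSpace ℝ (Fin N)) : Prop where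
  smooth : ContDiffOn ℝ (⊤ : ℕ∞) φ (Icc 0 T)
  left_eq_zero : φ 0 = 0
  right_eq_zero : φ T = 0

/-- Membership in the fractional derivative space `E₀^{α,p}`, the closure of `C₀^∞([0,T], ℝ^N)`
in the norm `(∫₀ᵀ |D^α u|^p + ∫₀ᵀ |u|^p)^(1/p)`.  An element is represented by its continuous
representative on `[0,T]` (which exists when `α > 1/p`); values outside `[0,T]` are irrelevant.
The distances are taken in `[0,∞]`, between `D^α (φ n)` and `D^α u`. -/
structure MemE0 {N : ℕ} (T α p : ℝ) (u : ℝ → EuclideanSpace ℝ (Fin N)) : Prop where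
  continuousOn : ContinuousOn u (Icc 0 T)
  approx : ∃ φ : ℕ → ℝ → EuclideanSpace ℝ (Fin N),
    (∀ n, IsTestFunction T (φ n)) ∧
    Tendsto (fun n => eLpNorm (fun t => φ n t - u t) (ENNReal.ofReal p)
      (volume.restrict (Icc 0 T))) atTop (𝓝 0) ∧
    Tendsto (fun n => eLpNorm (fun t => rlDeriv α (φ n) t - rlDeriv α u t) (ENNReal.ofReal p)
      (volume.restrict (Icc 0 T))) atTop (𝓝 0)

/-- `‖u‖_V = (∫₀ᵀ |D^α u|^p dt + ∫₀ᵀ V |u|^p dt)^(1/p)`. -/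
def normV {N : ℕ} (T α p : ℝ) (V : ℝ → ℝ) (u : ℝ → EuclideanSpace ℝ (Fin N)) : ℝ :=
  ((∫ t in (0 : ℝ)..T, ‖rlDeriv α u t‖ ^ p) + ∫ t in (0 : ℝ)..T, V t * ‖u t‖ ^ p) ^ (1 / p)

/-- `‖u‖_∞ = max_{[0,T]} |u(t)|`. -/
def supNorm {N : ℕ} (T : ℝ) (u : ℝ → EuclideanSpace ℝ (Fin N)) : ℝ :=
  sSup ((fun t => ‖u t‖) '' Icc 0 T)

/-- `φ_p(s) = |s|^(p-2) s`. -/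
def phi {N : ℕ} (p : ℝ) (s : EuclideanSpace ℝ (Fin N)) : EuclideanSpace ℝ (Fin N) :=
  ‖s‖ ^ (p - 2) • s

/-- The nonlocal coefficient `A(u) = [a + b ∫₀ᵀ (|D^α u|^p + V |u|^p) dt]^(p-1)`. -/
def kirchhoffCoeff {N : ℕ} (T α p a b : ℝ) (V : ℝ → ℝ)
    (u : ℝ → EuclideanSpace ℝ (Fin N)) : ℝ :=
  (a + b * ∫ t in (0 : ℝ)..T, (‖rlDeriv α u t‖ ^ p + V t * ‖u t‖ ^ p)) ^ (p - 1)

/-- `u` is a weak solution in `E₀^{α,p}` of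
`A(u) [ₜD_T^α φ_p(₀Dₜ^α u) + V φ_p(u)] = lam ∇F(t,u)` on `[0,T]`, `u(0) = u(T) = 0`.
Since `F` is only assumed to be regular near `x = 0`, it is part of the definition that
`F(t,·)` is differentiable at `u(t)` and that the right-hand side is integrable. -/
structure IsWeakSolution {N : ℕ} (T α p a b lam : ℝ) (V : ℝ → ℝ)
    (F : ℝ → EuclideanSpace ℝ (Fin N) → ℝ) (u : ℝ → EuclideanSpace ℝ (Fin N)) : Prop where
  mem : MemE0 T α p u
  left_eq_zero : u 0 = 0
  right_eq_zero : u T = 0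
  differentiable : ∀ᵐ t ∂(volume.restrict (Icc 0 T)), DifferentiableAt ℝ (F t) (u t)
  integrable : ∀ v : ℝ → EuclideanSpace ℝ (Fin N), MemE0 T α p v →
    IntervalIntegrable (fun t => inner ℝ (gradient (F t) (u t)) (v t)) volume 0 T
  weak_eq : ∀ v : ℝ → EuclideanSpace ℝ (Fin N), MemE0 T α p v →
    kirchhoffCoeff T α p a b V u *
      ((∫ t in (0 : ℝ)..T, inner ℝ (phi p (rlDeriv α u t)) (rlDeriv α v t)) +
        ∫ t in (0 : ℝ)..T, V t * inner ℝ (phi p (u t)) (v t)) =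
      lam * ∫ t in (0 : ℝ)..T, inner ℝ (gradient (F t) (u t)) (v t)

/-- Local regularity of `F` on `|x| ≤ δ`.  At boundary points of the closed ball the gradient is
the one relative to the ball. -/
structure HypH0 {N : ℕ} (T δ : ℝ) (F : ℝ → EuclideanSpace ℝ (Fin N) → ℝ) : Prop where
  contDiff : ∀ᵐ t ∂(volume.restrict (Icc 0 T)), ContDiffOn ℝ 1 (F t) (Metric.closedBall 0 δ)
  measurable : ∀ x ∈ Metric.closedBall (0 : EuclideanSpace ℝ (Fin N)) δ,
    AEMeasurable (fun t => F t x) (volume.restrict (Icc 0 T))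
  growth : ∃ g h : ℝ → ℝ, ContinuousOn g (Ici 0) ∧ (∀ s ∈ Ici (0 : ℝ), 0 ≤ g s) ∧
    IntegrableOn h (Icc 0 T) ∧ (∀ t ∈ Icc 0 T, 0 ≤ h t) ∧
    ∀ᵐ t ∂(volume.restrict (Icc 0 T)), ∀ x ∈ Metric.closedBall (0 : EuclideanSpace ℝ (Fin N)) δ,
      |F t x| ≤ g ‖x‖ * h t ∧
      ‖gradientWithin (F t) (Metric.closedBall 0 δ) x‖ ≤ g ‖x‖ * h t

/-- `M₁ |x|^q₁ ≤ F(t,x) ≤ M₂ |x|^q₂` for `|x| ≤ δ`. -/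
def HypH1 {N : ℕ} (T δ q₁ q₂ M₁ M₂ : ℝ) (F : ℝ → EuclideanSpace ℝ (Fin N) → ℝ) : Prop :=
  ∀ᵐ t ∂(volume.restrict (Icc 0 T)), ∀ x ∈ Metric.closedBall (0 : EuclideanSpace ℝ (Fin N)) δ,
    M₁ * ‖x‖ ^ q₁ ≤ F t x ∧ F t x ≤ M₂ * ‖x‖ ^ q₂

/-- `0 ≤ β F(t,x) ≤ (∇F(t,x), x)` for `|x| ≤ δ`. -/
def HypH2 {N : ℕ} (T δ β : ℝ) (F : ℝ → EuclideanSpace ℝ (Fin N) → ℝ) : Prop :=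
  ∀ᵐ t ∂(volume.restrict (Icc 0 T)), ∀ x ∈ Metric.closedBall (0 : EuclideanSpace ℝ (Fin N)) δ,
    0 ≤ β * F t x ∧
    β * F t x ≤ inner ℝ (gradientWithin (F t) (Metric.closedBall 0 δ) x) x

/-- `V^∞ = max_{[0,T]} V`. -/
def Vmax (T : ℝ) (V : ℝ → ℝ) : ℝ := sSup (V '' Icc 0 T)

/-- `V_∞ = min_{[0,T]} V`. -/
def Vmin (T : ℝ) (V : ℝ → ℝ) : ℝ := sInf (V '' Icc 0 T)

/-- The conjugate exponent `q = p / (p - 1)`. -/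
def conjExp (p : ℝ) : ℝ := p / (p - 1)

/-- `Γ(α) (α q - q + 1)^(1/q)`. -/
def gammaConst (α p : ℝ) : ℝ :=
  Real.Gamma α * (α * conjExp p - conjExp p + 1) ^ (1 / conjExp p)

/-- `T^(α - 1/p) / (Γ(α) (α q - q + 1)^(1/q))`. -/
def embConst (T α p : ℝ) : ℝ := T ^ (α - 1 / p) / gammaConst α p

/-- The constant `D`. -/
def constD (T : ℝ) (p : ℕ) : ℝ :=
  if Odd p then
    (T ^ (p + 1) / Real.pi ^ (p + 1) *
      (2 * (Nat.doubleFactorial (p - 1) : ℝ) / (Nat.doubleFactorial p : ℝ))) ^ (1 / (p : ℝ))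
  else
    (T ^ (p + 1) / Real.pi ^ p *
      ((Nat.doubleFactorial (p - 1) : ℝ) / (Nat.doubleFactorial p : ℝ))) ^ (1 / (p : ℝ))

/-- The constant `G`. -/
def constG (T α p : ℝ) : ℝ :=
  (T ^ (p + 1 - p * α) / (Real.Gamma (2 - α) ^ p * (p + 1 - p * α))) ^ (1 / p)

/-- The constant `G₀`. -/
def constG0 (T α p : ℝ) : ℝ := embConst T α p * constG T α p

/-- The constant `Λ₁`. -/
def Lambda1 (T α : ℝ) (p : ℕ) (a b δ q₁ q₂ M₁ M₂ : ℝ) (V : ℝ → ℝ) : ℝ :=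
  max
    ((Vmin T V * a ^ ((p : ℝ) - 1) * (gammaConst α p * constG0 T α p) ^ (q₂ - p)) /
      (2 * (p : ℝ) ^ 2 * M₂ * T ^ ((α - 1 / (p : ℝ)) * (q₂ - p)) *
        (δ * min 1 (Vmin T V) * constD T p) ^ (q₂ - p)))
    ((1 / (b * (p : ℝ) ^ 2) *
        (a + b * δ ^ p / constG0 T α p ^ p * max 1 (Vmax T V) *
          (constD T p ^ p + constG T α p ^ p)) ^ p) /
      (M₁ * (δ ^ q₁ / constG0 T α p ^ q₁) * T ^ (1 - q₁ / (p : ℝ)) * constD T p ^ q₁))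

/-- The constant `Λ₂`. -/
def Lambda2 (T α : ℝ) (p : ℕ) (a b δ q₁ : ℝ) (V : ℝ → ℝ) : ℝ :=
  (a + b * (max 1 (Vmax T V)) ^ p * (δ ^ p / constG0 T α p ^ p) *
    (constD T p ^ p + constG T α p ^ p)) ^ (q₁ * ((p : ℝ) - 1))

/-- The constant `C_*`. -/
def Cstar (T α : ℝ) (p : ℕ) (q₁ M₁ : ℝ) (V : ℝ → ℝ) : ℝ :=
  (1 / ((p : ℝ) * (M₁ * q₁) ^ ((p : ℝ) / (q₁ - p))) - M₁ / (M₁ * q₁) ^ (q₁ / (q₁ - p))) *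
    ((max 1 (Vmax T V)) ^ (1 / (p : ℝ)) *
        (constD T p ^ p + constG T α p ^ p) ^ (1 / (p : ℝ)) /
      (T ^ (1 / q₁ - 1 / (p : ℝ)) * constD T p)) ^ ((p : ℝ) * q₁ / (q₁ - p))

/-- `p² θ / (a^(p-1) (θ - p²)) · C_*` with `θ = min {β, q₂}`. -/
def boundConst (T α : ℝ) (p : ℕ) (a q₁ q₂ M₁ β : ℝ) (V : ℝ → ℝ) : ℝ :=
  ((p : ℝ) ^ 2 * min β q₂ / (a ^ ((p : ℝ) - 1) * (min β q₂ - (p : ℝ) ^ 2))) *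
    Cstar T α p q₁ M₁ V

/-- The constant `Λ₃`. -/
def Lambda3 (T α : ℝ) (p : ℕ) (a δ q₁ q₂ M₁ β : ℝ) (V : ℝ → ℝ) : ℝ :=
  (T ^ ((p : ℝ) * α - 1) / gammaConst α p ^ p * boundConst T α p a q₁ q₂ M₁ β V *
    (2 ^ p / δ ^ p)) ^ ((q₁ - p) / ((p : ℝ) - 1))

/-- `λ^* = max {Λ₁, Λ₂, Λ₃}`. -/
def lambdaStar (T α : ℝ) (p : ℕ) (a b δ q₁ q₂ M₁ M₂ β : ℝ) (V : ℝ → ℝ) : ℝ :=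
  max (max (Lambda1 T α p a b δ q₁ q₂ M₁ M₂ V) (Lambda2 T α p a b δ q₁ V))
    (Lambda3 T α p a δ q₁ q₂ M₁ β V)

end

end FracKirchhoff

open FracKirchhoff

/-! The problem is variational, but F is controlled only for |x| ≤ δ. It is replaced by F̃ = η F +
(1 - η) M₂|x|^q₂ with a radially decreasing cutoff η, equal to 1 on |x| ≤ δ/2. Since 0 ≤ F ≤
M₂|x|^q₂ near 0, F̃ keeps the bounds 0 ≤ F̃ ≤ M₂|x|^q₂ globally. It also satisfies the
Ambrosetti-Rabinowitz inequality θ F̃ ≤ (∇F̃, x) with θ = min{β, q₂}: the extra term (F -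
M₂|x|^q₂)(∇η, x) is a product of two nonpositive factors (`mul_truncation_le_fderiv`).

Every u in the fractional space is I^α w with w = D^α u, and this identifies the space with a closed
subspace of L^p (`memE0_rlIntegral`, `MemE0.exists_eq_rlIntegral`). There the energy is ((a +
b‖u‖_V^p)^p - a^p)/(b p²) - λ ∫ F̃(t,u), whose derivative is the difference of the two sides of the
weak equation with F̃ in place of F. The lower order terms see w only through u, and I^α is compact
from L^p to C([0,T]) because α > 1/p. Together with the strong monotonicity of w ↦ |w|^(p-2) w this
gives the Palais-Smale condition (`exists_critical_of_palaisSmale`). Almost critical points come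
from a mountain pass theorem proved by applying Ekeland's principle to the space of paths
(`mountain_pass`).

The mountain ring exists because q₂ > p. The far endpoint is a multiple c e of a half-period of the
sine. The constants D and G are the L^p norm of e and a bound for that of D^α e, and c = δ/G₀ keeps
|c e| ≤ δ, so that F ≥ M₁|x|^q₁ applies along the whole ray. The second entry of Λ₁ makes the energy
at c e negative. Λ₂ bounds the nonlocal coefficient along the ray by λ^(1/q₁), after which an
elementary maximisation bounds the energy on the ray, hence the critical level, by C_*
λ^(-(p-1)/(q₁-p)).

At a critical point the Ambrosetti-Rabinowitz inequality with θ > p² turns this level into ‖u‖_V^p ≤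
B λ^(-(p-1)/(q₁-p)), and the embedding constant K turns that into a sup norm bound. Λ₃ makes the
latter smaller than δ/2, where F̃ = F, so the critical point solves the original problem. The
estimates force convergence to 0 as λ → ∞. -/

namespace FracKirchhoff

/-! ### Ekeland's principle and the mountain pass theorem -/

/-- Ekeland's variational principle, weak form. -/
theorem ekeland {Y : Type*} [MetricSpace Y] [CompleteSpace Y] (Ψ : Y → ℝ) (hΨ : Continuous Ψ)
    (m : ℝ) (hm : ∀ y, m ≤ Ψ y) (y₀ : Y) {ε : ℝ} (hε : 0 < ε) :
    ∃ y, Ψ y ≤ Ψ y₀ ∧ ∀ z, Ψ y - ε * dist y z ≤ Ψ z := by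
  -- The set A y consists of the points below y in the order "Ψ drops by at least ε times the
  -- distance travelled". A minimal point of this order is what is sought.
  let A : Y → Set Y := fun y => {z | Ψ z + ε * dist y z ≤ Ψ y}
  have hself : ∀ y, y ∈ A y := fun y => by simp [A]
  have htrans : ∀ x y z, y ∈ A x → z ∈ A y → z ∈ A x := by
    intro x y z hxy hyz
    simp only [A, mem_ofPred_eq] at *
    nlinarith [dist_triangle x y z]
  have hbdd : ∀ y, BddBelow (Ψ '' A y) := fun y => ⟨m, by rintro _ ⟨z, -, rfl⟩; exact hm z⟩
  have hex : ∀ (n : ℕ) (y : Y), ∃ z ∈ A y, Ψ z < sInf (Ψ '' A y) + (1 / 2 : ℝ) ^ n := by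
    intro n y
    obtain ⟨_, ⟨z, hz, rfl⟩, h⟩ := exists_lt_of_csInf_lt
      (show (Ψ '' A y).Nonempty from ⟨_, y, hself y, rfl⟩)
      (lt_add_of_pos_right (sInf (Ψ '' A y)) (by positivity : (0 : ℝ) < (1 / 2) ^ n))
    exact ⟨z, hz, h⟩
  choose f hfA hf using hex
  let y : ℕ → Y := fun n => Nat.rec y₀ (fun n z => f n z) n
  have hy : ∀ n, y (n + 1) = f n (y n) := fun n => rfl
  have hstep : ∀ n, y (n + 1) ∈ A (y n) := fun n => by rw [hy]; exact hfA _ _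
  have hmem : ∀ n k, y (n + k) ∈ A (y n) := by
    intro n k
    induction k with
    | zero => exact hself _
    | succ k ih => exact htrans _ _ _ ih (hstep (n + k))
  -- The sets A (y n) decrease and y (n + 1) is within 2^(-n) of the infimum of Ψ on A (y n). Hence
  -- nothing in A (y (n + 1)) can be farther from y (n + 1) than 2^(-n) / ε.
  have hsmall : ∀ n z, z ∈ A (y (n + 1)) → ε * dist (y (n + 1)) z ≤ (1 / 2 : ℝ) ^ n := by
    intro n z hz
    have h1 : sInf (Ψ '' A (y n)) ≤ Ψ z :=
      csInf_le (hbdd _) ⟨z, htrans _ _ _ (hstep n) hz, rfl⟩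
    have h2 := hf n (y n)
    rw [← hy] at h2
    have h3 : Ψ z + ε * dist (y (n + 1)) z ≤ Ψ (y (n + 1)) := hz
    linarith
  have hpow : Tendsto (fun n : ℕ => (1 / 2 : ℝ) ^ n / ε) atTop (𝓝 0) := by
    have := (tendsto_pow_atTop_nhds_zero_of_lt_one (by norm_num : (0 : ℝ) ≤ 1 / 2)
      (by norm_num)).div_const ε
    simpa using this
  have hcauchy : CauchySeq (fun n => y (n + 1)) := by
    refine cauchySeq_of_le_tendsto_0' (fun n => (1 / 2 : ℝ) ^ n / ε) ?_ hpow
    intro n k hnk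
    obtain ⟨j, rfl⟩ := Nat.exists_eq_add_of_le hnk
    rw [le_div_iff₀ hε, mul_comm]
    have := hmem (n + 1) j
    rw [show n + 1 + j = n + j + 1 by ring] at this
    exact hsmall n _ this
  obtain ⟨x, hx⟩ := cauchySeq_tendsto_of_complete hcauchy
  have hxA : ∀ n, x ∈ A (y n) := by
    intro n
    have hcl : IsClosed (A (y n)) :=
      isClosed_le (by fun_prop) continuous_const
    refine hcl.mem_of_tendsto hx ?_
    filter_upwards [eventually_ge_atTop n] with k hk
    obtain ⟨j, rfl⟩ := Nat.exists_eq_add_of_le hk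
    exact hmem n (j + 1)
  refine ⟨x, ?_, ?_⟩
  · have : Ψ x + ε * dist y₀ x ≤ Ψ y₀ := hxA 0
    nlinarith [dist_nonneg (x := y₀) (y := x)]
  · intro z
    by_contra! hcon
    have hz : z ∈ A x := by
      simp only [A, mem_ofPred_eq]; linarith
    -- A point z violating the conclusion lies in A x, hence in every A (y (n + 1)). These sets
    -- shrink to the single point x, so z = x, for which no violation is possible.
    have hlim : Tendsto (fun n => y (n + 1)) atTop (𝓝 z) := by
      rw [tendsto_iff_dist_tendsto_zero]
      refine squeeze_zero (fun _ => dist_nonneg) (fun n => ?_) hpow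
      rw [le_div_iff₀ hε, mul_comm]
      exact hsmall n z (htrans _ _ _ (hxA (n + 1)) hz)
    have hxz : x = z := tendsto_nhds_unique hx hlim
    subst hxz
    simp at hcon

variable {X : Type*} [NormedAddCommGroup X] [NormedSpace ℝ X]

/-- A compact family of descent directions can be chosen continuously, supported in an open set. -/
theorem exists_continuous_descent (D : X → X →ₗ[ℝ] ℝ)
    (hD : Continuous fun z : X × X => D z.1 z.2) (γ : C(unitInterval, X))
    (M U : Set unitInterval) (hM : IsClosed M) (hU : IsOpen U) (hMU : M ⊆ U) {ε : ℝ}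
    (hε : ∀ s ∈ M, ∃ v, ε * ‖v‖ < |D (γ s) v|) (hε0 : 0 ≤ ε) :
    ∃ v : C(unitInterval, X), (∀ s, ‖v s‖ ≤ 1) ∧ (∀ s ∉ U, v s = 0) ∧
      ∀ s ∈ M, D (γ s) (v s) < -ε := by
  have hunit : ∀ s ∈ M, ∃ v, ‖v‖ ≤ 1 ∧ D (γ s) v < -ε := by
    intro s hs
    obtain ⟨v, hv⟩ := hε s hs
    have hv0 : 0 < ‖v‖ := by
      rw [norm_pos_iff]; rintro rfl; simp at hv
    rcases le_total 0 (D (γ s) v) with h | h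
    · refine ⟨-(‖v‖⁻¹ • v), ?_, ?_⟩
      · rw [norm_neg, norm_smul, norm_inv, norm_norm, inv_mul_cancel₀ hv0.ne']
      · rw [abs_of_nonneg h] at hv
        rw [map_neg, map_smul, smul_eq_mul, neg_lt_neg_iff, inv_mul_eq_div, lt_div_iff₀ hv0]
        exact hv
    · refine ⟨‖v‖⁻¹ • v, ?_, ?_⟩
      · rw [norm_smul, norm_inv, norm_norm, inv_mul_cancel₀ hv0.ne']
      · rw [abs_of_nonpos h] at hv
        rw [map_smul, smul_eq_mul, inv_mul_eq_div, div_lt_iff₀ hv0]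
        linarith
  -- All three constraints are convex in v, and near each s one constant vector satisfies them: a
  -- descent direction if s ∈ M, the zero vector otherwise. A partition of unity then glues the
  -- local choices.
  let t : unitInterval → Set X := fun s =>
    {v | ‖v‖ ≤ 1 ∧ (s ∉ U → v = 0) ∧ (s ∈ M → D (γ s) v < -ε)}
  have hconv : ∀ s, Convex ℝ (t s) := by
    intro s v hv w hw a b ha hb hab
    refine ⟨?_, ?_, ?_⟩
    · have h1 : ‖a • v + b • w‖ ≤ a * ‖v‖ + b * ‖w‖ := by
        refine (norm_add_le _ _).trans ?_
        rw [norm_smul, norm_smul, Real.norm_of_nonneg ha, Real.norm_of_nonneg hb]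
      nlinarith [hv.1, hw.1]
    · intro hs
      rw [hv.2.1 hs, hw.2.1 hs]; simp
    · intro hs
      have h1 := hv.2.2 hs
      have h2 := hw.2.2 hs
      rw [map_add, map_smul, map_smul, smul_eq_mul, smul_eq_mul]
      rcases ha.eq_or_lt with rfl | ha
      · have : b = 1 := by linarith
        subst this; linarith
      · nlinarith
  have hloc : ∀ s, ∃ c, ∀ᶠ s' in 𝓝 s, c ∈ t s' := by
    intro s
    by_cases hs : s ∈ M
    · obtain ⟨v, hv1, hv⟩ := hunit s hs
      refine ⟨v, ?_⟩
      have hc : Continuous fun s' => D (γ s') v :=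
        hD.comp (γ.continuous.prodMk continuous_const)
      filter_upwards [hU.mem_nhds (hMU hs), hc.continuousAt.eventually_lt
        continuousAt_const hv] with s' h1 h2
      exact ⟨hv1, fun h => (h h1).elim, fun _ => h2⟩
    · refine ⟨0, ?_⟩
      filter_upwards [hM.isOpen_compl.mem_nhds hs] with s' h
      exact ⟨by simp, fun _ => rfl, fun h' => (h h').elim⟩
  obtain ⟨g, hg⟩ := exists_continuous_forall_mem_convex_of_local_const hconv hloc
  exact ⟨g, fun s => (hg s).1, fun s => (hg s).2.1, fun s => (hg s).2.2⟩

/-- If every maximum point of `I ∘ γ` is a point where `D` exceeds `ε`, then moving along the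
descent field decreases the maximum faster than `ε`. -/
theorem exists_max_decrease (I : X → ℝ) (D : X → X →ₗ[ℝ] ℝ) (hI : Continuous I)
    (hderiv : ∀ u v, HasDerivAt (fun τ : ℝ => I (u + τ • v)) (D u v) 0)
    (hD : Continuous fun z : X × X => D z.1 z.2) (γ v : C(unitInterval, X)) {ε c : ℝ}
    (hc : ∀ s, I (γ s) ≤ c)
    (hv : ∀ s, I (γ s) = c → D (γ s) (v s) < -ε) :
    ∃ h : ℝ, 0 < h ∧ ∀ s, I (γ s + h • v s) < c - ε * h := by
  by_contra! hcon
  -- If no step size works, step sizes h n → 0 produce parameters s n at which the decrease is too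
  -- small. By compactness they accumulate at some s₀, which turns out to be a maximum point where
  -- the slope is at least -ε.
  let h : ℕ → ℝ := fun n => 1 / ((n : ℝ) + 1)
  have hpos : ∀ n, 0 < h n := fun n => by positivity
  have hlim : Tendsto h atTop (𝓝 0) := tendsto_one_div_add_atTop_nhds_zero_nat
  choose s hs using fun n => hcon (h n) (hpos n)
  obtain ⟨s₀, -, φ, hφ, hsφ⟩ := isCompact_univ.tendsto_subseq (fun n => mem_univ (s n))
  have hderiv' : ∀ u w (τ : ℝ), HasDerivAt (fun τ : ℝ => I (u + τ • w)) (D (u + τ • w) w) τ := by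
    intro u w τ
    have h1 := hderiv (u + τ • w) w
    have h2 : HasDerivAt (fun r : ℝ => r - τ) 1 τ := (hasDerivAt_id τ).sub_const τ
    have h3 := HasDerivAt.scomp_of_eq τ h1 h2 (sub_self τ).symm
    rw [one_smul] at h3
    refine h3.congr_of_eventuallyEq (Eventually.of_forall fun r => ?_)
    simp only [Function.comp]
    congr 1
    rw [sub_smul]; abel
  -- The mean value theorem replaces the difference quotient by a derivative at an intermediate
  -- point, and joint continuity of D lets it pass to the limit. Uniform differentiability of I is
  -- not needed.
  have hmvt : ∀ n, ∃ ξ ∈ Ioo 0 (h n), -ε ≤ D (γ (s n) + ξ • v (s n)) (v (s n)) := by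
    intro n
    obtain ⟨ξ, hξ, hξe⟩ := exists_hasDerivAt_eq_slope
      (fun τ : ℝ => I (γ (s n) + τ • v (s n))) (fun τ => D (γ (s n) + τ • v (s n)) (v (s n)))
      (hpos n) (fun τ _ => (hderiv' _ _ τ).continuousAt.continuousWithinAt)
      (fun τ _ => hderiv' _ _ τ)
    refine ⟨ξ, hξ, ?_⟩
    rw [hξe, le_div_iff₀ (by linarith [hpos n])]
    have := hs n
    have := hc (s n)
    simp only [zero_smul, add_zero, sub_zero]
    linarith
  choose ξ hξ hξD using hmvt
  have hξlim : Tendsto ξ atTop (𝓝 0) :=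
    squeeze_zero (fun n => (hξ n).1.le) (fun n => (hξ n).2.le) hlim
  have hγs : Tendsto (fun n => γ (s (φ n))) atTop (𝓝 (γ s₀)) :=
    (γ.continuous.tendsto s₀).comp hsφ
  have hvs : Tendsto (fun n => v (s (φ n))) atTop (𝓝 (v s₀)) :=
    (v.continuous.tendsto s₀).comp hsφ
  have hmove : ∀ r : ℕ → ℝ, Tendsto r atTop (𝓝 0) →
      Tendsto (fun n => γ (s (φ n)) + r (φ n) • v (s (φ n))) atTop (𝓝 (γ s₀)) := by
    intro r hr
    have := hγs.add ((hr.comp hφ.tendsto_atTop).smul hvs)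
    simpa using this
  have hmax : I (γ s₀) = c := by
    refine le_antisymm (hc _) ?_
    have h1 := (hI.tendsto _).comp (hmove h hlim)
    have h2 : Tendsto (fun n => c - ε * h (φ n)) atTop (𝓝 (c - ε * 0)) :=
      tendsto_const_nhds.sub ((hlim.comp hφ.tendsto_atTop).const_mul ε)
    have := le_of_tendsto_of_tendsto' h2 h1 (fun n => hs (φ n))
    simpa using this
  have hge : -ε ≤ D (γ s₀) (v s₀) := by
    have h1 := (hD.tendsto (γ s₀, v s₀)).comp ((hmove ξ hξlim).prodMk_nhds hvs)
    exact ge_of_tendsto' h1 (fun n => hξD (φ n))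
  exact absurd (hv s₀ hmax) (not_lt.2 hge)

/-- The mountain pass theorem without compactness: there are almost critical points of `I` whose
level lies between the height `ρ` of the mountain ring and the maximum of `I` on the segment
`[0, e]`. -/
theorem mountain_pass [CompleteSpace X] (I : X → ℝ) (D : X → X →ₗ[ℝ] ℝ) (hI : Continuous I)
    (hderiv : ∀ u v, HasDerivAt (fun τ : ℝ => I (u + τ • v)) (D u v) 0)
    (hD : Continuous fun z : X × X => D z.1 z.2) {e : X} {r ρ C : ℝ}
    (hr : 0 ≤ r) (hre : r ≤ ‖e‖) (hring : ∀ u, ‖u‖ = r → ρ ≤ I u) (h0 : I 0 < ρ) (he : I e < ρ)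
    (hC : ∀ s ∈ Icc (0 : ℝ) 1, I (s • e) ≤ C) {ε : ℝ} (hε : 0 < ε) :
    ∃ u, ρ ≤ I u ∧ I u ≤ C ∧ ∀ v, |D u v| ≤ ε * ‖v‖ := by
  -- The paths from 0 to e form a closed subset of C([0,1], X), hence a complete metric space.
  -- Ekeland's principle is applied there to Ψ γ = max I ∘ γ, starting from the straight segment.
  let Γ : Set C(unitInterval, X) := {γ | γ 0 = 0 ∧ γ 1 = e}
  have hΓ : IsClosed Γ :=
    (isClosed_eq (continuous_eval_const (0 : unitInterval)) continuous_const).inter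
      (isClosed_eq (continuous_eval_const (1 : unitInterval)) continuous_const)
  have : CompleteSpace Γ := hΓ.completeSpace_coe
  have hmaxex : ∀ γ : C(unitInterval, X), ∃ s, ∀ s', I (γ s') ≤ I (γ s) := by
    intro γ
    obtain ⟨s, -, hs⟩ := isCompact_univ.exists_isMaxOn univ_nonempty
      (hI.comp γ.continuous).continuousOn
    exact ⟨s, fun s' => hs (mem_univ s')⟩
  choose sm hsm using hmaxex
  let Ψ : Γ → ℝ := fun γ => I (γ.1 (sm γ.1))
  have hΨρ : ∀ γ : Γ, ρ ≤ Ψ γ := by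
    intro γ
    have hcont : Continuous fun s => ‖γ.1 s‖ := by fun_prop
    have h1 : r ∈ Icc (‖γ.1 0‖) (‖γ.1 1‖) := by
      rw [γ.2.1, γ.2.2]; simpa using ⟨hr, hre⟩
    obtain ⟨s, -, hs⟩ := isPreconnected_univ.intermediate_value (mem_univ 0) (mem_univ 1)
      hcont.continuousOn h1
    exact (hring _ hs).trans (hsm _ _)
  have hΨc : Continuous Ψ := by
    have hsup : Ψ = fun γ : Γ => sSup ((fun s => I (γ.1 s)) '' univ) := by
      ext γ
      have hg : IsGreatest ((fun s => I (γ.1 s)) '' univ) (Ψ γ) :=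
        ⟨⟨sm γ.1, mem_univ _, rfl⟩, by rintro _ ⟨s, -, rfl⟩; exact hsm _ _⟩
      exact hg.csSup_eq.symm
    rw [hsup]
    refine isCompact_univ.continuous_sSup (f := fun (γ : Γ) s => I (γ.1 s)) ?_
    exact hI.comp (continuous_eval.comp (continuous_subtype_val.prodMap continuous_id))
  let ℓ : C(unitInterval, X) := ⟨fun s => (s : ℝ) • e, by fun_prop⟩
  let γ₀ : Γ := ⟨ℓ, by simp [Γ, ℓ]⟩
  obtain ⟨γ, hγ0, hγ⟩ := ekeland Ψ hΨc ρ hΨρ γ₀ hε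
  have hC' : Ψ γ ≤ C := hγ0.trans (hC _ (sm γ₀.1).2)
  by_contra! hcon
  let M : Set unitInterval := {s | I (γ.1 s) = Ψ γ}
  -- At the end points I < ρ ≤ Ψ γ, so the maximum set M avoids them. A deformation field vanishing
  -- off U keeps the end points of the path fixed.
  let U : Set unitInterval := {0}ᶜ ∩ {1}ᶜ
  have hM : IsClosed M := isClosed_eq (hI.comp γ.1.continuous) continuous_const
  have hU : IsOpen U := isOpen_compl_singleton.inter isOpen_compl_singleton
  have hMU : M ⊆ U := by
    intro s hs
    have hs' : I (γ.1 s) = Ψ γ := hs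
    have := hΨρ γ
    refine ⟨?_, ?_⟩ <;> rintro rfl
    · rw [γ.2.1] at hs'; linarith
    · rw [γ.2.2] at hs'; linarith
  obtain ⟨v, hv1, hvU, hvM⟩ := exists_continuous_descent D hD γ.1 M U hM hU hMU
    (fun s hs => by
      have hs' : I (γ.1 s) = Ψ γ := hs
      exact hcon (γ.1 s) (hs' ▸ hΨρ γ) (hs' ▸ hC')) hε.le
  obtain ⟨h, hh, hdec⟩ := exists_max_decrease I D hI hderiv hD γ.1 v (c := Ψ γ)
    (fun s => hsm _ _) (fun s hs => hvM s hs)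
  let γ' : Γ := ⟨γ.1 + h • v, by
    constructor
    · simp [γ.2.1, hvU 0 (by simp [U])]
    · simp [γ.2.2, hvU 1 (by simp [U])]⟩
  -- The field has norm at most 1, so the path moves by at most h, while its maximum drops by more
  -- than ε h. This contradicts the almost minimality of γ.
  have hdist : dist γ γ' ≤ h := by
    rw [Subtype.dist_eq, ContinuousMap.dist_le hh.le]
    intro s
    simp only [γ', ContinuousMap.add_apply, ContinuousMap.smul_apply, dist_self_add_right,
      norm_smul, Real.norm_of_nonneg hh.le]
    nlinarith [hv1 s]
  have h1 := hγ γ'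
  have h2 : Ψ γ' < Ψ γ - ε * h := hdec _
  nlinarith

/-- The mountain pass theorem on a closed subspace. -/
theorem mountain_pass_submodule (I : X → ℝ) (D : X → X →ₗ[ℝ] ℝ) (hI : Continuous I)
    (hderiv : ∀ u v, HasDerivAt (fun τ : ℝ => I (u + τ • v)) (D u v) 0)
    (hD : Continuous fun z : X × X => D z.1 z.2) (S : Submodule ℝ X) [CompleteSpace S]
    {e : X} (heS : e ∈ S) {r ρ C : ℝ}
    (hr : 0 ≤ r) (hre : r ≤ ‖e‖) (hring : ∀ u, ‖u‖ = r → ρ ≤ I u) (h0 : I 0 < ρ) (he : I e < ρ)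
    (hC : ∀ s ∈ Icc (0 : ℝ) 1, I (s • e) ≤ C) {ε : ℝ} (hε : 0 < ε) :
    ∃ u ∈ S, ρ ≤ I u ∧ I u ≤ C ∧ ∀ v ∈ S, |D u v| ≤ ε * ‖v‖ := by
  obtain ⟨u, h1, h2, h3⟩ := mountain_pass (fun u : S => I u) (fun u => (D u).comp S.subtype)
    (hI.comp continuous_subtype_val) (fun u v => hderiv u v)
    (hD.comp (continuous_subtype_val.prodMap continuous_subtype_val)) (e := ⟨e, heS⟩) hr hre
    (fun u hu => hring u hu) h0 he hC hε
  exact ⟨u, u.2, h1, h2, fun v hv => h3 ⟨v, hv⟩⟩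

/-! ### The Riemann-Liouville kernel and the semigroup property -/

/-- The causal Riemann-Liouville kernel `r^(γ-1)` on `r > 0`. -/
noncomputable def rlKernel (γ r : ℝ) : ℝ := if 0 < r then r ^ (γ - 1) else 0

theorem rlKernel_nonneg (γ r : ℝ) : 0 ≤ rlKernel γ r := by
  unfold rlKernel; split_ifs with h
  · positivity
  · exact le_rfl

@[fun_prop]
theorem measurable_rlKernel (γ : ℝ) : Measurable (rlKernel γ) :=
  Measurable.ite measurableSet_Ioi (by fun_prop) measurable_const

theorem rlKernel_of_pos {γ r : ℝ} (h : 0 < r) : rlKernel γ r = r ^ (γ - 1) := if_pos h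

theorem rlKernel_of_nonpos {γ r : ℝ} (h : r ≤ 0) : rlKernel γ r = 0 := if_neg (not_lt.2 h)

theorem setIntegral_Icc_eq_intervalIntegral {F : Type*} [NormedAddCommGroup F] [NormedSpace ℝ F]
    {T c t : ℝ} (hc : 0 ≤ c) (hct : c ≤ t) (htT : t ≤ T) {f g : ℝ → F}
    (hfg : ∀ s ∈ Ioo c t, f s = g s) (hf : ∀ s ∉ Icc c t, f s = 0) :
    ∫ s in Icc 0 T, f s = ∫ s in c..t, g s := by
  rw [intervalIntegral.integral_of_le hct, integral_Ioc_eq_integral_Ioo,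
    ← setIntegral_congr_fun measurableSet_Ioo hfg, ← integral_Icc_eq_integral_Ioo]
  exact setIntegral_eq_of_subset_of_forall_sdiff_eq_zero measurableSet_Icc
    (Icc_subset_Icc hc htT) (fun s hs => hf s hs.2)

/-- Extending the kernel by zero makes the domain of integration independent of t. Fubini's theorem
and the comparison of two values of t then take place over the fixed interval [0,T]. -/
theorem setIntegral_rlKernel_smul {F : Type*} [NormedAddCommGroup F] [NormedSpace ℝ F]
    {T t γ : ℝ} (ht : t ∈ Icc 0 T) (f : ℝ → F) :
    ∫ s in Icc 0 T, rlKernel γ (t - s) • f s = ∫ s in (0 : ℝ)..t, (t - s) ^ (γ - 1) • f s := by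
  have h : ∫ s in Icc 0 T, rlKernel γ (t - s) • f s =
      ∫ s in Icc 0 T, (Ioo 0 t).indicator (fun s => (t - s) ^ (γ - 1) • f s) s := by
    refine setIntegral_congr_ae measurableSet_Icc ?_
    have h0 : ∀ᵐ s : ℝ, s ≠ 0 := by simp [ae_iff, measure_singleton]
    filter_upwards [h0] with s hs0 hs
    rcases lt_or_ge s t with hst | hst
    · rw [indicator_of_mem (show s ∈ Ioo 0 t from ⟨lt_of_le_of_ne hs.1 (fun h => hs0 h.symm), hst⟩),
        rlKernel_of_pos (sub_pos.2 hst)]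
    · rw [indicator_of_notMem (show s ∉ Ioo 0 t from fun h => absurd h.2 (not_lt.2 hst)),
        rlKernel_of_nonpos (sub_nonpos.2 hst), zero_smul]
  rw [h]
  exact setIntegral_Icc_eq_intervalIntegral le_rfl ht.1 ht.2
    (fun s hs => indicator_of_mem hs _) (fun s hs => indicator_of_notMem (fun h => hs (Ioo_subset_Icc_self h)) _)

theorem rlIntegral_eq {N : ℕ} {T t : ℝ} (γ : ℝ) (ht : t ∈ Icc 0 T)
    (f : ℝ → EuclideanSpace ℝ (Fin N)) :
    rlIntegral γ f t = (1 / Real.Gamma γ) • ∫ s in Icc 0 T, rlKernel γ (t - s) • f s := by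
  rw [setIntegral_rlKernel_smul ht]; rfl

theorem integral_rpow_sub_left {γ c t : ℝ} (hγ : 0 < γ) :
    ∫ s in c..t, (t - s) ^ (γ - 1) = (t - c) ^ γ / γ := by
  rw [intervalIntegral.integral_comp_sub_left (fun x : ℝ => x ^ (γ - 1)),
    integral_rpow (Or.inl (by linarith))]
  simp [hγ.ne']

theorem intervalIntegrable_rpow_sub_left {γ c t : ℝ} (hγ : 0 < γ) :
    IntervalIntegrable (fun s => (t - s) ^ (γ - 1)) volume c t := by
  have := (intervalIntegral.intervalIntegrable_rpow' (a := t - c) (b := t - t) (r := γ - 1)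
    (by linarith)).comp_sub_left t
  simpa using this

theorem integrableOn_rlKernel {γ : ℝ} (hγ : 0 < γ) (t a b : ℝ) :
    IntegrableOn (fun s => rlKernel γ (t - s)) (Icc a b) := by
  rcases le_or_gt a t with hat | hat
  · have h1 : IntegrableOn (fun s => rlKernel γ (t - s)) (Ioo a t) := by
      have := (intervalIntegrable_iff_integrableOn_Ioo_of_le hat).1
        (intervalIntegrable_rpow_sub_left (c := a) (t := t) hγ)
      refine this.congr_fun (fun s hs => ?_) measurableSet_Ioo
      simp only [rlKernel_of_pos (sub_pos.2 hs.2)]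
    have h2 : IntegrableOn (fun s => rlKernel γ (t - s)) (Icc a t) :=
      (integrableOn_Icc_iff_integrableOn_Ioo (by simp) (by simp)).2 h1
    have h3 : IntegrableOn (fun s => rlKernel γ (t - s)) (Ici t) := by
      refine integrableOn_zero.congr_fun (fun s hs => ?_) measurableSet_Ici
      exact (rlKernel_of_nonpos (sub_nonpos.2 hs)).symm
    refine (h2.union h3).mono_set fun s hs => ?_
    rcases le_or_gt s t with h | h
    · exact Or.inl ⟨hs.1, h⟩
    · exact Or.inr h.le
  · refine integrableOn_zero.congr_fun (fun s hs => ?_) measurableSet_Icc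
    exact (rlKernel_of_nonpos (by linarith [hs.1])).symm

theorem setIntegral_rlKernel {T t γ : ℝ} (hγ : 0 < γ) (ht : t ∈ Icc 0 T) :
    ∫ s in Icc 0 T, rlKernel γ (t - s) = t ^ γ / γ := by
  have := setIntegral_rlKernel_smul (γ := γ) ht (fun _ => (1 : ℝ))
  simp only [smul_eq_mul, mul_one] at this
  rw [this, integral_rpow_sub_left hγ, sub_zero]

theorem integral_beta {α γ a : ℝ} (hα : 0 < α) (hγ : 0 < γ) (ha : 0 < a) :
    ∫ x in (0 : ℝ)..a, x ^ (γ - 1) * (a - x) ^ (α - 1) =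
      a ^ (γ + α - 1) * (Real.Gamma γ * Real.Gamma α / Real.Gamma (γ + α)) := by
  have h := Complex.betaIntegral_scaled (γ : ℂ) (α : ℂ) ha
  rw [Complex.betaIntegral_eq_Gamma_mul_div _ _ (by simpa) (by simpa), ← Complex.ofReal_add,
    Complex.Gamma_ofReal, Complex.Gamma_ofReal, Complex.Gamma_ofReal] at h
  have h2 : ∫ x in (0 : ℝ)..a, (x : ℂ) ^ ((γ : ℂ) - 1) * ((a : ℂ) - x) ^ ((α : ℂ) - 1) =
      ∫ x in (0 : ℝ)..a, ((x ^ (γ - 1) * (a - x) ^ (α - 1) : ℝ) : ℂ) := by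
    refine intervalIntegral.integral_congr fun x hx => ?_
    rw [uIcc_of_le ha.le] at hx
    rw [Complex.ofReal_mul, Complex.ofReal_cpow hx.1, Complex.ofReal_cpow (sub_nonneg.2 hx.2)]
    push_cast; rfl
  rw [h2, intervalIntegral.integral_ofReal] at h
  have h3 : ((a : ℂ) ^ (((γ + α : ℝ) : ℂ) - 1)) = ((a ^ (γ + α - 1) : ℝ) : ℂ) := by
    rw [Complex.ofReal_cpow ha.le]; push_cast; rfl
  rw [h3] at h
  exact_mod_cast h

/-- A shift by r turns this into a Beta integral, in which t - r appears to the power α + γ - 1 = 0.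
The value is therefore independent of r and t, which is the semigroup property at the level of
kernels. -/
theorem setIntegral_rlKernel_mul {T t r α γ : ℝ} (hα : 0 < α) (hγ : 0 < γ) (hαγ : α + γ = 1)
    (hr : 0 ≤ r) (hrt : r < t) (ht : t ≤ T) :
    ∫ s in Icc 0 T, rlKernel α (t - s) * rlKernel γ (s - r) =
      Real.Gamma α * Real.Gamma γ := by
  rw [setIntegral_Icc_eq_intervalIntegral (c := r) (t := t) hr hrt.le ht
    (g := fun s => (s - r) ^ (γ - 1) * (t - r - (s - r)) ^ (α - 1))]
  · rw [intervalIntegral.integral_comp_sub_right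
      (fun x : ℝ => x ^ (γ - 1) * (t - r - x) ^ (α - 1)), sub_self,
      integral_beta hα hγ (sub_pos.2 hrt), add_comm γ, hαγ, Real.Gamma_one, sub_self,
      Real.rpow_zero]
    ring
  · intro s hs
    rw [rlKernel_of_pos (sub_pos.2 hs.2), rlKernel_of_pos (sub_pos.2 hs.1), mul_comm]
    congr 2; ring
  · intro s hs
    by_cases h1 : r < s
    · rw [rlKernel_of_nonpos (sub_nonpos.2 (not_lt.1 fun h2 => hs ⟨h1.le, h2.le⟩)), zero_mul]
    · rw [rlKernel_of_nonpos (sub_nonpos.2 (not_lt.1 h1)), mul_zero]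

theorem rlKernel_mul_eq_zero {t r s α γ : ℝ} (h : t ≤ r) :
    rlKernel α (t - s) * rlKernel γ (s - r) = 0 := by
  rcases le_or_gt s r with h1 | h1
  · rw [rlKernel_of_nonpos (sub_nonpos.2 h1), mul_zero]
  · rw [rlKernel_of_nonpos (by linarith), zero_mul]

theorem integrableOn_rlKernel_mul {T t r α γ : ℝ} (hα : 0 < α) (hγ : 0 < γ) (hαγ : α + γ = 1)
    (hr : 0 ≤ r) (ht : t ≤ T) :
    IntegrableOn (fun s => rlKernel α (t - s) * rlKernel γ (s - r)) (Icc 0 T) := by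
  rcases lt_or_ge r t with h | h
  · by_contra hcon
    have h1 := setIntegral_rlKernel_mul hα hγ hαγ hr h ht
    rw [integral_undef hcon] at h1
    have := mul_pos (Real.Gamma_pos_of_pos hα) (Real.Gamma_pos_of_pos hγ)
    linarith
  · simp_rw [rlKernel_mul_eq_zero h]
    exact integrableOn_zero

variable {N : ℕ}

/-- This justifies Fubini in the semigroup property. Integrating the norm first over the
intermediate variable s leaves Γ(α)Γ(γ)‖f r‖ on r < t, which is integrable. -/
theorem integrable_rlKernel_prod {T t α γ : ℝ} (hα : 0 < α) (hγ : 0 < γ) (hαγ : α + γ = 1)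
    (ht : t ∈ Icc 0 T) {f : ℝ → EuclideanSpace ℝ (Fin N)} (hf : IntegrableOn f (Icc 0 T)) :
    Integrable (fun z : ℝ × ℝ => (rlKernel α (t - z.1) * rlKernel γ (z.1 - z.2)) • f z.2)
      ((volume.restrict (Icc 0 T)).prod (volume.restrict (Icc 0 T))) := by
  have hk : Measurable fun z : ℝ × ℝ => rlKernel α (t - z.1) * rlKernel γ (z.1 - z.2) := by
    fun_prop
  have hmeas : AEStronglyMeasurable
      (fun z : ℝ × ℝ => (rlKernel α (t - z.1) * rlKernel γ (z.1 - z.2)) • f z.2)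
      ((volume.restrict (Icc 0 T)).prod (volume.restrict (Icc 0 T))) :=
    hk.aestronglyMeasurable.smul hf.1.comp_snd
  rw [integrable_prod_iff' hmeas]
  constructor
  · filter_upwards [ae_restrict_mem measurableSet_Icc] with r hr
    exact (integrableOn_rlKernel_mul hα hγ hαγ hr.1 ht.2).smul_const (f r)
  · have h1 : Integrable (fun r => (Iio t).indicator
        (fun r => Real.Gamma α * Real.Gamma γ * ‖f r‖) r) (volume.restrict (Icc 0 T)) :=
      (hf.norm.const_mul _).indicator measurableSet_Iio
    refine h1.congr ?_
    filter_upwards [ae_restrict_mem measurableSet_Icc] with r hr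
    have h2 : ∀ s, ‖(rlKernel α (t - s) * rlKernel γ (s - r)) • f r‖ =
        rlKernel α (t - s) * rlKernel γ (s - r) * ‖f r‖ := fun s => by
      rw [norm_smul, Real.norm_of_nonneg (mul_nonneg (rlKernel_nonneg _ _) (rlKernel_nonneg _ _))]
    simp_rw [h2]
    rw [integral_mul_const]
    rcases lt_or_ge r t with h | h
    · rw [indicator_of_mem (show r ∈ Iio t from h), setIntegral_rlKernel_mul hα hγ hαγ hr.1 h ht.2]
    · rw [indicator_of_notMem (show r ∉ Iio t from not_lt.2 h)]
      simp_rw [rlKernel_mul_eq_zero h]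
      simp

/-- Values of the fractional integral at every point, not just almost every point, depend only on
the class of the integrand, so I^α w is a genuine function for w ∈ L^p. -/
theorem rlIntegral_congr {T t γ : ℝ} {f g : ℝ → EuclideanSpace ℝ (Fin N)}
    (hfg : ∀ᵐ s ∂(volume.restrict (Icc 0 T)), f s = g s) (ht : t ∈ Icc 0 T) :
    rlIntegral γ f t = rlIntegral γ g t := by
  rw [rlIntegral_eq γ ht, rlIntegral_eq γ ht]
  congr 1
  refine integral_congr_ae ?_
  filter_upwards [hfg] with s hs
  rw [hs]

/-- Semigroup property `I^α I^γ = I^1` for `α + γ = 1`. -/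
theorem rlIntegral_rlIntegral {T t α γ : ℝ} (hα : 0 < α) (hγ : 0 < γ) (hαγ : α + γ = 1)
    (ht : t ∈ Icc 0 T) {f : ℝ → EuclideanSpace ℝ (Fin N)} (hf : IntegrableOn f (Icc 0 T)) :
    rlIntegral α (rlIntegral γ f) t = ∫ s in (0 : ℝ)..t, f s := by
  have hα' := (Real.Gamma_pos_of_pos hα).ne'
  have hγ' := (Real.Gamma_pos_of_pos hγ).ne'
  have h1 : ∫ s in Icc 0 T, rlKernel α (t - s) • rlIntegral γ f s =
      (1 / Real.Gamma γ) • ∫ s in Icc 0 T, ∫ r in Icc 0 T,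
        (rlKernel α (t - s) * rlKernel γ (s - r)) • f r := by
    rw [← integral_smul]
    refine setIntegral_congr_fun measurableSet_Icc fun s hs => ?_
    rw [rlIntegral_eq γ hs, smul_comm, ← integral_smul]
    simp_rw [smul_smul]
  rw [rlIntegral_eq α ht, h1, integral_integral_swap
    (f := fun s r => (rlKernel α (t - s) * rlKernel γ (s - r)) • f r)
    (integrable_rlKernel_prod hα hγ hαγ ht hf)]
  have h2 : ∫ r in Icc 0 T, ∫ s in Icc 0 T, (rlKernel α (t - s) * rlKernel γ (s - r)) • f r =
      (Real.Gamma α * Real.Gamma γ) • ∫ s in (0 : ℝ)..t, f s := by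
    have h3 := setIntegral_rlKernel_smul (γ := 1) ht f
    simp only [sub_self, Real.rpow_zero, one_smul] at h3
    rw [← h3, ← integral_smul]
    refine setIntegral_congr_fun measurableSet_Icc fun r hr => ?_
    rw [integral_smul_const]
    rcases lt_or_ge r t with h | h
    · rw [setIntegral_rlKernel_mul hα hγ hαγ hr.1 h ht.2, rlKernel_of_pos (sub_pos.2 h)]
      simp
    · simp_rw [rlKernel_mul_eq_zero h]
      rw [rlKernel_of_nonpos (sub_nonpos.2 h)]
      simp
  rw [h2, smul_smul, smul_smul]
  convert one_smul ℝ _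
  field_simp

theorem rlIntegral_one {t : ℝ} (f : ℝ → EuclideanSpace ℝ (Fin N)) :
    rlIntegral 1 f t = ∫ s in (0 : ℝ)..t, f s := by
  simp [rlIntegral]

theorem aestronglyMeasurable_rlIntegral {T γ : ℝ} {f : ℝ → EuclideanSpace ℝ (Fin N)}
    (hf : IntegrableOn f (Icc 0 T)) :
    AEStronglyMeasurable (rlIntegral γ f) (volume.restrict (Icc 0 T)) := by
  have hk : Measurable fun z : ℝ × ℝ => rlKernel γ (z.1 - z.2) := by fun_prop
  have h : AEStronglyMeasurable (fun z : ℝ × ℝ => rlKernel γ (z.1 - z.2) • f z.2)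
      ((volume.restrict (Icc 0 T)).prod (volume.restrict (Icc 0 T))) :=
    hk.aestronglyMeasurable.smul hf.1.comp_snd
  refine (h.integral_prod_right'.const_smul (1 / Real.Gamma γ)).congr ?_
  filter_upwards [ae_restrict_mem measurableSet_Icc] with t ht
  exact (rlIntegral_eq γ ht f).symm

/-- With γ = 1 - α and f = φ' this gives the factor t^(1-α)/Γ(2-α) from which the constant G arises.
-/
theorem norm_rlIntegral_le_of_bounded {T t γ C : ℝ} (hγ : 0 < γ) (ht : t ∈ Icc 0 T)
    {f : ℝ → EuclideanSpace ℝ (Fin N)} (hf : ∀ s ∈ Icc 0 T, ‖f s‖ ≤ C) :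
    ‖rlIntegral γ f t‖ ≤ C * (t ^ γ / Real.Gamma (γ + 1)) := by
  have hΓ := Real.Gamma_pos_of_pos hγ
  rw [rlIntegral_eq γ ht, norm_smul, Real.norm_of_nonneg (by positivity),
    Real.Gamma_add_one hγ.ne']
  have h1 : ‖∫ s in Icc 0 T, rlKernel γ (t - s) • f s‖ ≤ ∫ s in Icc 0 T, rlKernel γ (t - s) * C := by
    refine norm_integral_le_of_norm_le ((integrableOn_rlKernel hγ t 0 T).mul_const C) ?_
    filter_upwards [ae_restrict_mem measurableSet_Icc] with s hs
    rw [norm_smul, Real.norm_of_nonneg (rlKernel_nonneg _ _)]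
    exact mul_le_mul_of_nonneg_left (hf s hs) (rlKernel_nonneg _ _)
  rw [integral_mul_const, setIntegral_rlKernel hγ ht] at h1
  calc _ ≤ 1 / Real.Gamma γ * (t ^ γ / γ * C) := by gcongr
    _ = _ := by field_simp

/-! ### Fractional integrals of L^p functions: embedding and Hölder continuity -/

variable {N : ℕ}

theorem conjExp_holderConjugate {p : ℝ} (hp : 1 < p) : p.HolderConjugate (conjExp p) :=
  Real.HolderConjugate.conjExponent hp

/-- The exponent `α q - q + 1`. -/
theorem kernelExp_pos {α p : ℝ} (hp : 1 < p) (hα : 1 / p < α) :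
    0 < α * conjExp p - conjExp p + 1 := by
  have h1 : (1 : ℝ) - 1 / p = 1 / conjExp p := by
    have := (conjExp_holderConjugate hp).inv_add_inv_eq_one
    simp only [one_div]; linarith
  have hq : 0 < conjExp p := (conjExp_holderConjugate hp).symm.pos
  have h2 : 1 - α < 1 / conjExp p := by linarith
  rw [lt_div_iff₀ hq] at h2
  linarith

theorem kernelExp_div {α p : ℝ} (hp : 1 < p) :
    (α * conjExp p - conjExp p + 1) * (1 / conjExp p) = α - 1 / p := by
  have h1 : (1 : ℝ) - 1 / p = 1 / conjExp p := by
    have := (conjExp_holderConjugate hp).inv_add_inv_eq_one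
    simp only [one_div]; linarith
  have hq : 0 < conjExp p := (conjExp_holderConjugate hp).symm.pos
  have : (α * conjExp p - conjExp p + 1) * (1 / conjExp p) = α - 1 + 1 / conjExp p := by
    field_simp
  rw [this, ← h1]; ring

/-- The q-th power of a kernel is again a kernel, now of order α q - q + 1. For the conjugate
exponent q this order is positive exactly when α > 1/p, so L^q norms of kernels reduce to the
integral already computed. -/
theorem rlKernel_rpow {α q : ℝ} (hq : 0 < q) (r : ℝ) :
    rlKernel α r ^ q = rlKernel (α * q - q + 1) r := by
  rcases lt_or_ge 0 r with h | h
  · rw [rlKernel_of_pos h, rlKernel_of_pos h, ← Real.rpow_mul h.le]; congr 1; ring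
  · rw [rlKernel_of_nonpos h, rlKernel_of_nonpos h, Real.zero_rpow hq.ne']

theorem memLp_rlKernel {α p T t : ℝ} (hp : 1 < p) (hα : 1 / p < α) :
    MemLp (fun s => rlKernel α (t - s)) (ENNReal.ofReal (conjExp p))
      (volume.restrict (Icc 0 T)) := by
  have hq : 0 < conjExp p := (conjExp_holderConjugate hp).symm.pos
  have hm : Measurable fun s => rlKernel α (t - s) := by fun_prop
  rw [← integrable_norm_rpow_iff hm.aestronglyMeasurable (by simpa) (by simp)]
  refine (integrableOn_rlKernel (kernelExp_pos hp hα) t 0 T).congr (Eventually.of_forall fun s => ?_)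
  simp only
  rw [Real.norm_of_nonneg (rlKernel_nonneg _ _), ENNReal.toReal_ofReal hq.le, rlKernel_rpow hq]

theorem integrable_smul_of_memLp {μ : Measure ℝ} {p : ℝ} (hp : 1 < p) {k : ℝ → ℝ}
    {w : ℝ → EuclideanSpace ℝ (Fin N)} (hk : MemLp k (ENNReal.ofReal (conjExp p)) μ)
    (hw : MemLp w (ENNReal.ofReal p) μ) : Integrable (fun s => k s • w s) μ := by
  have hpq := conjExp_holderConjugate hp
  have := hpq.symm.ennrealOfReal
  exact memLp_one_iff_integrable.1 (hw.smul hk)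

theorem norm_integral_smul_le {μ : Measure ℝ} {p : ℝ} (hp : 1 < p) {k : ℝ → ℝ}
    {w : ℝ → EuclideanSpace ℝ (Fin N)} (hk : MemLp k (ENNReal.ofReal (conjExp p)) μ)
    (hw : MemLp w (ENNReal.ofReal p) μ) :
    ‖∫ s, k s • w s ∂μ‖ ≤
      (∫ s, |k s| ^ conjExp p ∂μ) ^ (1 / conjExp p) * (∫ s, ‖w s‖ ^ p ∂μ) ^ (1 / p) := by
  have hpq := conjExp_holderConjugate hp
  refine (norm_integral_le_integral_norm _).trans ?_
  have := integral_mul_le_Lp_mul_Lq_of_nonneg hpq.symm (μ := μ) (f := fun s => |k s|)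
    (g := fun s => ‖w s‖) (Eventually.of_forall fun s => abs_nonneg _)
    (Eventually.of_forall fun s => norm_nonneg _) hk.norm hw.norm
  simpa only [norm_smul, Real.norm_eq_abs] using this

theorem integrableOn_rlKernel_smul {α p T t : ℝ} (hp : 1 < p) (hα : 1 / p < α)
    {w : ℝ → EuclideanSpace ℝ (Fin N)}
    (hw : MemLp w (ENNReal.ofReal p) (volume.restrict (Icc 0 T))) :
    IntegrableOn (fun s => rlKernel α (t - s) • w s) (Icc 0 T) :=
  integrable_smul_of_memLp hp (memLp_rlKernel hp hα) hw

theorem rlIntegral_add {α p T t : ℝ} (hp : 1 < p) (hα : 1 / p < α) (ht : t ∈ Icc 0 T)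
    {w v : ℝ → EuclideanSpace ℝ (Fin N)}
    (hw : MemLp w (ENNReal.ofReal p) (volume.restrict (Icc 0 T)))
    (hv : MemLp v (ENNReal.ofReal p) (volume.restrict (Icc 0 T))) :
    rlIntegral α (fun s => w s + v s) t = rlIntegral α w t + rlIntegral α v t := by
  rw [rlIntegral_eq α ht, rlIntegral_eq α ht, rlIntegral_eq α ht, ← smul_add,
    ← integral_add (integrableOn_rlKernel_smul hp hα hw) (integrableOn_rlKernel_smul hp hα hv)]
  simp_rw [smul_add]

theorem rlIntegral_smul (α t c : ℝ) (w : ℝ → EuclideanSpace ℝ (Fin N)) :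
    rlIntegral α (fun s => c • w s) t = c • rlIntegral α w t := by
  simp only [rlIntegral]
  simp_rw [smul_comm _ c, intervalIntegral.integral_smul]
  rw [smul_comm]

theorem gammaConst_pos {α p : ℝ} (hp : 1 < p) (hα : 1 / p < α) : 0 < gammaConst α p := by
  have h0 : 0 < 1 / p := by positivity
  exact mul_pos (Real.Gamma_pos_of_pos (h0.trans hα)) (Real.rpow_pos_of_pos (kernelExp_pos hp hα) _)

theorem embConst_pos {T α p : ℝ} (hT : 0 < T) (hp : 1 < p) (hα : 1 / p < α) :
    0 < embConst T α p := div_pos (Real.rpow_pos_of_pos hT _) (gammaConst_pos hp hα)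

/-- The embedding `‖I^α w‖_∞ ≤ K ‖w‖_p`. -/
theorem norm_rlIntegral_le {α p T t : ℝ} (hp : 1 < p) (hα : 1 / p < α) (ht : t ∈ Icc 0 T)
    {w : ℝ → EuclideanSpace ℝ (Fin N)}
    (hw : MemLp w (ENNReal.ofReal p) (volume.restrict (Icc 0 T))) :
    ‖rlIntegral α w t‖ ≤ embConst T α p * (∫ s in Icc 0 T, ‖w s‖ ^ p) ^ (1 / p) := by
  have hq : 0 < conjExp p := (conjExp_holderConjugate hp).symm.pos
  have h0 : 0 < α := lt_trans (by positivity) hα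
  have hΓ := Real.Gamma_pos_of_pos h0
  have hm := kernelExp_pos hp hα
  rw [rlIntegral_eq α ht, norm_smul, Real.norm_of_nonneg (by positivity)]
  have h1 := norm_integral_smul_le hp (memLp_rlKernel (t := t) hp hα) hw
  simp_rw [abs_of_nonneg (rlKernel_nonneg _ _), rlKernel_rpow hq] at h1
  rw [setIntegral_rlKernel hm ht] at h1
  have h2 : (t ^ (α * conjExp p - conjExp p + 1) / (α * conjExp p - conjExp p + 1)) ^
      (1 / conjExp p) ≤ T ^ (α - 1 / p) / (α * conjExp p - conjExp p + 1) ^ (1 / conjExp p) := by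
    rw [← kernelExp_div (α := α) hp, Real.rpow_mul (ht.1.trans ht.2), ← Real.div_rpow
      (Real.rpow_nonneg (ht.1.trans ht.2) _) hm.le]
    have := Real.rpow_le_rpow ht.1 ht.2 hm.le
    have := Real.rpow_nonneg ht.1 (α * conjExp p - conjExp p + 1)
    gcongr
  have h3 : 0 ≤ (∫ s in Icc 0 T, ‖w s‖ ^ p) ^ (1 / p) := by positivity
  calc _ ≤ 1 / Real.Gamma α * (T ^ (α - 1 / p) /
        (α * conjExp p - conjExp p + 1) ^ (1 / conjExp p) *
        (∫ s in Icc 0 T, ‖w s‖ ^ p) ^ (1 / p)) := by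
        refine mul_le_mul_of_nonneg_left (h1.trans ?_) (by positivity)
        exact mul_le_mul_of_nonneg_right h2 h3
    _ = _ := by
        unfold embConst gammaConst
        rw [div_mul_eq_div_div]
        ring

/-- For s < t the kernel at t dominates the kernel at t' because α ≤ 1, and superadditivity of x ↦
x^q gives (x - y)^q ≤ x^q - y^q. For s ≥ t only the kernel at t' survives. The integral of the first
part is explicit and produces t^m/m - t'^m/m ≤ 0, which may be dropped. -/
theorem setIntegral_rlKernel_sub_rpow_le {α p T t t' : ℝ} (hp : 1 < p) (hα : 1 / p < α)
    (hα1 : α ≤ 1) (h0 : 0 ≤ t) (htt : t ≤ t') (hT : t' ≤ T) :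
    ∫ s in Icc 0 T, |rlKernel α (t' - s) - rlKernel α (t - s)| ^ conjExp p ≤
      2 * (t' - t) ^ (α * conjExp p - conjExp p + 1) / (α * conjExp p - conjExp p + 1) := by
  have hq1 : 1 < conjExp p := (conjExp_holderConjugate hp).symm.lt
  have hq : 0 < conjExp p := by linarith
  have hm := kernelExp_pos hp hα
  set m := α * conjExp p - conjExp p + 1 with hmdef
  have hi := fun r => integrableOn_rlKernel hm r 0 T
  -- The coefficient 2 merges both cases into one formula: for s ≥ t the difference of kernels
  -- equals minus the kernel at t', and adding twice that kernel restores it with a plus sign.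
  have hpt : ∀ s, |rlKernel α (t' - s) - rlKernel α (t - s)| ^ conjExp p ≤
      rlKernel m (t - s) - rlKernel m (t' - s) +
        2 * (Ici t).indicator (fun s => rlKernel m (t' - s)) s := by
    intro s
    simp_rw [hmdef, ← rlKernel_rpow hq]
    rcases lt_or_ge s t with h | h
    · rw [indicator_of_notMem (show s ∉ Ici t from not_le.2 h)]
      have h1 : rlKernel α (t' - s) ≤ rlKernel α (t - s) := by
        rw [rlKernel_of_pos (sub_pos.2 h), rlKernel_of_pos (sub_pos.2 (h.trans_le htt))]
        exact Real.rpow_le_rpow_of_nonpos (sub_pos.2 h) (by linarith) (by linarith)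
      have h2 := Real.add_rpow_le_rpow_add (sub_nonneg.2 h1) (rlKernel_nonneg α (t' - s)) hq1.le
      rw [sub_add_cancel] at h2
      rw [abs_sub_comm, abs_of_nonneg (sub_nonneg.2 h1)]
      linarith
    · rw [rlKernel_of_nonpos (sub_nonpos.2 h), sub_zero, abs_of_nonneg (rlKernel_nonneg _ _),
        Real.zero_rpow hq.ne', indicator_of_mem (show s ∈ Ici t from h)]
      linarith
  have hind : IntegrableOn ((Ici t).indicator fun s => rlKernel m (t' - s)) (Icc 0 T) :=
    (hi t').indicator measurableSet_Ici
  have hindI : ∫ s in Icc 0 T, (Ici t).indicator (fun s => rlKernel m (t' - s)) s =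
      (t' - t) ^ m / m := by
    rw [← integral_rpow_sub_left (γ := m) (c := t) (t := t') hm]
    refine setIntegral_Icc_eq_intervalIntegral h0 htt hT (fun s hs => ?_) (fun s hs => ?_)
    · rw [indicator_of_mem (show s ∈ Ici t from hs.1.le), rlKernel_of_pos (sub_pos.2 hs.2)]
    · by_cases h : t ≤ s
      · rw [indicator_of_mem (show s ∈ Ici t from h),
          rlKernel_of_nonpos (sub_nonpos.2 (not_lt.1 fun h' => hs ⟨h, h'.le⟩))]
      · rw [indicator_of_notMem (show s ∉ Ici t from h)]
  have hbi : IntegrableOn (fun s => rlKernel m (t - s) - rlKernel m (t' - s) +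
        2 * (Ici t).indicator (fun s => rlKernel m (t' - s)) s) (Icc 0 T) :=
    ((hi t).sub (hi t')).add (hind.const_mul 2)
  calc _ ≤ ∫ s in Icc 0 T, (rlKernel m (t - s) - rlKernel m (t' - s) +
        2 * (Ici t).indicator (fun s => rlKernel m (t' - s)) s) := by
        refine integral_mono_of_nonneg (Eventually.of_forall fun s => ?_) hbi
          (Eventually.of_forall hpt)
        positivity
    _ = t ^ m / m - t' ^ m / m + 2 * ((t' - t) ^ m / m) := by
        rw [integral_add (f := fun s => rlKernel m (t - s) - rlKernel m (t' - s))
          ((hi t).sub (hi t')) (hind.const_mul 2), integral_sub (hi t) (hi t'),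
          integral_const_mul, hindI, setIntegral_rlKernel hm ⟨h0, htt.trans hT⟩,
          setIntegral_rlKernel hm ⟨h0.trans htt, hT⟩]
    _ ≤ _ := by
        have : t ^ m / m ≤ t' ^ m / m := by gcongr
        rw [mul_div_assoc]; linarith

/-- Hölder continuity of `I^α w`, uniform for `w` in bounded sets of `L^p`. -/
theorem norm_rlIntegral_sub_le {α p T t t' : ℝ} (hp : 1 < p) (hα : 1 / p < α)
    (hα1 : α ≤ 1) (h0 : 0 ≤ t) (htt : t ≤ t') (hT : t' ≤ T)
    {w : ℝ → EuclideanSpace ℝ (Fin N)}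
    (hw : MemLp w (ENNReal.ofReal p) (volume.restrict (Icc 0 T))) :
    ‖rlIntegral α w t' - rlIntegral α w t‖ ≤ 1 / Real.Gamma α *
      ((2 * (t' - t) ^ (α * conjExp p - conjExp p + 1) / (α * conjExp p - conjExp p + 1)) ^
        (1 / conjExp p) * (∫ s in Icc 0 T, ‖w s‖ ^ p) ^ (1 / p)) := by
  have hq : 0 < conjExp p := (conjExp_holderConjugate hp).symm.pos
  have hΓ := Real.Gamma_pos_of_pos (lt_trans (by positivity) hα)
  rw [rlIntegral_eq α ⟨h0.trans htt, hT⟩, rlIntegral_eq α ⟨h0, htt.trans hT⟩, ← smul_sub,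
    ← integral_sub (integrableOn_rlKernel_smul hp hα hw) (integrableOn_rlKernel_smul hp hα hw),
    norm_smul, Real.norm_of_nonneg (by positivity)]
  simp_rw [← sub_smul]
  refine mul_le_mul_of_nonneg_left ((norm_integral_smul_le hp
    ((memLp_rlKernel hp hα).sub (memLp_rlKernel hp hα)) hw).trans ?_) (by positivity)
  have := setIntegral_rlKernel_sub_rpow_le hp hα hα1 h0 htt hT
  refine mul_le_mul_of_nonneg_right ?_ (by positivity)
  exact Real.rpow_le_rpow (integral_nonneg fun s => by positivity) this (by positivity)

theorem memLp_integrableOn {p T : ℝ} (hp : 1 < p) {w : ℝ → EuclideanSpace ℝ (Fin N)}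
    (hw : MemLp w (ENNReal.ofReal p) (volume.restrict (Icc 0 T))) : IntegrableOn w (Icc 0 T) :=
  hw.integrable (by rw [← ENNReal.ofReal_one]; exact ENNReal.ofReal_le_ofReal hp.le)

theorem continuousOn_rlIntegral {α p T : ℝ} (hp : 1 < p) (hα : 1 / p < α)
    (hα1 : α ≤ 1) {w : ℝ → EuclideanSpace ℝ (Fin N)}
    (hw : MemLp w (ENNReal.ofReal p) (volume.restrict (Icc 0 T))) :
    ContinuousOn (rlIntegral α w) (Icc 0 T) := by
  have hq : 0 < conjExp p := (conjExp_holderConjugate hp).symm.pos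
  have hm := kernelExp_pos hp hα
  set m := α * conjExp p - conjExp p + 1 with hmdef
  let ω : ℝ → ℝ := fun r => 1 / Real.Gamma α *
      ((2 * |r| ^ m / m) ^ (1 / conjExp p) * (∫ s in Icc 0 T, ‖w s‖ ^ p) ^ (1 / p))
  have hω : Continuous ω := by
    have : Continuous fun r : ℝ => |r| ^ m := continuous_abs.rpow_const fun _ => Or.inr hm.le
    have : Continuous fun r : ℝ => (2 * |r| ^ m / m) ^ (1 / conjExp p) :=
      (by fun_prop : Continuous fun r : ℝ => 2 * |r| ^ m / m).rpow_const
        fun _ => Or.inr (by positivity)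
    fun_prop
  have hω0 : ω 0 = 0 := by
    simp [ω, Real.zero_rpow hm.ne', hq.ne']
  intro t ht
  rw [ContinuousWithinAt, tendsto_iff_norm_sub_tendsto_zero]
  have hlim : Tendsto (fun t' => ω (t' - t)) (𝓝[Icc 0 T] t) (𝓝 0) := by
    have : Continuous fun t' => ω (t' - t) := hω.comp (by fun_prop)
    have := this.tendsto t
    rw [sub_self, hω0] at this
    exact this.mono_left nhdsWithin_le_nhds
  refine squeeze_zero' (Eventually.of_forall fun _ => norm_nonneg _) ?_ hlim
  filter_upwards [self_mem_nhdsWithin] with t' ht'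
  simp only [ω]
  rcases le_total t t' with h | h
  · rw [abs_of_nonneg (sub_nonneg.2 h)]
    exact norm_rlIntegral_sub_le hp hα hα1 ht.1 h ht'.2 hw
  · rw [abs_sub_comm, abs_of_nonneg (sub_nonneg.2 h), norm_sub_rev]
    exact norm_rlIntegral_sub_le hp hα hα1 ht'.1 h ht.2 hw

/-! ### Inversion of fractional integrals, and test functions -/

/-- `D^α I^α g = g` almost everywhere. -/
theorem rlDeriv_eq_of_eq_rlIntegral {α T : ℝ} (hα : 0 < α) (hα1 : α ≤ 1)
    {u g : ℝ → EuclideanSpace ℝ (Fin N)} (hg : IntegrableOn g (Icc 0 T))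
    (hu : ∀ t ∈ Icc 0 T, u t = rlIntegral α g t) :
    ∀ᵐ t ∂(volume.restrict (Icc 0 T)), rlDeriv α u t = g t := by
  rcases le_or_gt T 0 with hT | hT
  · have : volume.restrict (Icc 0 T) = 0 := by
      rw [Measure.restrict_eq_zero]; simp [hT]
    rw [this]; simp
  have hgi : IntervalIntegrable g volume 0 T :=
    (intervalIntegrable_iff_integrableOn_Icc_of_le hT.le (by simp)).2 hg
  have hae := hgi.ae_hasDerivAt_integral
  have hne : ∀ᵐ t : ℝ, t ≠ 0 ∧ t ≠ T := by
    have h1 : ∀ c : ℝ, ∀ᵐ s : ℝ, s ≠ c := fun c => by simp [ae_iff, measure_singleton]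
    filter_upwards [h1 0, h1 T] with s a b using ⟨a, b⟩
  rw [ae_restrict_iff' measurableSet_Icc]
  filter_upwards [hae, hne] with t ht hne htI
  rw [uIcc_of_le hT.le] at ht
  have hd := ht htI 0 ⟨le_rfl, hT.le⟩
  have htI' : t ∈ Ioo 0 T := ⟨lt_of_le_of_ne htI.1 hne.1.symm, lt_of_le_of_ne htI.2 hne.2⟩
  have hnhds : ∀ᶠ s in 𝓝 t, s ∈ Ioo 0 T := isOpen_Ioo.mem_nhds htI'
  have huae : ∀ᵐ s ∂(volume.restrict (Icc 0 T)), u s = rlIntegral α g s := by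
    filter_upwards [ae_restrict_mem measurableSet_Icc] with s hs using hu s hs
  -- For α < 1 the derivative is the first derivative of I^(1-α) I^α g = ∫ g, and Lebesgue's
  -- differentiation theorem applies. For α = 1 the floor is 1, so `rlDeriv` is the second
  -- derivative of the integral of u. The first differentiation returns u by continuity, and the
  -- second is again Lebesgue's theorem.
  rcases hα1.lt_or_eq with hα1 | rfl
  · have hfl : ⌊α⌋₊ = 0 := Nat.floor_eq_zero.2 hα1
    unfold rlDeriv
    rw [hfl, zero_add, iteratedDeriv_one]
    refine (hd.congr_of_eventuallyEq ?_).deriv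
    filter_upwards [hnhds] with s hs
    have hs' : s ∈ Icc 0 T := Ioo_subset_Icc_self hs
    rw [Nat.cast_one, rlIntegral_congr huae hs']
    exact rlIntegral_rlIntegral (sub_pos.2 hα1) hα (by ring) hs' hg
  · have hfl : ⌊(1 : ℝ)⌋₊ = 1 := Nat.floor_one
    unfold rlDeriv
    rw [hfl, iteratedDeriv_succ, iteratedDeriv_one]
    refine (hd.congr_of_eventuallyEq ?_).deriv
    have hcont : ContinuousOn (fun s => ∫ r in (0 : ℝ)..s, g r) (Icc 0 T) := by
      have := intervalIntegral.continuousOn_primitive_interval' (a := 0) hgi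
        (by simp)
      rwa [uIcc_of_le hT.le] at this
    filter_upwards [hnhds] with s hs
    -- Since u is known only on [0,T], the identity for the inner derivative is established at
    -- interior points near t, which is enough for the outer derivative.
    have hs' : s ∈ Icc 0 T := Ioo_subset_Icc_self hs
    have hs2 : ∀ᶠ r in 𝓝 s, r ∈ Ioo 0 T := isOpen_Ioo.mem_nhds hs
    have hc : ∀ r ∈ Icc 0 T, u r = ∫ y in (0 : ℝ)..r, g y := fun r hr => by
      rw [hu r hr, rlIntegral_one]
    have hcu : ContinuousOn u (Icc 0 T) := hcont.congr hc
    have hu1 : rlIntegral (((1 + 1 : ℕ) : ℝ) - 1) u = fun r => ∫ y in (0 : ℝ)..r, u y := by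
      ext1 r
      rw [← rlIntegral_one]
      norm_num
    rw [hu1, ← hc s hs']
    refine (intervalIntegral.integral_hasDerivAt_right ?_ ?_ ?_).deriv
    · refine (hcu.mono ?_).intervalIntegrable
      rw [uIcc_of_le hs.1.le]
      exact Icc_subset_Icc le_rfl hs.2.le
    · exact (hcu.mono Ioo_subset_Icc_self).stronglyMeasurableAtFilter isOpen_Ioo s hs
    · exact hcu.continuousAt (Icc_mem_nhds hs.1 hs.2)

theorem IsTestFunction.congr {T : ℝ} {φ ψ : ℝ → EuclideanSpace ℝ (Fin N)} (hT : 0 ≤ T)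
    (hφ : IsTestFunction T φ) (h : ∀ t ∈ Icc 0 T, ψ t = φ t) : IsTestFunction T ψ :=
  ⟨hφ.smooth.congr h, by rw [h 0 ⟨le_rfl, hT⟩, hφ.left_eq_zero],
    by rw [h T ⟨hT, le_rfl⟩, hφ.right_eq_zero]⟩

theorem IsTestFunction.continuousOn_derivWithin {T : ℝ} {φ : ℝ → EuclideanSpace ℝ (Fin N)}
    (hT : 0 < T) (hφ : IsTestFunction T φ) : ContinuousOn (derivWithin φ (Icc 0 T)) (Icc 0 T) :=
  hφ.smooth.continuousOn_derivWithin (uniqueDiffOn_Icc hT) (by simp)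

theorem IsTestFunction.eq_integral {T t : ℝ} {φ : ℝ → EuclideanSpace ℝ (Fin N)}
    (hT : 0 < T) (hφ : IsTestFunction T φ) (ht : t ∈ Icc 0 T) :
    ∫ s in (0 : ℝ)..t, derivWithin φ (Icc 0 T) s = φ t := by
  have hsub : Icc 0 t ⊆ Icc 0 T := Icc_subset_Icc le_rfl ht.2
  rw [intervalIntegral.integral_eq_sub_of_hasDerivAt_of_le ht.1
    (hφ.smooth.continuousOn.mono hsub) ?_ ?_, hφ.left_eq_zero, sub_zero]
  · intro s hs
    have hs' : s ∈ Ioo 0 T := ⟨hs.1, hs.2.trans_le ht.2⟩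
    exact ((hφ.smooth.differentiableOn (by simp)) s
      (Ioo_subset_Icc_self hs')).hasDerivWithinAt.hasDerivAt (Icc_mem_nhds hs'.1 hs'.2)
  · refine ((hφ.continuousOn_derivWithin hT).mono ?_).intervalIntegrable
    rwa [uIcc_of_le ht.1]

/-- A test function is a fractional integral of a bounded function. -/
theorem IsTestFunction.exists_eq_rlIntegral {T α C : ℝ} (hT : 0 < T) (hα : 0 < α) (hα1 : α ≤ 1)
    {φ : ℝ → EuclideanSpace ℝ (Fin N)} (hφ : IsTestFunction T φ)
    (hC : ∀ t ∈ Icc 0 T, ‖derivWithin φ (Icc 0 T) t‖ ≤ C) :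
    ∃ g : ℝ → EuclideanSpace ℝ (Fin N), AEStronglyMeasurable g (volume.restrict (Icc 0 T)) ∧
      (∀ t ∈ Icc 0 T, ‖g t‖ ≤ C * (t ^ (1 - α) / Real.Gamma (2 - α))) ∧
      ∀ t ∈ Icc 0 T, φ t = rlIntegral α g t := by
  have hc := hφ.continuousOn_derivWithin hT
  have hi : IntegrableOn (derivWithin φ (Icc 0 T)) (Icc 0 T) := hc.integrableOn_Icc
  rcases hα1.lt_or_eq with hα1 | rfl
  -- As φ(0) = 0, φ is the integral of φ', which is I^α I^(1-α) φ'. So g = I^(1-α) φ', the Caputo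
  -- derivative.
  · refine ⟨rlIntegral (1 - α) (derivWithin φ (Icc 0 T)), aestronglyMeasurable_rlIntegral hi,
      fun t ht => ?_, fun t ht => ?_⟩
    · have := norm_rlIntegral_le_of_bounded (sub_pos.2 hα1) ht hC
      rwa [show 1 - α + 1 = 2 - α by ring] at this
    · rw [rlIntegral_rlIntegral hα (sub_pos.2 hα1) (by ring) ht hi, hφ.eq_integral hT ht]
  · refine ⟨derivWithin φ (Icc 0 T), hi.1, fun t ht => ?_, fun t ht => ?_⟩
    · norm_num
      exact hC t ht
    · rw [rlIntegral_one, hφ.eq_integral hT ht]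

theorem IsTestFunction.exists_bound {T : ℝ} (hT : 0 < T)
    {φ : ℝ → EuclideanSpace ℝ (Fin N)} (hφ : IsTestFunction T φ) :
    ∃ C, ∀ t ∈ Icc 0 T, ‖derivWithin φ (Icc 0 T) t‖ ≤ C :=
  isCompact_Icc.exists_bound_of_continuousOn (hφ.continuousOn_derivWithin hT)

theorem memLp_of_bounded {T C : ℝ} {p : ENNReal} {g : ℝ → EuclideanSpace ℝ (Fin N)}
    (hg : AEStronglyMeasurable g (volume.restrict (Icc 0 T)))
    (hC : ∀ t ∈ Icc 0 T, ‖g t‖ ≤ C) : MemLp g p (volume.restrict (Icc 0 T)) :=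
  MemLp.of_bound hg C ((ae_restrict_mem measurableSet_Icc).mono hC)

/-- D^α φ agrees almost everywhere with the bounded function representing φ, so it lies in L^p and
I^α inverts it. -/
theorem IsTestFunction.memLp_rlDeriv {T α p : ℝ} (hT : 0 < T) (hα : 0 < α) (hα1 : α ≤ 1)
    (hp : 1 < p) {φ : ℝ → EuclideanSpace ℝ (Fin N)} (hφ : IsTestFunction T φ) :
    MemLp (rlDeriv α φ) (ENNReal.ofReal p) (volume.restrict (Icc 0 T)) ∧
      ∀ t ∈ Icc 0 T, φ t = rlIntegral α (rlDeriv α φ) t := by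
  obtain ⟨C, hC⟩ := hφ.exists_bound hT
  have hC0 : 0 ≤ C := (norm_nonneg _).trans (hC 0 ⟨le_rfl, hT.le⟩)
  obtain ⟨g, hgm, hgb, hg⟩ := hφ.exists_eq_rlIntegral hT hα hα1 hC
  have hΓ : 0 < Real.Gamma (2 - α) := Real.Gamma_pos_of_pos (by linarith)
  have hgLp : MemLp g (ENNReal.ofReal p) (volume.restrict (Icc 0 T)) := by
    refine memLp_of_bounded (C := C * (T ^ (1 - α) / Real.Gamma (2 - α))) hgm fun t ht =>
      (hgb t ht).trans ?_
    have := Real.rpow_le_rpow ht.1 ht.2 (sub_nonneg.2 hα1)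
    gcongr
  have hae := rlDeriv_eq_of_eq_rlIntegral hα hα1 (memLp_integrableOn hp hgLp) hg
  refine ⟨hgLp.ae_eq (hae.mono fun t h => h.symm), fun t ht => ?_⟩
  rw [hg t ht, rlIntegral_congr hae ht]

/-- No regularity of u is needed, since the derivative of an arbitrary function is measurable. This
allows D^α u to be handled before u is known to be a fractional integral. -/
theorem measurable_rlDeriv (α : ℝ) (u : ℝ → EuclideanSpace ℝ (Fin N)) :
    StronglyMeasurable (rlDeriv α u) := by
  have : rlDeriv α u = deriv (iteratedDeriv ⌊α⌋₊ (rlIntegral (((⌊α⌋₊ + 1 : ℕ) : ℝ) - α) u)) := by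
    ext1 t
    simp only [rlDeriv, iteratedDeriv_succ]
  rw [this]
  exact stronglyMeasurable_deriv _

/-! ### The fractional derivative space as a closed subspace of L^p -/

variable {N : ℕ}

/-- `L^p([0,T], ℝ^N)`. -/
noncomputable abbrev LpI (N : ℕ) (T p : ℝ) :=
  Lp (EuclideanSpace ℝ (Fin N)) (ENNReal.ofReal p) (volume.restrict (Icc 0 T))

theorem norm_lpI {T p : ℝ} (hp : 1 < p) (w : LpI N T p) :
    ‖w‖ = (∫ s in Icc 0 T, ‖w s‖ ^ p) ^ (1 / p) := by
  have hp0 : 0 < p := by linarith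
  rw [Lp.norm_def, (Lp.memLp w).eLpNorm_eq_integral_rpow_norm (by simpa) (by simp),
    ENNReal.toReal_ofReal (by positivity), ENNReal.toReal_ofReal hp0.le, one_div]

theorem norm_lpI_rpow {T p : ℝ} (hp : 1 < p) (w : LpI N T p) :
    ‖w‖ ^ p = ∫ s in Icc 0 T, ‖w s‖ ^ p := by
  have hp0 : 0 < p := by linarith
  rw [norm_lpI hp, ← Real.rpow_mul (by positivity), one_div, inv_mul_cancel₀ hp0.ne',
    Real.rpow_one]

theorem rlIntegral_lpI_add {T p α t : ℝ} (hp : 1 < p) (hα : 1 / p < α) (ht : t ∈ Icc 0 T)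
    (w v : LpI N T p) : rlIntegral α (w + v : LpI N T p) t =
      rlIntegral α w t + rlIntegral α v t := by
  rw [← rlIntegral_add hp hα ht (Lp.memLp w) (Lp.memLp v)]
  exact rlIntegral_congr (Lp.coeFn_add w v) ht

theorem rlIntegral_lpI_smul {T p α t : ℝ} (ht : t ∈ Icc 0 T) (c : ℝ)
    (w : LpI N T p) : rlIntegral α (c • w : LpI N T p) t = c • rlIntegral α w t := by
  rw [← rlIntegral_smul]
  exact rlIntegral_congr (Lp.coeFn_smul c w) ht

theorem rlIntegral_lpI_zero {T p α t : ℝ} (ht : t ∈ Icc 0 T) :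
    rlIntegral α (0 : LpI N T p) t = 0 := by
  have := rlIntegral_lpI_smul (α := α) ht 0 (0 : LpI N T p)
  rwa [zero_smul, zero_smul] at this

theorem rlIntegral_lpI_sub {T p α t : ℝ} (hp : 1 < p) (hα : 1 / p < α) (ht : t ∈ Icc 0 T)
    (w v : LpI N T p) : rlIntegral α (w - v : LpI N T p) t =
      rlIntegral α w t - rlIntegral α v t := by
  have h := rlIntegral_lpI_add hp hα ht (w - v) v
  rw [sub_add_cancel] at h
  rw [h, add_sub_cancel_right]

theorem norm_rlIntegral_lpI_le {T p α t : ℝ} (hp : 1 < p) (hα : 1 / p < α) (ht : t ∈ Icc 0 T)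
    (w : LpI N T p) : ‖rlIntegral α w t‖ ≤ embConst T α p * ‖w‖ := by
  rw [norm_lpI hp]
  exact norm_rlIntegral_le hp hα ht (Lp.memLp w)

theorem norm_rlIntegral_lpI_sub_le {T p α t : ℝ} (hp : 1 < p) (hα : 1 / p < α) (ht : t ∈ Icc 0 T)
    (w v : LpI N T p) :
    ‖rlIntegral α w t - rlIntegral α v t‖ ≤ embConst T α p * ‖w - v‖ := by
  rw [← rlIntegral_lpI_sub hp hα ht]
  exact norm_rlIntegral_lpI_le hp hα ht _

/-- The functions `w = D^α φ` with `φ` a test function. -/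
noncomputable def testSubmodule (N : ℕ) {T p α : ℝ} (hT : 0 < T) (hp : 1 < p) (hα : 1 / p < α) :
    Submodule ℝ (LpI N T p) where
  carrier := {w | IsTestFunction T (rlIntegral α w)}
  zero_mem' := by
    refine IsTestFunction.congr hT.le (φ := fun _ => 0) ⟨contDiffOn_const, rfl, rfl⟩ fun t ht => ?_
    exact rlIntegral_lpI_zero ht
  add_mem' := by
    intro w v hw hv
    refine IsTestFunction.congr hT.le (φ := fun t => rlIntegral α w t + rlIntegral α v t)
      ⟨hw.smooth.add hv.smooth, ?_, ?_⟩ fun t ht => rlIntegral_lpI_add hp hα ht w v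
    · rw [hw.left_eq_zero, hv.left_eq_zero, add_zero]
    · rw [hw.right_eq_zero, hv.right_eq_zero, add_zero]
  smul_mem' := by
    intro c w hw
    refine IsTestFunction.congr hT.le (φ := fun t => c • rlIntegral α w t)
      ⟨hw.smooth.const_smul c, ?_, ?_⟩ fun t ht => rlIntegral_lpI_smul ht c w
    · rw [hw.left_eq_zero, smul_zero]
    · rw [hw.right_eq_zero, smul_zero]

theorem rlDeriv_rlIntegral_lpI {T p α : ℝ} (hp : 1 < p) (hα : 1 / p < α) (hα1 : α ≤ 1) (w : LpI N T p) :
    rlDeriv α (rlIntegral α w) =ᵐ[volume.restrict (Icc 0 T)] w :=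
  rlDeriv_eq_of_eq_rlIntegral (lt_trans (by positivity) hα) hα1
    (memLp_integrableOn hp (Lp.memLp w)) (fun _ _ => rfl)

variable {T p α : ℝ} [Fact (1 ≤ ENNReal.ofReal p)]

/-- The image of `E₀^{α,p}` under `u ↦ D^α u`. -/
noncomputable def derivSpace (N : ℕ) {T p α : ℝ} [Fact (1 ≤ ENNReal.ofReal p)] (hT : 0 < T) (hp : 1 < p)
    (hα : 1 / p < α) : Submodule ℝ (LpI N T p) :=
  (testSubmodule N hT hp hα).topologicalClosure

theorem exists_seq_of_mem_derivSpace {hT : 0 < T} {hp : 1 < p} {hα : 1 / p < α} {w : LpI N T p}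
    (hw : w ∈ derivSpace N hT hp hα) :
    ∃ v : ℕ → LpI N T p, (∀ n, IsTestFunction T (rlIntegral α (v n))) ∧
      Tendsto v atTop (𝓝 w) := by
  have h : w ∈ closure (testSubmodule N hT hp hα : Set (LpI N T p)) := hw
  exact mem_closure_iff_seq_limit.1 h

theorem tendsto_rlIntegral_lpI (hp : 1 < p) (hα : 1 / p < α) {ι : Type*} {l : Filter ι}
    {v : ι → LpI N T p} {w : LpI N T p} (h : Tendsto v l (𝓝 w)) {t : ℝ} (ht : t ∈ Icc 0 T) :
    Tendsto (fun n => rlIntegral α (v n) t) l (𝓝 (rlIntegral α w t)) := by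
  rw [tendsto_iff_norm_sub_tendsto_zero] at h ⊢
  refine squeeze_zero (fun _ => norm_nonneg _)
    (fun n => norm_rlIntegral_lpI_sub_le hp hα ht (v n) w) ?_
  simpa using h.const_mul (embConst T α p)

theorem rlIntegral_boundary {hT : 0 < T} {hp : 1 < p} {hα : 1 / p < α} {w : LpI N T p}
    (hw : w ∈ derivSpace N hT hp hα) : rlIntegral α w 0 = 0 ∧ rlIntegral α w T = 0 := by
  obtain ⟨v, hv, hlim⟩ := exists_seq_of_mem_derivSpace hw
  constructor
  · refine tendsto_nhds_unique
      (tendsto_rlIntegral_lpI hp hα hlim ⟨le_rfl, hT.le⟩) ?_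
    simp_rw [fun n => (hv n).left_eq_zero]
    exact tendsto_const_nhds
  · refine tendsto_nhds_unique
      (tendsto_rlIntegral_lpI hp hα hlim ⟨hT.le, le_rfl⟩) ?_
    simp_rw [fun n => (hv n).right_eq_zero]
    exact tendsto_const_nhds

theorem tendsto_eLpNorm_sub_of_tendsto {ι : Type*} {l : Filter ι} {v : ι → LpI N T p}
    {w : LpI N T p} (h : Tendsto v l (𝓝 w)) :
    Tendsto (fun n => eLpNorm (fun t => v n t - w t) (ENNReal.ofReal p)
      (volume.restrict (Icc 0 T))) l (𝓝 0) :=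
  (Lp.tendsto_Lp_iff_tendsto_eLpNorm' v w).1 h

/-- Because I^α is bounded from L^p to the sup norm, convergence of the derivatives in L^p already
implies convergence of the functions. Taking the closure of the derivatives in L^p therefore loses
nothing. -/
theorem memE0_rlIntegral {hT : 0 < T} {hp : 1 < p} {hα : 1 / p < α} (hα1 : α ≤ 1)
    {w : LpI N T p} (hw : w ∈ derivSpace N hT hp hα) : MemE0 T α p (rlIntegral α w) := by
  obtain ⟨v, hv, hlim⟩ := exists_seq_of_mem_derivSpace hw
  refine ⟨continuousOn_rlIntegral hp hα hα1 (Lp.memLp w), fun n => rlIntegral α (v n), hv, ?_, ?_⟩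
  · have hb : ∀ n, eLpNorm (fun t => rlIntegral α (v n) t - rlIntegral α w t) (ENNReal.ofReal p)
        (volume.restrict (Icc 0 T)) ≤ (volume.restrict (Icc 0 T)) univ ^
          (ENNReal.ofReal p).toReal⁻¹ * ENNReal.ofReal (embConst T α p * ‖v n - w‖) := fun n =>
      eLpNorm_le_of_ae_bound ((ae_restrict_mem measurableSet_Icc).mono fun t ht =>
        norm_rlIntegral_lpI_sub_le hp hα ht (v n) w)
    refine tendsto_of_tendsto_of_tendsto_of_le_of_le tendsto_const_nhds ?_
      (fun _ => zero_le) hb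
    have h1 : Tendsto (fun n => ENNReal.ofReal (embConst T α p * ‖v n - w‖)) atTop (𝓝 0) := by
      rw [← ENNReal.ofReal_zero]
      refine ENNReal.tendsto_ofReal ?_
      simpa using (tendsto_iff_norm_sub_tendsto_zero.1 hlim).const_mul (embConst T α p)
    have h2 := ENNReal.Tendsto.const_mul (a := (volume.restrict (Icc 0 T)) univ ^
          (ENNReal.ofReal p).toReal⁻¹) h1 (Or.inr ?_)
    · simpa using h2
    · refine ENNReal.rpow_ne_top_of_nonneg (by positivity) ?_
      simp
  · refine (tendsto_eLpNorm_sub_of_tendsto hlim).congr fun n => ?_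
    refine eLpNorm_congr_ae ?_
    filter_upwards [rlDeriv_rlIntegral_lpI hp hα hα1 w, rlDeriv_rlIntegral_lpI hp hα hα1 (v n)]
      with t h1 h2
    rw [h1, h2]

/-- Every element of `E₀^{α,p}` is the fractional integral of its fractional derivative. -/
theorem MemE0.exists_eq_rlIntegral (hT : 0 < T) (hp : 1 < p) (hα : 1 / p < α) (hα1 : α ≤ 1)
    {u : ℝ → EuclideanSpace ℝ (Fin N)} (hu : MemE0 T α p u) :
    ∃ w ∈ derivSpace N hT hp hα, rlDeriv α u =ᵐ[volume.restrict (Icc 0 T)] w ∧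
      ∀ t ∈ Icc 0 T, u t = rlIntegral α w t := by
  obtain ⟨φ, hφ, hφu, hDφ⟩ := hu.approx
  have hα0 : 0 < α := lt_trans (by positivity) hα
  have hφL := fun n => (hφ n).memLp_rlDeriv hT hα0 hα1 hp
  have huL : MemLp (rlDeriv α u) (ENNReal.ofReal p) (volume.restrict (Icc 0 T)) := by
    have hm : AEStronglyMeasurable (rlDeriv α u) (volume.restrict (Icc 0 T)) :=
      (measurable_rlDeriv α u).aestronglyMeasurable
    -- Some distance between D^α (φ n) and D^α u is finite. As D^α (φ n) is in L^p, so is D^α u.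
    obtain ⟨n, hn⟩ := (hDφ.eventually (gt_mem_nhds (ENNReal.zero_lt_top))).exists
    have h1 : MemLp (fun t => rlDeriv α (φ n) t - rlDeriv α u t) (ENNReal.ofReal p)
      (volume.restrict (Icc 0 T)) := ⟨(hφL n).1.1.sub hm, hn⟩
    have h2 := (hφL n).1.sub h1
    refine h2.ae_eq (Eventually.of_forall fun t => ?_)
    simp
  let w : LpI N T p := huL.toLp _
  let v : ℕ → LpI N T p := fun n => (hφL n).1.toLp _
  have hw : w =ᵐ[volume.restrict (Icc 0 T)] rlDeriv α u := huL.coeFn_toLp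
  have hv : ∀ n, v n =ᵐ[volume.restrict (Icc 0 T)] rlDeriv α (φ n) :=
    fun n => (hφL n).1.coeFn_toLp
  have hvφ : ∀ n, ∀ t ∈ Icc 0 T, rlIntegral α (v n) t = φ n t := fun n t ht => by
    rw [(hφL n).2 t ht, rlIntegral_congr (hv n) ht]
  have hlim : Tendsto v atTop (𝓝 w) := by
    rw [Lp.tendsto_Lp_iff_tendsto_eLpNorm']
    refine hDφ.congr fun n => eLpNorm_congr_ae ?_
    filter_upwards [hw, hv n] with t h1 h2
    simp only [Pi.sub_apply]
    rw [h1, h2]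
  have hmem : w ∈ derivSpace N hT hp hα := by
    have : w ∈ closure (testSubmodule N hT hp hα : Set (LpI N T p)) :=
      mem_closure_of_tendsto hlim
        (Eventually.of_forall fun n => (hφ n).congr hT.le (hvφ n))
    exact this
  refine ⟨w, hmem, hw.symm, ?_⟩
  obtain ⟨-, ψ, -, hψ, -⟩ := memE0_rlIntegral hα1 hmem
  -- A subsequence of φ n converges almost everywhere to u, while φ n = I^α (v n) converges
  -- pointwise to I^α w. Both limits are continuous, so they agree on all of [0,T].
  have hae : u =ᵐ[volume.restrict (Icc 0 T)] rlIntegral α w := by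
    have hcw := continuousOn_rlIntegral hp hα hα1 (Lp.memLp w)
    have hmeas : ∀ n, AEStronglyMeasurable (φ n) (volume.restrict (Icc 0 T)) := fun n =>
      (hφ n).smooth.continuousOn.aestronglyMeasurable measurableSet_Icc
    have h1 := tendstoInMeasure_of_tendsto_eLpNorm (by simp; linarith) hmeas
      (hu.continuousOn.aestronglyMeasurable measurableSet_Icc) hφu
    obtain ⟨ns, hns, h2⟩ := h1.exists_seq_tendsto_ae
    filter_upwards [h2, ae_restrict_mem measurableSet_Icc] with t h3 ht
    refine tendsto_nhds_unique h3 ?_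
    have h4 := (tendsto_rlIntegral_lpI hp hα hlim ht).comp hns.tendsto_atTop
    refine h4.congr fun n => hvφ _ t ht
  have := Measure.eqOn_Icc_of_ae_eq volume hT.ne hae hu.continuousOn
    (continuousOn_rlIntegral hp hα hα1 (Lp.memLp w))
  exact this

/-- Compactness of `I^α : L^p → C([0,T])`. -/
theorem exists_subseq_uniformCauchy (hT : 0 < T) (hp : 1 < p) (hα : 1 / p < α) (hα1 : α ≤ 1)
    {R : ℝ} (w : ℕ → LpI N T p) (hw : ∀ n, ‖w n‖ ≤ R) :
    ∃ φ : ℕ → ℕ, StrictMono φ ∧ ∀ ε > 0, ∃ n₀, ∀ n ≥ n₀, ∀ m ≥ n₀, ∀ t ∈ Icc 0 T,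
      ‖rlIntegral α (w (φ n)) t - rlIntegral α (w (φ m)) t‖ ≤ ε := by
  have hcont := fun n => continuousOn_rlIntegral hp hα hα1 (Lp.memLp (w n))
  let f : ℕ → BoundedContinuousFunction (Icc 0 T) (EuclideanSpace ℝ (Fin N)) := fun n =>
    BoundedContinuousFunction.mkOfCompact ⟨fun t => rlIntegral α (w n) t, (hcont n).domRestrict⟩
  have hR : 0 ≤ R := (norm_nonneg _).trans (hw 0)
  have hK := embConst_pos hT hp hα
  -- Arzelà-Ascoli: the embedding constant gives a common bound, and the Hölder estimate gives a
  -- common modulus of continuity ω depending only on R.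
  have hcpt : IsCompact (closure (range f)) := by
    refine BoundedContinuousFunction.arzela_ascoli
      (Metric.closedBall 0 (embConst T α p * R)) (isCompact_closedBall _ _) _ ?_ ?_
    · rintro _ t ⟨n, rfl⟩
      rw [mem_closedBall_zero_iff]
      exact (norm_rlIntegral_lpI_le hp hα t.2 (w n)).trans
        (mul_le_mul_of_nonneg_left (hw n) hK.le)
    · have hq : 0 < conjExp p := (conjExp_holderConjugate hp).symm.pos
      have hm := kernelExp_pos hp hα
      set m := α * conjExp p - conjExp p + 1 with hmdef
      have hΓ := Real.Gamma_pos_of_pos (lt_trans (by positivity) hα)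
      let ω : ℝ → ℝ := fun r => 1 / Real.Gamma α * ((2 * |r| ^ m / m) ^ (1 / conjExp p) * R)
      have hω : Continuous ω := by
        have : Continuous fun r : ℝ => |r| ^ m := continuous_abs.rpow_const fun _ => Or.inr hm.le
        have : Continuous fun r : ℝ => (2 * |r| ^ m / m) ^ (1 / conjExp p) :=
          (by fun_prop : Continuous fun r : ℝ => 2 * |r| ^ m / m).rpow_const
            fun _ => Or.inr (by positivity)
        fun_prop
      have hω0 : ω 0 = 0 := by
        simp [ω, Real.zero_rpow hm.ne', hq.ne']
      intro t
      refine Metric.equicontinuousAt_of_continuity_modulus (fun t' : Icc 0 T => ω (t' - t)) ?_ _ ?_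
      · have : Continuous fun t' : Icc 0 T => ω (t' - t) := hω.comp (by fun_prop)
        have := this.tendsto t
        rwa [sub_self, hω0] at this
      · refine Eventually.of_forall ?_
        rintro t' ⟨_, n, rfl⟩
        change dist (rlIntegral α (w n) t) (rlIntegral α (w n) t') ≤ _
        rw [dist_eq_norm]
        have key : ∀ a b : ℝ, 0 ≤ a → a ≤ b → b ≤ T →
            ‖rlIntegral α (w n) b - rlIntegral α (w n) a‖ ≤ ω (b - a) := by
          intro a b ha hab hb
          refine (norm_rlIntegral_sub_le hp hα hα1 ha hab hb (Lp.memLp (w n))).trans ?_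
          rw [← norm_lpI hp]
          simp only [ω, abs_of_nonneg (sub_nonneg.2 hab)]
          have := hw n
          have := sub_nonneg.2 hab
          gcongr
        rcases le_total (t : ℝ) t' with h | h
        · rw [norm_sub_rev]
          exact key _ _ t.2.1 h t'.2.2
        · have : ω (t' - t) = ω (t - t') := by simp only [ω]; rw [abs_sub_comm]
          rw [this]
          exact key _ _ t'.2.1 h t.2.2
  obtain ⟨g, -, φ, hφ, hlim⟩ := hcpt.tendsto_subseq (fun n => subset_closure (mem_range_self n))
  refine ⟨φ, hφ, fun ε hε => ?_⟩
  obtain ⟨n₀, hn₀⟩ := Metric.cauchySeq_iff.1 hlim.cauchySeq ε hε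
  refine ⟨n₀, fun n hn m hm t ht => ?_⟩
  have h1 := (hn₀ n hn m hm).le
  rw [dist_eq_norm] at h1
  exact ((f (φ n) - f (φ m)).norm_coe_le_norm ⟨t, ht⟩).trans h1

/-! ### Pointwise inequalities for x ↦ |x|^k x -/

section Inequalities

/-- The factor ‖y‖ on the left keeps the exponent on the right at k instead of k - 1, so that k = 0
needs no separate treatment later. -/
theorem abs_norm_pow_sub_le {E : Type*} [NormedAddCommGroup E] (k : ℕ) (x y : E) :
    |‖x‖ ^ k - ‖y‖ ^ k| * ‖y‖ ≤ k * ‖x - y‖ * (‖x‖ + ‖y‖) ^ k := by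
  rcases k with _ | k
  · simp
  · have h1 := abs_pow_sub_pow_le ‖x‖ ‖y‖ (k + 1)
    rw [abs_norm, abs_norm, Nat.add_sub_cancel] at h1
    have h2 : max ‖x‖ ‖y‖ ≤ ‖x‖ + ‖y‖ :=
      max_le (le_add_of_nonneg_right (norm_nonneg _)) (le_add_of_nonneg_left (norm_nonneg _))
    have h3 := abs_norm_sub_norm_le x y
    calc _ ≤ |‖x‖ - ‖y‖| * ↑(k + 1) * max ‖x‖ ‖y‖ ^ k * ‖y‖ := by gcongr
      _ ≤ ‖x - y‖ * ↑(k + 1) * (‖x‖ + ‖y‖) ^ k * (‖x‖ + ‖y‖) := by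
        gcongr
        exact le_add_of_nonneg_left (norm_nonneg _)
      _ = _ := by ring

variable {E : Type*} [NormedAddCommGroup E] [InnerProductSpace ℝ E]

theorem norm_pow_smul_sub_le (k : ℕ) (x y : E) :
    ‖‖x‖ ^ k • x - ‖y‖ ^ k • y‖ ≤ (k + 1) * ‖x - y‖ * (‖x‖ + ‖y‖) ^ k := by
  have h : ‖x‖ ^ k • x - ‖y‖ ^ k • y = ‖x‖ ^ k • (x - y) + (‖x‖ ^ k - ‖y‖ ^ k) • y := by
    rw [smul_sub, sub_smul]; abel
  rw [h]
  refine (norm_add_le _ _).trans ?_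
  rw [norm_smul, norm_smul, Real.norm_eq_abs, Real.norm_eq_abs, abs_pow, abs_norm]
  have h1 : ‖x‖ ^ k ≤ (‖x‖ + ‖y‖) ^ k := by gcongr; exact le_add_of_nonneg_right (norm_nonneg _)
  nlinarith [abs_norm_pow_sub_le k x y, mul_le_mul_of_nonneg_right h1 (norm_nonneg (x - y))]

/-- Strong monotonicity for exponents p = k + 2 ≥ 2. Symmetrisation writes the inner product as half
of (|x|^k + |y|^k)|x - y|² plus half of (|x|^k - |y|^k)(|x|² - |y|²). The second term is
nonnegative, and in the first |x - y| ≤ 2 max(|x|, |y|) provides the missing power. -/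
theorem norm_sub_pow_le_inner (k : ℕ) (x y : E) :
    ‖x - y‖ ^ (k + 2) ≤ 2 ^ (k + 1) * inner ℝ (‖x‖ ^ k • x - ‖y‖ ^ k • y) (x - y) := by
  have h1 : inner ℝ (‖x‖ ^ k • x - ‖y‖ ^ k • y) (x - y) =
      1 / 2 * ((‖x‖ ^ k + ‖y‖ ^ k) * ‖x - y‖ ^ 2) +
        1 / 2 * ((‖x‖ ^ k - ‖y‖ ^ k) * (‖x‖ ^ 2 - ‖y‖ ^ 2)) := by
    rw [@norm_sub_sq_real]
    simp only [inner_sub_left, inner_sub_right, real_inner_smul_left,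
      real_inner_self_eq_norm_sq, real_inner_comm x y]
    ring
  have h2 : 0 ≤ (‖x‖ ^ k - ‖y‖ ^ k) * (‖x‖ ^ 2 - ‖y‖ ^ 2) := by
    rcases le_total ‖x‖ ‖y‖ with h | h
    · exact mul_nonneg_of_nonpos_of_nonpos
        (sub_nonpos.2 (pow_le_pow_left₀ (norm_nonneg _) h k))
        (sub_nonpos.2 (pow_le_pow_left₀ (norm_nonneg _) h 2))
    · exact mul_nonneg (sub_nonneg.2 (pow_le_pow_left₀ (norm_nonneg _) h k))
        (sub_nonneg.2 (pow_le_pow_left₀ (norm_nonneg _) h 2))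
  have h3 : ‖x - y‖ ^ k ≤ 2 ^ k * (‖x‖ ^ k + ‖y‖ ^ k) := by
    have h4 : ‖x - y‖ ≤ 2 * max ‖x‖ ‖y‖ := by
      have := norm_sub_le x y
      linarith [le_max_left ‖x‖ ‖y‖, le_max_right ‖x‖ ‖y‖]
    refine (pow_le_pow_left₀ (norm_nonneg _) h4 k).trans ?_
    rw [mul_pow]
    gcongr
    rcases max_choice ‖x‖ ‖y‖ with h | h <;> rw [h]
    · exact le_add_of_nonneg_right (by positivity)
    · exact le_add_of_nonneg_left (by positivity)
  have h5 := mul_le_mul_of_nonneg_right h3 (sq_nonneg ‖x - y‖)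
  rw [h1, pow_succ (2 : ℝ) k, pow_add]
  have h6 : (0 : ℝ) ≤ 2 ^ k * ((‖x‖ ^ k - ‖y‖ ^ k) * (‖x‖ ^ 2 - ‖y‖ ^ 2)) := by positivity
  nlinarith

theorem hasDerivAt_norm_pow (k : ℕ) (x v : E) (τ : ℝ) :
    HasDerivAt (fun τ : ℝ => ‖x + τ • v‖ ^ (k + 2))
      ((k + 2) * inner ℝ (‖x + τ • v‖ ^ k • (x + τ • v)) v) τ := by
  have h1 : HasDerivAt (fun τ : ℝ => x + τ • v) v τ := by
    simpa using ((hasDerivAt_id τ).smul_const v).const_add x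
  have h2 := (hasFDerivAt_norm_rpow (x + τ • v) (p := (k : ℝ) + 2)
    (by have : (0 : ℝ) ≤ k := k.cast_nonneg
        linarith)).comp_hasDerivAt τ h1
  simp only [add_sub_cancel_right, smul_apply, innerSL_apply_apply,
    smul_eq_mul, Real.rpow_natCast] at h2
  rw [real_inner_smul_left, ← mul_assoc]
  refine h2.congr_of_eventuallyEq (Eventually.of_forall fun r => ?_)
  simp only [Function.comp]
  rw [← Real.rpow_natCast]
  norm_cast

theorem abs_inner_pow_smul_le (k : ℕ) (x v : E) :
    |inner ℝ (‖x‖ ^ k • x) v| ≤ ‖x‖ ^ (k + 1) * ‖v‖ := by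
  refine (abs_real_inner_le_norm _ _).trans_eq ?_
  rw [norm_smul, norm_pow, norm_norm, pow_succ]

/-- Both error terms have the shape A^(p-1) B, so a single use of Hölder's inequality with exponents
p/(p-1) and p integrates each of them. -/
theorem abs_inner_pow_smul_sub_le (k : ℕ) (x y v z : E) :
    |inner ℝ (‖x‖ ^ k • x) v - inner ℝ (‖y‖ ^ k • y) z| ≤
      ‖x‖ ^ (k + 1) * ‖v - z‖ + (k + 1) * ((‖x‖ + ‖y‖ + ‖z‖) ^ (k + 1) * ‖x - y‖) := by
  have h : inner ℝ (‖x‖ ^ k • x) v - inner ℝ (‖y‖ ^ k • y) z =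
      inner ℝ (‖x‖ ^ k • x) (v - z) + inner ℝ (‖x‖ ^ k • x - ‖y‖ ^ k • y) z := by
    rw [inner_sub_left, inner_sub_right]; ring
  rw [h]
  refine (abs_add_le _ _).trans (add_le_add (abs_inner_pow_smul_le k x _) ?_)
  refine (abs_real_inner_le_norm _ _).trans ?_
  calc _ ≤ (k + 1) * ‖x - y‖ * (‖x‖ + ‖y‖) ^ k * ‖z‖ := by
        gcongr; exact norm_pow_smul_sub_le k x y
    _ ≤ (k + 1) * ‖x - y‖ * (‖x‖ + ‖y‖ + ‖z‖) ^ k * (‖x‖ + ‖y‖ + ‖z‖) := by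
        have h1 : ‖z‖ ≤ ‖x‖ + ‖y‖ + ‖z‖ := le_add_of_nonneg_left (by positivity)
        have h2 : ‖x‖ + ‖y‖ ≤ ‖x‖ + ‖y‖ + ‖z‖ := le_add_of_nonneg_right (norm_nonneg _)
        gcongr
    _ = _ := by ring

end Inequalities

/-! ### The p-th power of the L^p norm and its derivative -/

section Functional
variable {N k : ℕ} {T : ℝ}

/-- The exponent `p = k + 2`. -/
abbrev expo (k : ℕ) : ℝ := ((k + 2 : ℕ) : ℝ)

theorem one_lt_expo (k : ℕ) : 1 < expo k := by
  simp only [expo]; push_cast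
  have : (0 : ℝ) ≤ k := k.cast_nonneg
  linarith

theorem expo_pos (k : ℕ) : 0 < expo k := zero_lt_one.trans (one_lt_expo k)

instance fact_one_le_expo (k : ℕ) : Fact (1 ≤ ENNReal.ofReal (expo k)) :=
  ⟨by rw [← ENNReal.ofReal_one]; exact ENNReal.ofReal_le_ofReal (one_lt_expo k).le⟩

theorem integrable_pow_of_memLp {μ : Measure ℝ} {a : ℝ → ℝ}
    (ha : MemLp a (ENNReal.ofReal (expo k)) μ) : Integrable (fun s => |a s| ^ (k + 2)) μ := by
  have := ha.integrable_norm_rpow (by simpa using expo_pos k) (by simp)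
  rw [ENNReal.toReal_ofReal (expo_pos k).le] at this
  simpa only [Real.rpow_natCast, Real.norm_eq_abs] using this

/-- Hölder's inequality in the form adapted to |w|^(p-1)|v|, using that (p - 1) times the conjugate
exponent is p. -/
theorem integral_pow_mul_le {μ : Measure ℝ} {a b : ℝ → ℝ} (ha0 : ∀ s, 0 ≤ a s) (hb0 : ∀ s, 0 ≤ b s)
    (ha : MemLp a (ENNReal.ofReal (expo k)) μ) (hb : MemLp b (ENNReal.ofReal (expo k)) μ) :
    Integrable (fun s => a s ^ (k + 1) * b s) μ ∧
    ∫ s, a s ^ (k + 1) * b s ∂μ ≤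
      (eLpNorm a (ENNReal.ofReal (expo k)) μ).toReal ^ (k + 1) *
        (eLpNorm b (ENNReal.ofReal (expo k)) μ).toReal := by
  have hp := one_lt_expo k
  have hp0 := expo_pos k
  have hpq := conjExp_holderConjugate hp
  have hq : 0 < conjExp (expo k) := hpq.symm.pos
  have hmul : ((k + 1 : ℕ) : ℝ) * conjExp (expo k) = expo k := by
    have h1 : expo k - 1 = ((k + 1 : ℕ) : ℝ) := by simp only [expo]; push_cast; ring
    rw [conjExp, h1, mul_div_cancel₀]
    positivity
  have hpow : ∀ s, (a s ^ (k + 1)) ^ conjExp (expo k) = a s ^ expo k := fun s => by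
    rw [← Real.rpow_natCast, ← Real.rpow_mul (ha0 s), hmul]
  have ha' : MemLp (fun s => a s ^ (k + 1)) (ENNReal.ofReal (conjExp (expo k))) μ := by
    have hm : AEStronglyMeasurable (fun s => a s ^ (k + 1)) μ := ha.1.pow _
    rw [← integrable_norm_rpow_iff hm (ENNReal.ofReal_pos.2 hq).ne' (by simp)]
    refine (integrable_pow_of_memLp ha).congr (Eventually.of_forall fun s => ?_)
    simp only
    rw [ENNReal.toReal_ofReal hq.le, Real.norm_of_nonneg (pow_nonneg (ha0 s) _), hpow,
      abs_of_nonneg (ha0 s), Real.rpow_natCast]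
  have heq : ∀ c : ℝ → ℝ, (∀ s, 0 ≤ c s) → MemLp c (ENNReal.ofReal (expo k)) μ →
      (eLpNorm c (ENNReal.ofReal (expo k)) μ).toReal = (∫ s, c s ^ expo k ∂μ) ^ (1 / expo k) := by
    intro c hc0 hc
    rw [hc.eLpNorm_eq_integral_rpow_norm (by simpa using hp0) (by simp),
      ENNReal.toReal_ofReal (by positivity), ENNReal.toReal_ofReal hp0.le, one_div]
    simp_rw [Real.norm_of_nonneg (hc0 _)]
  constructor
  · have := hpq.symm.ennrealOfReal
    exact ha'.integrable_mul hb
  · have h := integral_mul_le_Lp_mul_Lq_of_nonneg hpq.symm (μ := μ)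
      (Eventually.of_forall fun s => pow_nonneg (ha0 s) (k + 1)) (Eventually.of_forall hb0) ha' hb
    simp_rw [hpow] at h
    rw [heq a ha0 ha, heq b hb0 hb]
    refine h.trans_eq ?_
    congr 1
    rw [← Real.rpow_natCast, ← Real.rpow_mul (integral_nonneg fun s => Real.rpow_nonneg (ha0 s) _)]
    congr 1
    rw [one_div_mul_eq_div, div_eq_div_iff hq.ne' hp0.ne', one_mul, hmul]

/-- `∫ (|w|^(p-2) w, v)`. -/
noncomputable def powPairing (w v : LpI N T (expo k)) : ℝ :=
  ∫ s in Icc 0 T, inner ℝ (‖w s‖ ^ k • w s) (v s)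

theorem eLpNorm_norm_toReal (w : LpI N T (expo k)) :
    (eLpNorm (fun s => ‖w s‖) (ENNReal.ofReal (expo k)) (volume.restrict (Icc 0 T))).toReal =
      ‖w‖ := by
  rw [eLpNorm_norm, ← Lp.norm_def]

theorem integrable_powPairing (w v : LpI N T (expo k)) :
    IntegrableOn (fun s => inner ℝ (‖w s‖ ^ k • w s) (v s)) (Icc 0 T) := by
  have h := (integral_pow_mul_le (k := k) (fun s => norm_nonneg (w s)) (fun s => norm_nonneg (v s))
    (Lp.memLp w).norm (Lp.memLp v).norm).1
  refine h.mono' ?_ (Eventually.of_forall fun s => abs_inner_pow_smul_le k _ _)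
  have hw := (Lp.memLp w).1
  exact ((hw.norm.pow k).smul hw).inner (Lp.memLp v).1

theorem abs_powPairing_sub_le (w v w' v' : LpI N T (expo k)) :
    |powPairing w v - powPairing w' v'| ≤ ‖w‖ ^ (k + 1) * ‖v - v'‖ +
      (k + 1) * ((‖w‖ + ‖w'‖ + ‖v'‖) ^ (k + 1) * ‖w - w'‖) := by
  unfold powPairing
  rw [← integral_sub (integrable_powPairing w v) (integrable_powPairing w' v')]
  have h1 := integral_pow_mul_le (k := k) (fun s => norm_nonneg (w s))
    (fun s => norm_nonneg ((v - v' : LpI N T (expo k)) s)) (Lp.memLp w).norm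
    (Lp.memLp (v - v')).norm
  have hS := ((Lp.memLp w).norm.add (Lp.memLp w').norm).add (Lp.memLp v').norm
  have h2 := integral_pow_mul_le (k := k) (a := fun s => ‖w s‖ + ‖w' s‖ + ‖v' s‖)
    (fun s => by positivity)
    (fun s => norm_nonneg ((w - w' : LpI N T (expo k)) s)) hS
    (Lp.memLp (w - w')).norm
  rw [eLpNorm_norm_toReal, eLpNorm_norm_toReal] at h1
  rw [eLpNorm_norm_toReal] at h2
  have h3 : (eLpNorm (fun s => ‖w s‖ + ‖w' s‖ + ‖v' s‖) (ENNReal.ofReal (expo k))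
      (volume.restrict (Icc 0 T))).toReal ≤ ‖w‖ + ‖w'‖ + ‖v'‖ := by
    have hone : 1 ≤ ENNReal.ofReal (expo k) := (fact_one_le_expo k).out
    have e1 := eLpNorm_add_le ((Lp.memLp w).norm.add (Lp.memLp w').norm).1
      (Lp.memLp v').norm.1 hone
    have e2 := eLpNorm_add_le (Lp.memLp w).norm.1 (Lp.memLp w').norm.1 hone
    have e3 := e1.trans (add_le_add_left e2 _)
    have hfin : ∀ u : LpI N T (expo k), eLpNorm (fun s => ‖u s‖) (ENNReal.ofReal (expo k))
      (volume.restrict (Icc 0 T)) ≠ ⊤ := fun u => (Lp.memLp u).norm.2.ne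
    have e4 := ENNReal.toReal_mono (by
      simp only [ne_eq, ENNReal.add_eq_top, not_or]
      exact ⟨⟨hfin w, hfin w'⟩, hfin v'⟩) e3
    rw [ENNReal.toReal_add (ENNReal.add_ne_top.2 ⟨hfin w, hfin w'⟩) (hfin v'),
      ENNReal.toReal_add (hfin w) (hfin w'), eLpNorm_norm_toReal, eLpNorm_norm_toReal,
      eLpNorm_norm_toReal] at e4
    exact e4
  have h4 : ‖∫ s in Icc 0 T, (inner ℝ (‖w s‖ ^ k • w s) (v s) -
      inner ℝ (‖w' s‖ ^ k • w' s) (v' s))‖ ≤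
      ∫ s in Icc 0 T, (‖w s‖ ^ (k + 1) * ‖(v - v' : LpI N T (expo k)) s‖ +
        (k + 1) * ((‖w s‖ + ‖w' s‖ + ‖v' s‖) ^ (k + 1) * ‖(w - w' : LpI N T (expo k)) s‖)) := by
    refine norm_integral_le_of_norm_le (h1.1.add (h2.1.const_mul _)) ?_
    filter_upwards [Lp.coeFn_sub v v', Lp.coeFn_sub w w'] with s e1 e2
    rw [e1, e2]
    exact abs_inner_pow_smul_sub_le k _ _ _ _
  rw [Real.norm_eq_abs] at h4
  refine h4.trans ?_
  rw [integral_add h1.1 (h2.1.const_mul _), integral_const_mul]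
  have h5 := h2.2.trans (mul_le_mul_of_nonneg_right
    (pow_le_pow_left₀ ENNReal.toReal_nonneg h3 (k + 1)) (norm_nonneg (w - w')))
  have h6 : (0 : ℝ) ≤ k + 1 := by positivity
  exact add_le_add h1.2 (mul_le_mul_of_nonneg_left h5 h6)

theorem continuous_powPairing :
    Continuous fun z : LpI N T (expo k) × LpI N T (expo k) => powPairing z.1 z.2 := by
  rw [continuous_iff_continuousAt]
  intro z
  rw [ContinuousAt, tendsto_iff_norm_sub_tendsto_zero]
  have h : Continuous fun y : LpI N T (expo k) × LpI N T (expo k) =>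
      ‖y.1‖ ^ (k + 1) * ‖y.2 - z.2‖ +
      (k + 1) * ((‖y.1‖ + ‖z.1‖ + ‖z.2‖) ^ (k + 1) * ‖y.1 - z.1‖) := by fun_prop
  have h2 := h.tendsto z
  simp only [sub_self, norm_zero, mul_zero, add_zero] at h2
  exact squeeze_zero (fun _ => norm_nonneg _) (fun y => abs_powPairing_sub_le _ _ _ _) h2

theorem powPairing_add (w v v' : LpI N T (expo k)) :
    powPairing w (v + v') = powPairing w v + powPairing w v' := by
  unfold powPairing
  rw [← integral_add (integrable_powPairing w v) (integrable_powPairing w v')]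
  refine integral_congr_ae ?_
  filter_upwards [Lp.coeFn_add v v'] with s hs
  rw [hs, Pi.add_apply, inner_add_right]

theorem powPairing_smul (c : ℝ) (w v : LpI N T (expo k)) :
    powPairing w (c • v) = c * powPairing w v := by
  unfold powPairing
  rw [← integral_const_mul]
  refine integral_congr_ae ?_
  filter_upwards [Lp.coeFn_smul c v] with s hs
  rw [hs, Pi.smul_apply, real_inner_smul_right]

theorem norm_lpI_pow (w : LpI N T (expo k)) :
    ‖w‖ ^ (k + 2) = ∫ s in Icc 0 T, ‖w s‖ ^ (k + 2) := by
  have := norm_lpI_rpow (one_lt_expo k) w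
  simpa only [Real.rpow_natCast] using this

theorem powPairing_self (w : LpI N T (expo k)) : powPairing w w = ‖w‖ ^ (k + 2) := by
  rw [norm_lpI_pow]
  unfold powPairing
  congr 1
  ext s
  rw [real_inner_smul_left, real_inner_self_eq_norm_sq, ← pow_add]

/-- This is what upgrades smallness of the pairings to strong convergence of Palais-Smale sequences.
-/
theorem norm_sub_pow_le_powPairing (w v : LpI N T (expo k)) :
    ‖w - v‖ ^ (k + 2) ≤ 2 ^ (k + 1) * (powPairing w (w - v) - powPairing v (w - v)) := by
  have h1 := integrable_powPairing w (w - v)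
  have h2 := integrable_powPairing v (w - v)
  rw [norm_lpI_pow]
  unfold powPairing
  rw [← integral_sub h1 h2, ← integral_const_mul]
  refine integral_mono_of_nonneg (Eventually.of_forall fun s => by positivity)
    ((h1.sub h2).const_mul _) ?_
  filter_upwards [Lp.coeFn_sub w v] with s hs
  rw [Pi.sub_apply] at hs
  rw [hs, ← inner_sub_left]
  exact norm_sub_pow_le_inner k _ _

theorem hasDerivAt_norm_lpI_pow (w v : LpI N T (expo k)) :
    HasDerivAt (fun τ : ℝ => ‖w + τ • v‖ ^ (k + 2)) ((k + 2) * powPairing w v) 0 := by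
  have hS := (Lp.memLp w).norm.add (Lp.memLp v).norm
  have hb := integrable_pow_of_memLp (k := k) hS
  have hF : (fun τ : ℝ => ‖w + τ • v‖ ^ (k + 2)) =
      fun τ : ℝ => ∫ s in Icc 0 T, ‖w s + τ • v s‖ ^ (k + 2) := by
    ext1 τ
    rw [norm_lpI_pow]
    refine integral_congr_ae ?_
    filter_upwards [Lp.coeFn_add w (τ • v), Lp.coeFn_smul τ v] with s h1 h2
    rw [h1, Pi.add_apply, h2, Pi.smul_apply]
  have hmeas : ∀ τ : ℝ, AEStronglyMeasurable (fun s => w s + τ • v s)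
      (volume.restrict (Icc 0 T)) := fun τ => (Lp.memLp w).1.add ((Lp.memLp v).1.const_smul τ)
  rw [hF]
  have := (hasDerivAt_integral_of_dominated_loc_of_deriv_le (μ := volume.restrict (Icc 0 T))
    (F := fun τ s => ‖w s + τ • v s‖ ^ (k + 2))
    (F' := fun τ s => (k + 2) * inner ℝ (‖w s + τ • v s‖ ^ k • (w s + τ • v s)) (v s))
    (x₀ := (0 : ℝ)) (s := Metric.ball 0 1)
    -- For |τ| < 1 both |w + τ v| and |v| are at most |w| + |v|, so the derivative of the integrand
    -- is dominated by the integrable function p(|w| + |v|)^p.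
    (bound := fun s => (k + 2) * |((fun s => ‖w s‖) + fun s => ‖v s‖) s| ^ (k + 2))
    (Metric.ball_mem_nhds _ one_pos) (Eventually.of_forall fun τ => (hmeas τ).norm.pow _)
    ?_ ?_ ?_ (hb.const_mul _) ?_).2
  · simp only [zero_smul, add_zero] at this
    rwa [integral_const_mul] at this
  · simp only [zero_smul, add_zero]
    exact (integrable_pow_of_memLp (k := k) (Lp.memLp w).norm).congr
      (Eventually.of_forall fun s => by simp)
  · exact ((((hmeas 0).norm.pow k).smul (hmeas 0)).inner (Lp.memLp v).1).const_mul _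
  · refine Eventually.of_forall fun s τ hτ => ?_
    rw [mem_ball_zero_iff, Real.norm_eq_abs] at hτ
    have h1 : ‖w s + τ • v s‖ ≤ ‖w s‖ + ‖v s‖ := by
      refine (norm_add_le _ _).trans ?_
      rw [norm_smul, Real.norm_eq_abs]
      nlinarith [norm_nonneg (v s)]
    rw [Pi.add_apply, abs_of_nonneg (by positivity : 0 ≤ ‖w s‖ + ‖v s‖), norm_mul,
      Real.norm_of_nonneg (by positivity : (0 : ℝ) ≤ k + 2)]
    refine mul_le_mul_of_nonneg_left ?_ (by positivity)
    refine (abs_inner_pow_smul_le k _ _).trans ?_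
    rw [pow_succ _ (k + 1)]
    gcongr
    exact le_add_of_nonneg_left (norm_nonneg _)
  · exact Eventually.of_forall fun s τ _ => hasDerivAt_norm_pow k _ _ _

end Functional

/-! ### Integral functionals of Carathéodory functions -/

/-- Carathéodory functions `H(t,x)` of class `C¹` in `x` whose values and gradients are dominated
by an integrable function of `t`, locally uniformly in `x`. -/
structure IsCaratheodory {E : Type*} [NormedAddCommGroup E] [InnerProductSpace ℝ E]
    [CompleteSpace E] (μ : Measure ℝ) (H : ℝ → E → ℝ) : Prop where
  aemeasurable : ∀ x, AEMeasurable (fun t => H t x) μ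
  contDiff : ∀ᵐ t ∂μ, ContDiff ℝ 1 (H t)
  bound : ∀ R : ℝ, ∃ h : ℝ → ℝ, Integrable h μ ∧
    ∀ᵐ t ∂μ, ∀ x, ‖x‖ ≤ R → |H t x| ≤ h t ∧ ‖gradient (H t) x‖ ≤ h t

namespace IsCaratheodory
variable {N : ℕ} {μ : Measure ℝ} {H : ℝ → EuclideanSpace ℝ (Fin N) → ℝ}
  {u v : ℝ → EuclideanSpace ℝ (Fin N)} {R : ℝ}

theorem hasDerivAt_line {E : Type*} [NormedAddCommGroup E] [InnerProductSpace ℝ E]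
    [CompleteSpace E] {f : E → ℝ} (hf : ContDiff ℝ 1 f) (x v : E) (τ : ℝ) :
    HasDerivAt (fun τ : ℝ => f (x + τ • v)) (inner ℝ (gradient f (x + τ • v)) v) τ := by
  have h1 : HasDerivAt (fun τ : ℝ => x + τ • v) v τ := by
    simpa using ((hasDerivAt_id τ).smul_const v).const_add x
  have h2 := ((hf.differentiable (by simp)) (x + τ • v)).hasGradientAt.hasFDerivAt
  have h3 := h2.comp_hasDerivAt τ h1
  simp only [InnerProductSpace.toDual_apply_apply] at h3
  exact h3

theorem continuous_gradient {E : Type*} [NormedAddCommGroup E] [InnerProductSpace ℝ E]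
    [CompleteSpace E] {f : E → ℝ} (hf : ContDiff ℝ 1 f) : Continuous (gradient f) :=
  (InnerProductSpace.toDual ℝ E).symm.continuous.comp (hf.continuous_fderiv (by simp))

/-- For a simple function the composition is a finite sum of restrictions of t ↦ H t x. Continuity
of H in x carries measurability to limits of simple functions. -/
theorem aestronglyMeasurable_comp (hH : IsCaratheodory μ H) (hu : AEStronglyMeasurable u μ) :
    AEStronglyMeasurable (fun t => H t (u t)) μ := by
  have hs : ∀ f : SimpleFunc ℝ (EuclideanSpace ℝ (Fin N)), AEMeasurable (fun t => H t (f t)) μ := by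
    intro f
    have : (fun t => H t (f t)) = fun t => ∑ x ∈ f.range, (f ⁻¹' {x}).indicator (fun t => H t x) t := by
      ext1 t
      rw [Finset.sum_eq_single (f t)]
      · rw [indicator_of_mem (by simp)]
      · intro x _ hx
        exact indicator_of_notMem (fun h => hx (by simpa using h.symm)) _
      · intro h
        exact absurd (f.mem_range_self t) h
    rw [this]
    exact Finset.aemeasurable_fun_sum _ fun x _ =>
      (hH.aemeasurable x).indicator (f.measurableSet_fiber x)
  obtain ⟨u', hu', huu'⟩ := hu
  have h1 : AEMeasurable (fun t => H t (u' t)) μ := by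
    refine aemeasurable_of_tendsto_metrizable_ae atTop (fun n => hs (hu'.approx n)) ?_
    filter_upwards [hH.contDiff] with t ht
    exact (ht.continuous.tendsto _).comp (hu'.tendsto_approx t)
  refine (h1.congr ?_).aestronglyMeasurable
  filter_upwards [huu'] with t ht
  rw [ht]

/-- Measurability of the gradient in t is not part of the definition. It is obtained by writing the
directional derivative as a limit of difference quotients, each of which is a composition. -/
theorem aestronglyMeasurable_inner (hH : IsCaratheodory μ H) (hu : AEStronglyMeasurable u μ)
    (hv : AEStronglyMeasurable v μ) :
    AEStronglyMeasurable (fun t => inner ℝ (gradient (H t) (u t)) (v t)) μ := by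
  let r : ℕ → ℝ := fun n => 1 / ((n : ℝ) + 1)
  have hr : Tendsto r atTop (𝓝[≠] 0) := by
    refine tendsto_nhdsWithin_iff.2 ⟨tendsto_one_div_add_atTop_nhds_zero_nat, ?_⟩
    exact Eventually.of_forall fun n => (by positivity : r n ≠ 0)
  refine aestronglyMeasurable_of_tendsto_ae atTop
    (f := fun n t => (r n)⁻¹ * (H t (u t + r n • v t) - H t (u t))) (fun n => ?_) ?_
  · exact ((hH.aestronglyMeasurable_comp (hu.add (hv.const_smul (r n)))).sub
      (hH.aestronglyMeasurable_comp hu)).const_mul _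
  · filter_upwards [hH.contDiff] with t ht
    have h := hasDerivAt_line ht (u t) (v t) 0
    rw [hasDerivAt_iff_tendsto_slope_zero] at h
    simp only [zero_add, zero_smul, add_zero] at h
    exact h.comp hr

theorem integrable_comp (hH : IsCaratheodory μ H) (hu : AEStronglyMeasurable u μ)
    (hR : ∀ᵐ t ∂μ, ‖u t‖ ≤ R) : Integrable (fun t => H t (u t)) μ := by
  obtain ⟨h, hi, hb⟩ := hH.bound R
  refine hi.mono' (hH.aestronglyMeasurable_comp hu) ?_
  filter_upwards [hb, hR] with t h1 h2
  exact (h1 _ h2).1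

theorem integrable_inner (hH : IsCaratheodory μ H) (hu : AEStronglyMeasurable u μ)
    (hv : AEStronglyMeasurable v μ) (hR : ∀ᵐ t ∂μ, ‖u t‖ ≤ R) (hvR : ∀ᵐ t ∂μ, ‖v t‖ ≤ R) :
    Integrable (fun t => inner ℝ (gradient (H t) (u t)) (v t)) μ := by
  obtain ⟨h, hi, hb⟩ := hH.bound R
  refine (hi.mul_const R).mono' (hH.aestronglyMeasurable_inner hu hv) ?_
  filter_upwards [hb, hR, hvR] with t h1 h2 h3
  have h4 := (h1 _ h2).2
  exact (norm_inner_le_norm _ _).trans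
    (mul_le_mul h4 h3 (norm_nonneg _) ((norm_nonneg _).trans h4))

theorem hasDerivAt_integral (hH : IsCaratheodory μ H) (hu : AEStronglyMeasurable u μ)
    (hv : AEStronglyMeasurable v μ) (hR : ∀ᵐ t ∂μ, ‖u t‖ ≤ R) (hvR : ∀ᵐ t ∂μ, ‖v t‖ ≤ R) :
    HasDerivAt (fun τ : ℝ => ∫ t, H t (u t + τ • v t) ∂μ)
      (∫ t, inner ℝ (gradient (H t) (u t)) (v t) ∂μ) 0 := by
  obtain ⟨h, hi, hb⟩ := hH.bound (R + R)
  have hm : ∀ τ : ℝ, AEStronglyMeasurable (fun t => u t + τ • v t) μ :=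
    fun τ => hu.add (hv.const_smul τ)
  have := (hasDerivAt_integral_of_dominated_loc_of_deriv_le (μ := μ)
    (F := fun τ t => H t (u t + τ • v t))
    (F' := fun τ t => inner ℝ (gradient (H t) (u t + τ • v t)) (v t))
    (x₀ := (0 : ℝ)) (s := Metric.ball 0 1) (bound := fun t => h t * R)
    (Metric.ball_mem_nhds _ one_pos)
    (Eventually.of_forall fun τ => hH.aestronglyMeasurable_comp (hm τ)) ?_
    (hH.aestronglyMeasurable_inner (hm 0) hv) ?_ (hi.mul_const R) ?_).2
  · simpa using this
  · simpa using hH.integrable_comp hu hR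
  · filter_upwards [hb, hR, hvR] with t h1 h2 h3 τ hτ
    rw [mem_ball_zero_iff, Real.norm_eq_abs] at hτ
    have h4 : ‖u t + τ • v t‖ ≤ R + R := by
      refine (norm_add_le _ _).trans (add_le_add h2 ?_)
      rw [norm_smul, Real.norm_eq_abs]
      nlinarith [norm_nonneg (v t)]
    have h5 := (h1 _ h4).2
    exact (norm_inner_le_norm _ _).trans
      (mul_le_mul h5 h3 (norm_nonneg _) ((norm_nonneg _).trans h5))
  · filter_upwards [hH.contDiff] with t ht τ _
    exact hasDerivAt_line ht _ _ _

theorem tendsto_integral_comp (hH : IsCaratheodory μ H) {ι : Type*} {l : Filter ι}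
    [l.IsCountablyGenerated] {U : ι → ℝ → EuclideanSpace ℝ (Fin N)}
    (hU : ∀ i, AEStronglyMeasurable (U i) μ) (hUR : ∀ᶠ i in l, ∀ᵐ t ∂μ, ‖U i t‖ ≤ R)
    (hlim : ∀ᵐ t ∂μ, Tendsto (fun i => U i t) l (𝓝 (u t))) :
    Tendsto (fun i => ∫ t, H t (U i t) ∂μ) l (𝓝 (∫ t, H t (u t) ∂μ)) := by
  obtain ⟨h, hi, hb⟩ := hH.bound R
  refine tendsto_integral_filter_of_dominated_convergence h
    (Eventually.of_forall fun i => hH.aestronglyMeasurable_comp (hU i)) ?_ hi ?_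
  · filter_upwards [hUR] with i hiR
    filter_upwards [hb, hiR] with t h1 h2
    exact (h1 _ h2).1
  · filter_upwards [hH.contDiff, hlim] with t h1 h2
    exact (h1.continuous.tendsto _).comp h2

theorem tendsto_integral_inner (hH : IsCaratheodory μ H) {ι : Type*} {l : Filter ι}
    [l.IsCountablyGenerated] {U W : ι → ℝ → EuclideanSpace ℝ (Fin N)}
    (hU : ∀ i, AEStronglyMeasurable (U i) μ) (hW : ∀ i, AEStronglyMeasurable (W i) μ)
    (hUR : ∀ᶠ i in l, ∀ᵐ t ∂μ, ‖U i t‖ ≤ R) (hWR : ∀ᶠ i in l, ∀ᵐ t ∂μ, ‖W i t‖ ≤ R)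
    (hlim : ∀ᵐ t ∂μ, Tendsto (fun i => U i t) l (𝓝 (u t)))
    (hlimW : ∀ᵐ t ∂μ, Tendsto (fun i => W i t) l (𝓝 (v t))) :
    Tendsto (fun i => ∫ t, inner ℝ (gradient (H t) (U i t)) (W i t) ∂μ) l
      (𝓝 (∫ t, inner ℝ (gradient (H t) (u t)) (v t) ∂μ)) := by
  obtain ⟨h, hi, hb⟩ := hH.bound R
  refine tendsto_integral_filter_of_dominated_convergence (fun t => h t * R)
    (Eventually.of_forall fun i => hH.aestronglyMeasurable_inner (hU i) (hW i)) ?_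
    (hi.mul_const R) ?_
  · filter_upwards [hUR, hWR] with i h1 h2
    filter_upwards [hb, h1, h2] with t h1 h2 h3
    have h4 := (h1 _ h2).2
    exact (norm_inner_le_norm _ _).trans
      (mul_le_mul h4 h3 (norm_nonneg _) ((norm_nonneg _).trans h4))
  · filter_upwards [hH.contDiff, hlim, hlimW] with t h1 h2 h3
    exact (((continuous_gradient h1).tendsto _).comp h2).inner h3

end IsCaratheodory

/-- The functional `u ↦ ∫ H(t,u)` on `w`, where `u = I^α w`. -/
noncomputable def integralFunctional {N : ℕ} {T p : ℝ} (α : ℝ)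
    (H : ℝ → EuclideanSpace ℝ (Fin N) → ℝ) (w : LpI N T p) : ℝ :=
  ∫ t in Icc 0 T, H t (rlIntegral α w t)

/-- The derivative of `integralFunctional`. -/
noncomputable def integralFunctionalDeriv {N : ℕ} {T p : ℝ} (α : ℝ)
    (H : ℝ → EuclideanSpace ℝ (Fin N) → ℝ) (w v : LpI N T p) : ℝ :=
  ∫ t in Icc 0 T, inner ℝ (gradient (H t) (rlIntegral α w t)) (rlIntegral α v t)

section
variable {N : ℕ} {T p α : ℝ} {H : ℝ → EuclideanSpace ℝ (Fin N) → ℝ}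

theorem aestronglyMeasurable_rlIntegral_lpI (hp : 1 < p) (w : LpI N T p) :
    AEStronglyMeasurable (rlIntegral α w) (volume.restrict (Icc 0 T)) :=
  aestronglyMeasurable_rlIntegral (memLp_integrableOn hp (Lp.memLp w))

theorem ae_norm_rlIntegral_lpI_le (hT : 0 < T) (hp : 1 < p) (hα : 1 / p < α) (w : LpI N T p)
    {R : ℝ} (hw : ‖w‖ ≤ R) :
    ∀ᵐ t ∂(volume.restrict (Icc 0 T)), ‖rlIntegral α w t‖ ≤ embConst T α p * R :=
  (ae_restrict_mem measurableSet_Icc).mono fun _ ht => (norm_rlIntegral_lpI_le hp hα ht w).trans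
    (mul_le_mul_of_nonneg_left hw (embConst_pos hT hp hα).le)

theorem integrable_integralFunctional
    (hH : IsCaratheodory (volume.restrict (Icc 0 T)) H)
    (hT : 0 < T) (hp : 1 < p) (hα : 1 / p < α) (w : LpI N T p) :
    IntegrableOn (fun t => H t (rlIntegral α w t)) (Icc 0 T) :=
  hH.integrable_comp (aestronglyMeasurable_rlIntegral_lpI hp w)
    (ae_norm_rlIntegral_lpI_le hT hp hα w le_rfl)

theorem integrable_integralFunctionalDeriv
    (hH : IsCaratheodory (volume.restrict (Icc 0 T)) H)
    (hT : 0 < T) (hp : 1 < p) (hα : 1 / p < α)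
    (w v : LpI N T p) : IntegrableOn (fun t =>
      inner ℝ (gradient (H t) (rlIntegral α w t)) (rlIntegral α v t)) (Icc 0 T) :=
  hH.integrable_inner (aestronglyMeasurable_rlIntegral_lpI hp w)
    (aestronglyMeasurable_rlIntegral_lpI hp v)
    (ae_norm_rlIntegral_lpI_le hT hp hα w (le_max_left _ ‖v‖))
    (ae_norm_rlIntegral_lpI_le hT hp hα v (le_max_right _ _))

theorem hasDerivAt_integralFunctional
    (hH : IsCaratheodory (volume.restrict (Icc 0 T)) H)
    (hT : 0 < T) (hp : 1 < p) (hα : 1 / p < α)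
    (w v : LpI N T p) : HasDerivAt (fun τ : ℝ => integralFunctional α H (w + τ • v))
      (integralFunctionalDeriv α H w v) 0 := by
  have h := hH.hasDerivAt_integral (aestronglyMeasurable_rlIntegral_lpI hp w)
    (aestronglyMeasurable_rlIntegral_lpI hp v)
    (ae_norm_rlIntegral_lpI_le hT hp hα w (le_max_left _ ‖v‖))
    (ae_norm_rlIntegral_lpI_le hT hp hα v (le_max_right _ _))
  refine h.congr_of_eventuallyEq (Eventually.of_forall fun τ => ?_)
  refine setIntegral_congr_fun measurableSet_Icc fun t ht => ?_
  rw [rlIntegral_lpI_add hp hα ht, rlIntegral_lpI_smul ht]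

theorem continuous_integralFunctional [Fact (1 ≤ ENNReal.ofReal p)]
    (hH : IsCaratheodory (volume.restrict (Icc 0 T)) H)
    (hT : 0 < T) (hp : 1 < p) (hα : 1 / p < α) :
    Continuous (integralFunctional (N := N) (T := T) (p := p) α H) := by
  rw [continuous_iff_continuousAt]
  intro w
  refine hH.tendsto_integral_comp (R := embConst T α p * (‖w‖ + 1))
    (fun v => aestronglyMeasurable_rlIntegral_lpI hp v) ?_ ?_
  · have : ∀ᶠ v in 𝓝 w, ‖v‖ < ‖w‖ + 1 :=
      continuous_norm.continuousAt.eventually_lt continuousAt_const (by linarith)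
    filter_upwards [this] with v hv using ae_norm_rlIntegral_lpI_le hT hp hα v hv.le
  · filter_upwards [ae_restrict_mem measurableSet_Icc] with t ht
    exact tendsto_rlIntegral_lpI hp hα tendsto_id ht

theorem continuous_integralFunctionalDeriv [Fact (1 ≤ ENNReal.ofReal p)]
    (hH : IsCaratheodory (volume.restrict (Icc 0 T)) H)
    (hT : 0 < T) (hp : 1 < p) (hα : 1 / p < α) :
    Continuous fun z : LpI N T p × LpI N T p => integralFunctionalDeriv α H z.1 z.2 := by
  rw [continuous_iff_continuousAt]
  intro z
  have hz : ∀ᶠ y in 𝓝 z, ‖y‖ < ‖z‖ + 1 :=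
    continuous_norm.continuousAt.eventually_lt continuousAt_const (by linarith)
  refine hH.tendsto_integral_inner (R := embConst T α p * (‖z‖ + 1))
    (fun y => aestronglyMeasurable_rlIntegral_lpI hp y.1)
    (fun y => aestronglyMeasurable_rlIntegral_lpI hp y.2) ?_ ?_ ?_ ?_
  · filter_upwards [hz] with y hy
    exact ae_norm_rlIntegral_lpI_le hT hp hα y.1 ((norm_fst_le y).trans hy.le)
  · filter_upwards [hz] with y hy
    exact ae_norm_rlIntegral_lpI_le hT hp hα y.2 ((norm_snd_le y).trans hy.le)
  · filter_upwards [ae_restrict_mem measurableSet_Icc] with t ht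
    exact tendsto_rlIntegral_lpI hp hα continuous_fst.continuousAt ht
  · filter_upwards [ae_restrict_mem measurableSet_Icc] with t ht
    exact tendsto_rlIntegral_lpI hp hα continuous_snd.continuousAt ht

theorem integralFunctionalDeriv_add
    (hH : IsCaratheodory (volume.restrict (Icc 0 T)) H)
    (hT : 0 < T) (hp : 1 < p) (hα : 1 / p < α)
    (w v v' : LpI N T p) : integralFunctionalDeriv α H w (v + v') =
      integralFunctionalDeriv α H w v + integralFunctionalDeriv α H w v' := by
  unfold integralFunctionalDeriv
  rw [← integral_add (integrable_integralFunctionalDeriv hH hT hp hα w v)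
    (integrable_integralFunctionalDeriv hH hT hp hα w v')]
  refine setIntegral_congr_fun measurableSet_Icc fun t ht => ?_
  rw [rlIntegral_lpI_add hp hα ht, inner_add_right]

theorem integralFunctionalDeriv_smul (c : ℝ)
    (w v : LpI N T p) : integralFunctionalDeriv α H w (c • v) =
      c * integralFunctionalDeriv α H w v := by
  unfold integralFunctionalDeriv
  rw [← integral_const_mul]
  refine setIntegral_congr_fun measurableSet_Icc fun t ht => ?_
  rw [rlIntegral_lpI_smul ht, real_inner_smul_right]

/-- On bounded sets the derivative is controlled by the sup norm of the direction. -/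
theorem exists_integralFunctionalDeriv_bound
    (hH : IsCaratheodory (volume.restrict (Icc 0 T)) H)
    (hT : 0 < T) (hp : 1 < p) (hα : 1 / p < α) (R : ℝ) :
    ∃ C, 0 ≤ C ∧ ∀ w v : LpI N T p, ‖w‖ ≤ R → ∀ ε, 0 ≤ ε →
      (∀ t ∈ Icc 0 T, ‖rlIntegral α v t‖ ≤ ε) → |integralFunctionalDeriv α H w v| ≤ C * ε := by
  obtain ⟨h, hi, hb⟩ := hH.bound (embConst T α p * R)
  refine ⟨|∫ t in Icc 0 T, h t|, abs_nonneg _, fun w v hw ε hε hv => ?_⟩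
  have h1 : |integralFunctionalDeriv α H w v| ≤ ∫ t in Icc 0 T, h t * ε := by
    rw [integralFunctionalDeriv, ← Real.norm_eq_abs]
    refine norm_integral_le_of_norm_le (hi.mul_const ε) ?_
    filter_upwards [hb, ae_norm_rlIntegral_lpI_le hT hp hα w hw,
      ae_restrict_mem measurableSet_Icc] with t h2 h3 ht
    have h4 := (h2 _ h3).2
    exact (norm_inner_le_norm _ _).trans
      (mul_le_mul h4 (hv t ht) (norm_nonneg _) ((norm_nonneg _).trans h4))
  rw [integral_mul_const] at h1
  exact h1.trans (mul_le_mul_of_nonneg_right (le_abs_self _) hε)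

end

/-! ### The energy functional, its geometry and the Palais-Smale condition -/

/-- This and the next two lemmas compare the primitive of the nonlocal coefficient with linear
expressions. The first bounds it below near the origin (mountain ring), the second bounds it above
along a ray, and the third bounds it below by z times the coefficient itself (Ambrosetti-Rabinowitz
estimate). -/
theorem mul_pow_le_add_pow_sub {a z : ℝ} (ha : 0 ≤ a) (hz : 0 ≤ z) (n : ℕ) :
    (n + 1) * a ^ n * z ≤ (a + z) ^ (n + 1) - a ^ (n + 1) := by
  induction n with
  | zero => simp
  | succ n ih =>
    have h1 := mul_le_mul_of_nonneg_left ih (add_nonneg ha hz)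
    have h2 : 0 ≤ (n + 1) * a ^ n * z * z := by positivity
    push_cast
    have e1 : (a + z) ^ (n + 1 + 1) = (a + z) * (a + z) ^ (n + 1) := pow_succ' _ _
    have e2 : a ^ (n + 1) = a * a ^ n := pow_succ' _ _
    have e3 : a ^ (n + 1 + 1) = a * (a * a ^ n) := by rw [pow_succ', e2]
    rw [e1, e3, e2]
    rw [e2] at h1
    nlinarith

theorem add_pow_sub_le {a z : ℝ} (ha : 0 ≤ a) (hz : 0 ≤ z) (n : ℕ) :
    (a + z) ^ (n + 1) - a ^ (n + 1) ≤ (n + 1) * z * (a + z) ^ n := by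
  induction n with
  | zero => simp
  | succ n ih =>
    have h1 := mul_le_mul_of_nonneg_left ih ha
    have h2 : 0 ≤ (n + 1) * z * (a + z) ^ n * z := by positivity
    push_cast
    have e1 : (a + z) ^ (n + 1 + 1) = (a + z) * (a + z) ^ (n + 1) := pow_succ' _ _
    have e2 : (a + z) ^ (n + 1) = (a + z) * (a + z) ^ n := pow_succ' _ _
    have e3 : a ^ (n + 1 + 1) = a * a ^ (n + 1) := pow_succ' _ _
    rw [e2] at h1 e1 ⊢
    rw [e1, e3]
    nlinarith

theorem mul_add_pow_le_sub {a z : ℝ} (ha : 0 ≤ a) (hz : 0 ≤ z) (n : ℕ) :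
    z * (a + z) ^ n ≤ (a + z) ^ (n + 1) - a ^ (n + 1) := by
  have h1 : a ^ n ≤ (a + z) ^ n := by gcongr; linarith
  rw [pow_succ', pow_succ']
  nlinarith

section Energy
variable {N k : ℕ} {T α a b lam : ℝ} {H₁ H₂ : ℝ → EuclideanSpace ℝ (Fin N) → ℝ}

/-- `‖w‖_p^p + ∫ H₁(t,u)`, which for `H₁(t,x) = V(t)|x|^p` is `‖u‖_V^p`. -/
noncomputable def potential (α : ℝ) (H₁ : ℝ → EuclideanSpace ℝ (Fin N) → ℝ)
    (w : LpI N T (expo k)) : ℝ :=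
  ‖w‖ ^ (k + 2) + integralFunctional α H₁ w

/-- The derivative of `potential`. -/
noncomputable def potentialDeriv (α : ℝ) (H₁ : ℝ → EuclideanSpace ℝ (Fin N) → ℝ)
    (w v : LpI N T (expo k)) : ℝ :=
  (k + 2) * powPairing w v + integralFunctionalDeriv α H₁ w v

/-- The energy functional of the Kirchhoff problem. -/
noncomputable def energy (α a b lam : ℝ) (H₁ H₂ : ℝ → EuclideanSpace ℝ (Fin N) → ℝ)
    (w : LpI N T (expo k)) : ℝ :=
  ((a + b * potential α H₁ w) ^ (k + 2) - a ^ (k + 2)) / (b * (k + 2) ^ 2) -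
    lam * integralFunctional α H₂ w

/-- The derivative of `energy`. -/
noncomputable def energyDeriv (α a b lam : ℝ) (H₁ H₂ : ℝ → EuclideanSpace ℝ (Fin N) → ℝ)
    (w v : LpI N T (expo k)) : ℝ :=
  (a + b * potential α H₁ w) ^ (k + 1) * (1 / (k + 2) * potentialDeriv α H₁ w v) -
    lam * integralFunctionalDeriv α H₂ w v

theorem continuous_potential (hH₁ : IsCaratheodory (volume.restrict (Icc 0 T)) H₁) (hT : 0 < T)
    (hα : 1 / expo k < α) :
    Continuous (potential (N := N) (T := T) (k := k) α H₁) :=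
  (continuous_norm.pow _).add (continuous_integralFunctional hH₁ hT (one_lt_expo k) hα)

theorem continuous_energy (hH₁ : IsCaratheodory (volume.restrict (Icc 0 T)) H₁)
    (hH₂ : IsCaratheodory (volume.restrict (Icc 0 T)) H₂) (hT : 0 < T) (hα : 1 / expo k < α) :
    Continuous (energy (N := N) (T := T) (k := k) α a b lam H₁ H₂) := by
  have h1 := continuous_potential hH₁ hT hα
  have h2 := continuous_integralFunctional (N := N) hH₂ hT (one_lt_expo k) hα
  unfold energy
  fun_prop

theorem continuous_energyDeriv (hH₁ : IsCaratheodory (volume.restrict (Icc 0 T)) H₁)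
    (hH₂ : IsCaratheodory (volume.restrict (Icc 0 T)) H₂) (hT : 0 < T) (hα : 1 / expo k < α) :
    Continuous fun z : LpI N T (expo k) × LpI N T (expo k) =>
      energyDeriv α a b lam H₁ H₂ z.1 z.2 := by
  have h1 : Continuous fun z : LpI N T (expo k) × LpI N T (expo k) => potential α H₁ z.1 :=
    (continuous_potential hH₁ hT hα).comp continuous_fst
  have h2 := continuous_integralFunctionalDeriv (N := N) hH₁ hT (one_lt_expo k) hα
  have h3 := continuous_integralFunctionalDeriv (N := N) hH₂ hT (one_lt_expo k) hα
  have h4 := continuous_powPairing (N := N) (k := k) (T := T)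
  unfold energyDeriv potentialDeriv
  fun_prop

theorem hasDerivAt_energy (hH₁ : IsCaratheodory (volume.restrict (Icc 0 T)) H₁)
    (hH₂ : IsCaratheodory (volume.restrict (Icc 0 T)) H₂) (hT : 0 < T) (hα : 1 / expo k < α)
    (hb : b ≠ 0) (w v : LpI N T (expo k)) :
    HasDerivAt (fun τ : ℝ => energy α a b lam H₁ H₂ (w + τ • v))
      (energyDeriv α a b lam H₁ H₂ w v) 0 := by
  have h1 : HasDerivAt (fun τ : ℝ => potential α H₁ (w + τ • v)) (potentialDeriv α H₁ w v) 0 :=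
    (hasDerivAt_norm_lpI_pow w v).add
      (hasDerivAt_integralFunctional hH₁ hT (one_lt_expo k) hα w v)
  have h2 := hasDerivAt_integralFunctional hH₂ hT (one_lt_expo k) hα w v
  have h3 := (((((h1.const_mul b).const_add a).pow (k + 2)).sub_const (a ^ (k + 2))).div_const
    (b * (k + 2) ^ 2)).sub (h2.const_mul lam)
  refine h3.congr_deriv ?_
  simp only [zero_smul, add_zero, energyDeriv]
  have : (k : ℝ) + 2 ≠ 0 := by positivity
  push_cast
  field_simp

theorem energyDeriv_add (hH₁ : IsCaratheodory (volume.restrict (Icc 0 T)) H₁)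
    (hH₂ : IsCaratheodory (volume.restrict (Icc 0 T)) H₂) (hT : 0 < T) (hα : 1 / expo k < α)
    (w v v' : LpI N T (expo k)) : energyDeriv α a b lam H₁ H₂ w (v + v') =
      energyDeriv α a b lam H₁ H₂ w v + energyDeriv α a b lam H₁ H₂ w v' := by
  unfold energyDeriv potentialDeriv
  rw [powPairing_add, integralFunctionalDeriv_add hH₁ hT (one_lt_expo k) hα,
    integralFunctionalDeriv_add hH₂ hT (one_lt_expo k) hα]
  ring

theorem energyDeriv_smul (c : ℝ) (w v : LpI N T (expo k)) :
    energyDeriv α a b lam H₁ H₂ w (c • v) = c * energyDeriv α a b lam H₁ H₂ w v := by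
  unfold energyDeriv potentialDeriv
  rw [powPairing_smul, integralFunctionalDeriv_smul, integralFunctionalDeriv_smul]
  ring

variable {θ : ℝ}

theorem norm_pow_le_potential {w : LpI N T (expo k)} (h : 0 ≤ integralFunctional α H₁ w) :
    ‖w‖ ^ (k + 2) ≤ potential α H₁ w := le_add_of_nonneg_right h

theorem potential_nonneg {w : LpI N T (expo k)} (h : 0 ≤ integralFunctional α H₁ w) :
    0 ≤ potential α H₁ w := (by positivity : 0 ≤ ‖w‖ ^ (k + 2)).trans (norm_pow_le_potential h)

/-- The Ambrosetti-Rabinowitz estimate. -/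
theorem potential_le_energy_sub (ha : 0 < a) (hb : 0 < b) (hlam : 0 ≤ lam)
    (hθ : ((k : ℝ) + 2) ^ 2 < θ) {w : LpI N T (expo k)} (h0 : 0 ≤ integralFunctional α H₁ w)
    (h1 : integralFunctionalDeriv α H₁ w w = (k + 2) * integralFunctional α H₁ w)
    (h2 : θ * integralFunctional α H₂ w ≤ integralFunctionalDeriv α H₂ w w) :
    (1 / ((k : ℝ) + 2) ^ 2 - 1 / θ) * a ^ (k + 1) * potential α H₁ w ≤
      energy α a b lam H₁ H₂ w - 1 / θ * energyDeriv α a b lam H₁ H₂ w w := by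
  have hX := potential_nonneg h0
  set X := potential α H₁ w with hXdef
  have hk : (0 : ℝ) < k + 2 := by positivity
  have hθ0 : 0 < θ := lt_trans (by positivity) hθ
  have hDX : potentialDeriv α H₁ w w = (k + 2) * X := by
    rw [potentialDeriv, powPairing_self, h1, hXdef, potential]; ring
  have hbX : 0 ≤ b * X := by positivity
  -- The Kirchhoff part of the energy is at least X (a + bX)^(p-1) / p², while its derivative in
  -- direction w is X (a + bX)^(p-1). Hence the threshold p², rather than p, for θ.
  have e1 : X * (a + b * X) ^ (k + 1) / (k + 2) ^ 2 ≤
      ((a + b * X) ^ (k + 2) - a ^ (k + 2)) / (b * (k + 2) ^ 2) := by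
    rw [div_le_div_iff₀ (by positivity) (by positivity)]
    have := mul_add_pow_le_sub ha.le hbX (k + 1)
    have h3 : 0 < ((k : ℝ) + 2) ^ 2 := by positivity
    nlinarith
  have e2 : a ^ (k + 1) ≤ (a + b * X) ^ (k + 1) := by gcongr; linarith
  have e3 : 0 < 1 / ((k : ℝ) + 2) ^ 2 - 1 / θ :=
    sub_pos.2 (one_div_lt_one_div_of_lt (by positivity) hθ)
  have e4 : integralFunctional α H₂ w ≤ 1 / θ * integralFunctionalDeriv α H₂ w w := by
    rw [one_div_mul_eq_div, le_div_iff₀ hθ0]; linarith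
  rw [energy, energyDeriv, hDX]
  have e5 : (1 / ((k : ℝ) + 2) ^ 2 - 1 / θ) * a ^ (k + 1) * X ≤
      (1 / ((k : ℝ) + 2) ^ 2 - 1 / θ) * (a + b * X) ^ (k + 1) * X := by gcongr
  have e6 : (a + b * X) ^ (k + 1) * (1 / ((k : ℝ) + 2) * ((k + 2) * X)) =
      (a + b * X) ^ (k + 1) * X := by field_simp
  have e7 := mul_le_mul_of_nonneg_left e4 hlam
  rw [e6]
  have e8 : X * (a + b * X) ^ (k + 1) / ((k : ℝ) + 2) ^ 2 =
    1 / ((k : ℝ) + 2) ^ 2 * (a + b * X) ^ (k + 1) * X := by ring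
  rw [e8] at e1
  nlinarith

/-- The principal part of the derivative is controlled by the derivative of the energy and the
compact lower order terms. -/
theorem abs_powPairing_le (ha : 0 < a) (hb : 0 < b) (hlam : 0 ≤ lam)
    {w v : LpI N T (expo k)} (h0 : 0 ≤ integralFunctional α H₁ w) {c₀ c₁ c₂ : ℝ}
    (e0 : |energyDeriv α a b lam H₁ H₂ w v| ≤ c₀)
    (e1 : |integralFunctionalDeriv α H₁ w v| ≤ c₁)
    (e2 : |integralFunctionalDeriv α H₂ w v| ≤ c₂) :
    |powPairing w v| ≤ (c₀ + lam * c₂) / a ^ (k + 1) + c₁ := by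
  have hX := potential_nonneg h0
  have hk : (0 : ℝ) < k + 2 := by positivity
  have hA : a ^ (k + 1) ≤ (a + b * potential α H₁ w) ^ (k + 1) := by
    gcongr
    have : 0 ≤ b * potential α H₁ w := by positivity
    linarith
  have hA0 : 0 < a ^ (k + 1) := by positivity
  set A := (a + b * potential α H₁ w) ^ (k + 1) with hAdef
  have hApos : 0 < A := hA0.trans_le hA
  -- The nonlocal coefficient A is at least a^(p-1) > 0, so the formula for the derivative can be
  -- solved for the principal part.
  have key : powPairing w v = (energyDeriv α a b lam H₁ H₂ w v +
      lam * integralFunctionalDeriv α H₂ w v) / A -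
        1 / (k + 2) * integralFunctionalDeriv α H₁ w v := by
    rw [energyDeriv, potentialDeriv, ← hAdef]
    field_simp
    ring
  rw [key]
  refine (abs_sub _ _).trans (add_le_add ?_ ?_)
  · rw [abs_div, abs_of_pos hApos]
    have : |energyDeriv α a b lam H₁ H₂ w v + lam * integralFunctionalDeriv α H₂ w v| ≤
        c₀ + lam * c₂ := by
      refine (abs_add_le _ _).trans (add_le_add e0 ?_)
      rw [abs_mul, abs_of_nonneg hlam]
      gcongr
    have := (abs_nonneg _).trans this
    gcongr
  · rw [abs_mul, abs_of_pos (by positivity)]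
    have h1 : 1 / ((k : ℝ) + 2) ≤ 1 := by
      rw [div_le_one hk]
      have : (0 : ℝ) ≤ k := k.cast_nonneg
      linarith
    nlinarith [abs_nonneg (integralFunctionalDeriv α H₁ w v)]

/-- The Palais-Smale condition. -/
theorem exists_critical_of_palaisSmale (hH₁ : IsCaratheodory (volume.restrict (Icc 0 T)) H₁)
    (hH₂ : IsCaratheodory (volume.restrict (Icc 0 T)) H₂) (hT : 0 < T) (hα : 1 / expo k < α)
    (hα1 : α ≤ 1) (ha : 0 < a) (hb : 0 < b) (hlam : 0 ≤ lam) (hθ : ((k : ℝ) + 2) ^ 2 < θ)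
    (h0 : ∀ w : LpI N T (expo k), 0 ≤ integralFunctional α H₁ w)
    (h1 : ∀ w : LpI N T (expo k),
      integralFunctionalDeriv α H₁ w w = (k + 2) * integralFunctional α H₁ w)
    (h2 : ∀ w : LpI N T (expo k),
      θ * integralFunctional α H₂ w ≤ integralFunctionalDeriv α H₂ w w)
    {S : Submodule ℝ (LpI N T (expo k))} (hS : IsClosed (S : Set (LpI N T (expo k))))
    {ρ C : ℝ} (hPS : ∀ ε > 0, ∃ w ∈ S, ρ ≤ energy α a b lam H₁ H₂ w ∧
      energy α a b lam H₁ H₂ w ≤ C ∧ ∀ v ∈ S, |energyDeriv α a b lam H₁ H₂ w v| ≤ ε * ‖v‖) :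
    ∃ w ∈ S, ρ ≤ energy α a b lam H₁ H₂ w ∧ energy α a b lam H₁ H₂ w ≤ C ∧
      ∀ v ∈ S, energyDeriv α a b lam H₁ H₂ w v = 0 := by
  have hp := one_lt_expo k
  have hθ0 : 0 < θ := lt_trans (by positivity) hθ
  let r : ℕ → ℝ := fun n => 1 / ((n : ℝ) + 1)
  have hr0 : ∀ n, 0 < r n := fun n => by positivity
  have hrlim : Tendsto r atTop (𝓝 0) := tendsto_one_div_add_atTop_nhds_zero_nat
  choose w hwS hwρ hwC hwD using fun n => hPS (r n) (hr0 n)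
  set κ := (1 / ((k : ℝ) + 2) ^ 2 - 1 / θ) * a ^ (k + 1) with hκdef
  have hκ : 0 < κ := mul_pos (sub_pos.2 (one_div_lt_one_div_of_lt (by positivity) hθ))
    (by positivity)
  -- When ‖w n‖ ≥ 1 the potential dominates ‖w n‖², because p ≥ 2. The Ambrosetti-Rabinowitz
  -- estimate bounds it by an expression growing only linearly in ‖w n‖.
  have hbound : ∀ n, ‖w n‖ ≤ max 1 ((|C| + 1) / κ) := by
    intro n
    rcases le_total ‖w n‖ 1 with hle | hle
    · exact hle.trans (le_max_left _ _)
    · refine le_trans ?_ (le_max_right _ _)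
      have e1 := potential_le_energy_sub (α := α) (H₁ := H₁) (H₂ := H₂) ha hb hlam hθ
        (h0 (w n)) (h1 (w n)) (h2 (w n))
      rw [← hκdef] at e1
      have e2 := hwD n (w n) (hwS n)
      have hr1 : r n ≤ 1 := by
        simp only [r]
        rw [div_le_one (by positivity)]
        have : (0 : ℝ) ≤ n := n.cast_nonneg
        linarith
      have hθ1 : 1 / θ ≤ 1 := by
        rw [div_le_one hθ0]
        have : (0 : ℝ) ≤ k := k.cast_nonneg
        nlinarith
      have e3 : |1 / θ * energyDeriv α a b lam H₁ H₂ (w n) (w n)| ≤ ‖w n‖ := by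
        rw [abs_mul, abs_of_pos (by positivity)]
        calc _ ≤ 1 * (1 * ‖w n‖) := by
              refine mul_le_mul hθ1 (e2.trans ?_) (abs_nonneg _) one_pos.le
              gcongr
          _ = _ := by ring
      have e4 : ‖w n‖ ^ 2 ≤ potential α H₁ (w n) := by
        refine le_trans ?_ (norm_pow_le_potential (h0 (w n)))
        exact pow_le_pow_right₀ hle (by omega)
      have e5 : κ * ‖w n‖ ^ 2 ≤ |C| * ‖w n‖ + ‖w n‖ := by
        have := mul_le_mul_of_nonneg_left e4 hκ.le
        have := neg_le_of_abs_le e3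
        have := le_abs_self C
        have := hwC n
        have := mul_le_mul_of_nonneg_left hle (abs_nonneg C)
        linarith
      rw [le_div_iff₀ hκ]
      have hpos : 0 < ‖w n‖ := by linarith
      have : (‖w n‖ * κ) * ‖w n‖ ≤ (|C| + 1) * ‖w n‖ := by nlinarith
      exact le_of_mul_le_mul_right this hpos
  set R := max 1 ((|C| + 1) / κ) with hR
  have hR0 : 0 < R := lt_of_lt_of_le one_pos (le_max_left _ _)
  obtain ⟨φ, hφ, hφC⟩ := exists_subseq_uniformCauchy hT hp hα hα1 w hbound
  obtain ⟨C₁, hC₁, hb₁⟩ := exists_integralFunctionalDeriv_bound (N := N) hH₁ hT hp hα R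
  obtain ⟨C₂, hC₂, hb₂⟩ := exists_integralFunctionalDeriv_bound (N := N) hH₂ hT hp hα R
  set M := (2 * R + lam * C₂) / a ^ (k + 1) + C₁ with hM
  have hM0 : 0 < M := by positivity
  -- A direction v that is small in sup norm makes all lower order terms small, and the error r n
  -- makes the derivative small. Therefore the principal pairing is small although v need not be
  -- small in L^p.
  have hpair : ∀ (n : ℕ) (v : LpI N T (expo k)) (ε : ℝ), v ∈ S → ‖v‖ ≤ 2 * R → 0 ≤ ε →
      r n ≤ ε → (∀ t ∈ Icc 0 T, ‖rlIntegral α v t‖ ≤ ε) → |powPairing (w n) v| ≤ M * ε := by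
    intro n v ε hv hvR hε hrn hvε
    refine (abs_powPairing_le ha hb hlam (h0 (w n)) (c₀ := ε * (2 * R)) ((hwD n v hv).trans ?_)
      (hb₁ (w n) v (hbound n) ε hε hvε) (hb₂ (w n) v (hbound n) ε hε hvε)).trans_eq ?_
    · gcongr
    · rw [hM]; ring
  have hcauchy : CauchySeq (fun n => w (φ n)) := by
    rw [Metric.cauchySeq_iff]
    intro η hη
    -- Chosen so that strong monotonicity, with two pairings of size at most M ε, yields ‖w (φ n) -
    -- w (φ m)‖^p ≤ η^p / 2.
    set ε := η ^ (k + 2) / (2 ^ (k + 1) * (2 * M) * 2) with hεdef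
    have hε : 0 < ε := by positivity
    obtain ⟨n₀, hn₀⟩ := hφC ε hε
    obtain ⟨n₁, hn₁⟩ := eventually_atTop.1
      ((hrlim.comp hφ.tendsto_atTop).eventually (gt_mem_nhds hε))
    refine ⟨max n₀ n₁, fun n hn m hm => ?_⟩
    rw [dist_eq_norm]
    have hv : w (φ n) - w (φ m) ∈ S := S.sub_mem (hwS _) (hwS _)
    have hvR : ‖w (φ n) - w (φ m)‖ ≤ 2 * R :=
      (norm_sub_le _ _).trans (by linarith [hbound (φ n), hbound (φ m)])
    have hvε : ∀ t ∈ Icc 0 T, ‖rlIntegral α (w (φ n) - w (φ m) : LpI N T (expo k)) t‖ ≤ ε := by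
      intro t ht
      rw [rlIntegral_lpI_sub hp hα ht]
      exact hn₀ n (le_of_max_le_left hn) m (le_of_max_le_left hm) t ht
    have g1 := hpair (φ n) _ ε hv hvR hε.le (hn₁ n (le_of_max_le_right hn)).le hvε
    have g2 := hpair (φ m) _ ε hv hvR hε.le (hn₁ m (le_of_max_le_right hm)).le hvε
    have g3 := norm_sub_pow_le_powPairing (w (φ n)) (w (φ m))
    have g4 : powPairing (w (φ n)) (w (φ n) - w (φ m)) -
        powPairing (w (φ m)) (w (φ n) - w (φ m)) ≤ 2 * M * ε := by
      have := le_of_abs_le g1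
      have := neg_le_of_abs_le g2
      linarith
    have g5 : ‖w (φ n) - w (φ m)‖ ^ (k + 2) < η ^ (k + 2) := by
      calc _ ≤ 2 ^ (k + 1) * (2 * M * ε) := by
            refine g3.trans ?_
            gcongr
        _ = η ^ (k + 2) / 2 := by rw [hεdef]; field_simp
        _ < _ := half_lt_self (by positivity)
    exact lt_of_pow_lt_pow_left₀ _ hη.le g5
  obtain ⟨w₀, hlim⟩ := cauchySeq_tendsto_of_complete hcauchy
  have hI := ((continuous_energy (a := a) (b := b) (lam := lam) hH₁ hH₂ hT hα).tendsto w₀).comp hlim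
  refine ⟨w₀, hS.mem_of_tendsto hlim (Eventually.of_forall fun n => hwS _),
    ge_of_tendsto' hI fun n => hwρ _, le_of_tendsto' hI fun n => hwC _, fun v hv => ?_⟩
  have hD := ((continuous_energyDeriv (a := a) (b := b) (lam := lam) hH₁ hH₂ hT hα).tendsto
    (w₀, v)).comp (hlim.prodMk_nhds (tendsto_const_nhds (x := v)))
  have hD0 : Tendsto (fun n => energyDeriv α a b lam H₁ H₂ (w (φ n)) v) atTop (𝓝 0) := by
    refine squeeze_zero_norm (fun n => hwD (φ n) v hv) ?_
    simpa using (hrlim.comp hφ.tendsto_atTop).mul_const ‖v‖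
  exact tendsto_nhds_unique hD hD0

/-- The mountain ring around the origin. -/
theorem exists_energy_ring (ha : 0 < a) (hb : 0 < b) (hlam : 0 ≤ lam)
    (h0 : ∀ w : LpI N T (expo k), 0 ≤ integralFunctional α H₁ w)
    {c q : ℝ} (hq : expo k < q)
    (h2q : ∀ w : LpI N T (expo k), integralFunctional α H₂ w ≤ c * ‖w‖ ^ q)
    {R : ℝ} (hR : 0 < R) :
    ∃ r ρ : ℝ, 0 < r ∧ r < R ∧ 0 < ρ ∧
      ∀ w : LpI N T (expo k), ‖w‖ = r → ρ ≤ energy α a b lam H₁ H₂ w := by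
  set m := a ^ (k + 1) / (2 * (k + 2)) with hm
  have hm0 : 0 < m := by positivity
  -- With r = ‖w‖ the energy is at least 2 m r^p - λ c r^q. As q > p, the second term is absorbed by
  -- m r^p for small r, leaving the ring height m r^p.
  have hlow : ∀ w : LpI N T (expo k),
      2 * m * ‖w‖ ^ (k + 2) - lam * c * ‖w‖ ^ q ≤ energy α a b lam H₁ H₂ w := by
    intro w
    have hX := potential_nonneg (h0 w)
    have e1 := norm_pow_le_potential (h0 w)
    set X := potential α H₁ w with hXdef
    have e2 := mul_pow_le_add_pow_sub ha.le (by positivity : 0 ≤ b * X) (k + 1)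
    have e3 : 2 * m * X ≤ ((a + b * X) ^ (k + 2) - a ^ (k + 2)) / (b * (k + 2) ^ 2) := by
      rw [le_div_iff₀ (by positivity), hm]
      have : 2 * (a ^ (k + 1) / (2 * ((k : ℝ) + 2))) * X * (b * (k + 2) ^ 2) =
          (k + 2) * a ^ (k + 1) * (b * X) := by field_simp
      rw [this]
      push_cast at e2
      have e4 : ((k : ℝ) + 1 + 1) = k + 2 := by ring
      rw [e4] at e2
      exact e2
    have e5 := mul_le_mul_of_nonneg_left (h2q w) hlam
    have e6 := mul_le_mul_of_nonneg_left e1 (by positivity : 0 ≤ 2 * m)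
    rw [energy, ← hXdef]
    linarith
  have hcont : ContinuousAt (fun r : ℝ => lam * c * r ^ (q - expo k)) 0 :=
    ((Real.continuousAt_rpow_const 0 (q - expo k) (Or.inr (by linarith))).const_mul _)
  have hval : lam * c * (0 : ℝ) ^ (q - expo k) < m := by
    rw [Real.zero_rpow (by linarith), mul_zero]; exact hm0
  have h3 : ∀ᶠ r : ℝ in 𝓝[>] 0, lam * c * r ^ (q - expo k) < m :=
    (hcont.eventually_lt continuousAt_const hval).filter_mono nhdsWithin_le_nhds
  obtain ⟨r, hrm, hr⟩ := (h3.and (Ioo_mem_nhdsGT hR)).exists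
  have hr0 : 0 < r := hr.1
  refine ⟨r, m * r ^ (k + 2), hr0, hr.2, by positivity, fun w hw => ?_⟩
  have e1 := hlow w
  rw [hw] at e1
  have e2 : r ^ q = r ^ (q - expo k) * r ^ (k + 2) := by
    rw [← Real.rpow_natCast, ← Real.rpow_add hr0]; congr 1; simp
  have e3 : 0 < r ^ (k + 2) := by positivity
  rw [e2] at e1
  nlinarith

/-- Palais-Smale sequences at mountain pass level. -/
theorem exists_palaisSmale (hH₁ : IsCaratheodory (volume.restrict (Icc 0 T)) H₁)
    (hH₂ : IsCaratheodory (volume.restrict (Icc 0 T)) H₂) (hT : 0 < T) (hα : 1 / expo k < α)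
    (hb : 0 < b) (S : Submodule ℝ (LpI N T (expo k)))
    (hS : IsClosed (S : Set (LpI N T (expo k)))) {r ρ C : ℝ}
    {e : LpI N T (expo k)} (heS : e ∈ S) (hr : 0 ≤ r) (hre : r ≤ ‖e‖)
    (hring : ∀ w : LpI N T (expo k), ‖w‖ = r → ρ ≤ energy α a b lam H₁ H₂ w)
    (hI0 : energy α a b lam H₁ H₂ (0 : LpI N T (expo k)) < ρ)
    (he : energy α a b lam H₁ H₂ e < ρ)
    (hC : ∀ s ∈ Icc (0 : ℝ) 1, energy α a b lam H₁ H₂ (s • e) ≤ C)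
    {ε : ℝ} (hε : 0 < ε) :
    ∃ w ∈ S, ρ ≤ energy α a b lam H₁ H₂ w ∧
      energy α a b lam H₁ H₂ w ≤ C ∧ ∀ v ∈ S, |energyDeriv α a b lam H₁ H₂ w v| ≤ ε * ‖v‖ := by
  have : CompleteSpace S := hS.completeSpace_coe
  let D : LpI N T (expo k) → LpI N T (expo k) →ₗ[ℝ] ℝ := fun w =>
    { toFun := fun v => energyDeriv α a b lam H₁ H₂ w v
      map_add' := fun v v' => energyDeriv_add hH₁ hH₂ hT hα w v v'
      map_smul' := fun c v => energyDeriv_smul c w v }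
  exact mountain_pass_submodule (energy α a b lam H₁ H₂) D (continuous_energy hH₁ hH₂ hT hα)
    (fun w v => hasDerivAt_energy hH₁ hH₂ hT hα hb.ne' w v)
    (continuous_energyDeriv hH₁ hH₂ hT hα) S heS hr hre hring hI0 he hC hε

/-- Existence of a critical point of mountain pass type. -/
theorem exists_critical_point (hH₁ : IsCaratheodory (volume.restrict (Icc 0 T)) H₁)
    (hH₂ : IsCaratheodory (volume.restrict (Icc 0 T)) H₂) (hT : 0 < T) (hα : 1 / expo k < α)
    (hα1 : α ≤ 1) (ha : 0 < a) (hb : 0 < b) (hlam : 0 ≤ lam) (hθ : ((k : ℝ) + 2) ^ 2 < θ)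
    (h0 : ∀ w : LpI N T (expo k), 0 ≤ integralFunctional α H₁ w)
    (h00 : integralFunctional α H₁ (0 : LpI N T (expo k)) = 0)
    (h1 : ∀ w : LpI N T (expo k),
      integralFunctionalDeriv α H₁ w w = (k + 2) * integralFunctional α H₁ w)
    (h2 : ∀ w : LpI N T (expo k),
      θ * integralFunctional α H₂ w ≤ integralFunctionalDeriv α H₂ w w)
    (h20 : integralFunctional α H₂ (0 : LpI N T (expo k)) = 0)
    {c q : ℝ} (hq : expo k < q)
    (h2q : ∀ w : LpI N T (expo k), integralFunctional α H₂ w ≤ c * ‖w‖ ^ q)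
    {S : Submodule ℝ (LpI N T (expo k))} (hS : IsClosed (S : Set (LpI N T (expo k))))
    {e : LpI N T (expo k)} (heS : e ∈ S) (he : energy α a b lam H₁ H₂ e < 0) {C : ℝ}
    (hC : ∀ s ∈ Icc (0 : ℝ) 1, energy α a b lam H₁ H₂ (s • e) ≤ C) :
    ∃ w ∈ S, 0 < energy α a b lam H₁ H₂ w ∧ energy α a b lam H₁ H₂ w ≤ C ∧
      ∀ v ∈ S, energyDeriv α a b lam H₁ H₂ w v = 0 := by
  have hI0 : energy α a b lam H₁ H₂ (0 : LpI N T (expo k)) = 0 := by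
    rw [energy, potential, h00, h20]; simp
  have hene : e ≠ 0 := by rintro rfl; rw [hI0] at he; exact lt_irrefl _ he
  -- The radius is taken below ‖e‖, so that the ring separates 0 from e.
  obtain ⟨r, ρ, hr0, hre, hρ, hring⟩ := exists_energy_ring (a := a) (b := b) (lam := lam)
    ha hb hlam h0 hq h2q (norm_pos_iff.2 hene)
  obtain ⟨w, hwS, e1, e2, e3⟩ := exists_critical_of_palaisSmale (ρ := ρ) (C := C)
    hH₁ hH₂ hT hα hα1 ha hb hlam hθ h0 h1 h2 hS (fun ε hε =>
      exists_palaisSmale hH₁ hH₂ hT hα hb S hS heS hr0.le hre.le hring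
        (hI0.trans_lt hρ) (he.trans hρ) hC hε)
  exact ⟨w, hwS, hρ.trans_le e1, e2, e3⟩

end Energy

/-! ### Truncation of the nonlinearity -/

section Truncation
variable {E : Type*} [NormedAddCommGroup E]

/-- A smooth radial cutoff: `1` for `|x| ≤ δ/2` and `0` for `|x| ≥ 3δ/4`. -/
noncomputable def cutoff (δ : ℝ) (x : E) : ℝ :=
  Real.smoothTransition ((9 * δ ^ 2 - 16 * ‖x‖ ^ 2) / (5 * δ ^ 2))

variable {δ : ℝ}

theorem cutoff_nonneg (x : E) : 0 ≤ cutoff δ x := Real.smoothTransition.nonneg _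

theorem cutoff_le_one (x : E) : cutoff δ x ≤ 1 := Real.smoothTransition.le_one _

theorem cutoff_eq_one (hδ : 0 < δ) {x : E} (hx : ‖x‖ ≤ δ / 2) : cutoff δ x = 1 := by
  refine Real.smoothTransition.one_of_one_le ?_
  rw [le_div_iff₀ (by positivity)]
  nlinarith [norm_nonneg x]

theorem cutoff_eq_zero (hδ : 0 < δ) {x : E} (hx : 3 * δ / 4 ≤ ‖x‖) : cutoff δ x = 0 := by
  refine Real.smoothTransition.zero_of_nonpos ?_
  refine div_nonpos_of_nonpos_of_nonneg ?_ (by positivity)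
  nlinarith [norm_nonneg x]

theorem closedBall_mem_nhds_of_norm_lt {x : E} (hx : ‖x‖ < δ) :
    Metric.closedBall (0 : E) δ ∈ 𝓝 x :=
  mem_of_superset (Metric.isOpen_ball.mem_nhds (mem_ball_zero_iff.2 hx))
    Metric.ball_subset_closedBall

variable {M q : ℝ}

/-- The truncation of `f`: equal to `f` near the origin and to `M |x|^q` far away. -/
noncomputable def truncation (δ M q : ℝ) (f : E → ℝ) (x : E) : ℝ :=
  M * ‖x‖ ^ q + cutoff δ x * (f x - M * ‖x‖ ^ q)

variable {f : E → ℝ}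

theorem truncation_eq (hδ : 0 < δ) {x : E} (hx : ‖x‖ ≤ δ / 2) : truncation δ M q f x = f x := by
  rw [truncation, cutoff_eq_one hδ hx]; ring

theorem truncation_eventuallyEq (hδ : 0 < δ) {x : E} (hx : ‖x‖ < δ / 2) :
    truncation δ M q f =ᶠ[𝓝 x] f := by
  filter_upwards [(isOpen_lt continuous_norm continuous_const).mem_nhds hx] with y hy
  exact truncation_eq hδ (le_of_lt hy)

theorem truncation_eq_of_le (hδ : 0 < δ) {x : E} (hx : 3 * δ / 4 ≤ ‖x‖) :
    truncation δ M q f x = M * ‖x‖ ^ q := by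
  rw [truncation, cutoff_eq_zero hδ hx]; ring

theorem truncation_eventuallyEq_of_lt (hδ : 0 < δ) {x : E} (hx : 3 * δ / 4 < ‖x‖) :
    truncation δ M q f =ᶠ[𝓝 x] fun x => M * ‖x‖ ^ q := by
  filter_upwards [(isOpen_lt continuous_const continuous_norm).mem_nhds hx] with y hy
  exact truncation_eq_of_le hδ (le_of_lt hy)

/-- The truncation is the convex combination η f + (1 - η) M|x|^q where f is controlled. Where f is
not controlled the cutoff vanishes, since it is already zero for |x| ≥ 3δ/4. -/
theorem truncation_bounds (hδ : 0 < δ) (hM : 0 ≤ M)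
    (hf : ∀ x ∈ Metric.closedBall (0 : E) δ, 0 ≤ f x ∧ f x ≤ M * ‖x‖ ^ q) (x : E) :
    0 ≤ truncation δ M q f x ∧ truncation δ M q f x ≤ M * ‖x‖ ^ q := by
  rcases lt_or_ge ‖x‖ δ with h | h
  · obtain ⟨h1, h2⟩ := hf x (mem_closedBall_zero_iff.2 h.le)
    have h3 := cutoff_nonneg (δ := δ) x
    have h4 := cutoff_le_one (δ := δ) x
    rw [truncation]
    constructor
    · have : 0 ≤ (1 - cutoff δ x) * (M * ‖x‖ ^ q) :=
        mul_nonneg (sub_nonneg.2 h4) (h1.trans h2)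
      nlinarith [mul_nonneg h3 h1]
    · nlinarith [mul_nonneg h3 (sub_nonneg.2 h2)]
  · rw [truncation_eq_of_le hδ (by linarith)]
    exact ⟨by positivity, le_rfl⟩

variable [InnerProductSpace ℝ E]

/-- The cutoff depends on |x|², not on |x|, so the origin causes no loss of smoothness. -/
theorem contDiff_cutoff (δ : ℝ) : ContDiff ℝ 1 (cutoff δ : E → ℝ) :=
  (Real.smoothTransition.contDiff (n := 1)).comp
    ((contDiff_const.sub (contDiff_const.mul (contDiff_norm_sq ℝ))).div_const _)

theorem fderiv_apply_eq_of_hasDerivAt {f : E → ℝ} {x v : E} {d : ℝ} (hf : DifferentiableAt ℝ f x)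
    (h : HasDerivAt (fun τ : ℝ => f (x + τ • v)) d 0) : fderiv ℝ f x v = d := by
  have h1 : HasDerivAt (fun τ : ℝ => x + τ • v) v 0 := by
    simpa using ((hasDerivAt_id (0 : ℝ)).smul_const v).const_add x
  have h2 := HasFDerivAt.comp_hasDerivAt_of_eq (0 : ℝ) hf.hasFDerivAt h1 (by simp)
  exact h2.unique h

/-- Along the ray (1 + τ)x the cutoff is an antitone function of (1 + τ)²|x|², so its radial
derivative is nonpositive. -/
theorem fderiv_cutoff_self_nonpos (x : E) : fderiv ℝ (cutoff δ) x x ≤ 0 := by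
  have hd : DifferentiableAt ℝ (cutoff δ : E → ℝ) x :=
    (contDiff_cutoff δ).differentiable (by simp) x
  let ζ : ℝ → ℝ := fun s => Real.smoothTransition ((9 * δ ^ 2 - 16 * s) / (5 * δ ^ 2))
  have hζ : Antitone ζ := by
    intro s s' hs
    refine Real.smoothTransition.monotone ?_
    gcongr
  have hζd : Differentiable ℝ ζ := by
    have : Differentiable ℝ Real.smoothTransition :=
      (Real.smoothTransition.contDiff (n := 1)).differentiable (by simp)
    exact this.comp (by fun_prop)
  have h1 : HasDerivAt (fun τ : ℝ => (1 + τ) ^ 2 * ‖x‖ ^ 2) (2 * ‖x‖ ^ 2) 0 := by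
    have := (((hasDerivAt_id (0 : ℝ)).const_add 1).pow 2).mul_const (‖x‖ ^ 2)
    simpa using this
  have h2 : HasDerivAt (fun τ : ℝ => ζ ((1 + τ) ^ 2 * ‖x‖ ^ 2))
      (deriv ζ (‖x‖ ^ 2) * (2 * ‖x‖ ^ 2)) 0 :=
    HasDerivAt.comp_of_eq (0 : ℝ) (hζd (‖x‖ ^ 2)).hasDerivAt h1 (by simp)
  have h3 : (fun τ : ℝ => cutoff δ (x + τ • x)) = fun τ : ℝ => ζ ((1 + τ) ^ 2 * ‖x‖ ^ 2) := by
    ext1 τ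
    have : ‖x + τ • x‖ ^ 2 = (1 + τ) ^ 2 * ‖x‖ ^ 2 := by
      rw [show x + τ • x = (1 + τ) • x by rw [add_smul, one_smul], norm_smul, mul_pow,
        Real.norm_eq_abs, sq_abs]
    simp only [cutoff, ζ, this]
  rw [fderiv_apply_eq_of_hasDerivAt hd (h3 ▸ h2)]
  exact mul_nonpos_of_nonpos_of_nonneg hζ.deriv_nonpos (by positivity)

theorem contDiff_mul_norm_rpow (M : ℝ) (hq : 1 < q) :
    ContDiff ℝ 1 (fun x : E => M * ‖x‖ ^ q) := contDiff_const.mul (contDiff_norm_rpow hq)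

/-- Euler's identity for a function homogeneous of degree q. -/
theorem fderiv_mul_norm_rpow_self (M : ℝ) (hq : 1 < q) (x : E) :
    fderiv ℝ (fun x : E => M * ‖x‖ ^ q) x x = q * (M * ‖x‖ ^ q) := by
  refine fderiv_apply_eq_of_hasDerivAt ((contDiff_mul_norm_rpow M hq).differentiable (by simp) x) ?_
  have h1 : HasDerivAt (fun τ : ℝ => (1 + τ) ^ q) (q * (1 : ℝ) ^ (q - 1)) 0 := by
    have h := Real.hasDerivAt_rpow_const (x := (1 : ℝ)) (p := q) (Or.inl one_ne_zero)
    have h2 : HasDerivAt (fun τ : ℝ => 1 + τ) 1 0 := (hasDerivAt_id _).const_add 1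
    have h3 := HasDerivAt.comp_of_eq (0 : ℝ) h h2 (by simp)
    rw [mul_one] at h3
    exact h3
  have h2 := h1.mul_const (M * ‖x‖ ^ q)
  rw [Real.one_rpow, mul_one] at h2
  refine h2.congr_of_eventuallyEq ?_
  filter_upwards [Ioi_mem_nhds (show (-1 : ℝ) < 0 by norm_num)] with τ hτ
  have h3 : 0 ≤ 1 + τ := by have : -1 < τ := hτ; linarith
  have : ‖x + τ • x‖ = (1 + τ) * ‖x‖ := by
    rw [show x + τ • x = (1 + τ) • x by rw [add_smul, one_smul], norm_smul,
      Real.norm_of_nonneg h3]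
  rw [this, Real.mul_rpow h3 (norm_nonneg _)]
  ring

theorem contDiff_truncation (hδ : 0 < δ) (hq : 1 < q)
    (hf : ContDiffOn ℝ 1 f (Metric.closedBall 0 δ)) : ContDiff ℝ 1 (truncation δ M q f) := by
  rw [contDiff_iff_contDiffAt]
  intro x
  have hG := (contDiff_mul_norm_rpow (E := E) M hq).contDiffAt (x := x)
  rcases lt_or_ge ‖x‖ δ with h | h
  · have hfx : ContDiffAt ℝ 1 f x := hf.contDiffAt (closedBall_mem_nhds_of_norm_lt h)
    exact hG.add ((contDiff_cutoff δ).contDiffAt.mul (hfx.sub hG))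
  · exact hG.congr_of_eventuallyEq (truncation_eventuallyEq_of_lt hδ (by linarith))

theorem fderiv_truncation {x : E} (hq : 1 < q) (hf : DifferentiableAt ℝ f x) :
    fderiv ℝ (truncation δ M q f) x = fderiv ℝ (fun x : E => M * ‖x‖ ^ q) x +
      (cutoff δ x • (fderiv ℝ f x - fderiv ℝ (fun x : E => M * ‖x‖ ^ q) x) +
        (f x - M * ‖x‖ ^ q) • fderiv ℝ (cutoff δ) x) := by
  have hG : DifferentiableAt ℝ (fun x : E => M * ‖x‖ ^ q) x :=
    (contDiff_mul_norm_rpow M hq).differentiable (by simp) x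
  have hη : DifferentiableAt ℝ (cutoff δ : E → ℝ) x :=
    (contDiff_cutoff δ).differentiable (by simp) x
  exact (hG.hasFDerivAt.add (hη.hasFDerivAt.mul (hf.hasFDerivAt.sub hG.hasFDerivAt))).fderiv

/-- The radial derivative is η (∇f, x) + (1 - η)(∇(M|x|^q), x) + (f - M|x|^q)(∇η, x). The first two
terms satisfy the inequality with θ, and the last is a product of nonpositive factors. This is why f
is continued by its own upper bound M|x|^q. -/
theorem mul_truncation_le_fderiv (hδ : 0 < δ) (hM : 0 ≤ M) (hq : 1 < q) {θ : ℝ} (hθq : θ ≤ q)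
    (hfd : ContDiffOn ℝ 1 f (Metric.closedBall 0 δ))
    (hf : ∀ x ∈ Metric.closedBall (0 : E) δ, 0 ≤ f x ∧ f x ≤ M * ‖x‖ ^ q)
    (hfθ : ∀ x, ‖x‖ < δ → θ * f x ≤ fderiv ℝ f x x) (x : E) :
    θ * truncation δ M q f x ≤ fderiv ℝ (truncation δ M q f) x x := by
  have hG : θ * (M * ‖x‖ ^ q) ≤ fderiv ℝ (fun x : E => M * ‖x‖ ^ q) x x := by
    rw [fderiv_mul_norm_rpow_self M hq]
    have : 0 ≤ M * ‖x‖ ^ q := by positivity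
    gcongr
  rcases lt_or_ge ‖x‖ δ with h | h
  · obtain ⟨h1, h2⟩ := hf x (mem_closedBall_zero_iff.2 h.le)
    have hd : DifferentiableAt ℝ f x :=
      (hfd.contDiffAt (closedBall_mem_nhds_of_norm_lt h)).differentiableAt (by simp)
    have h3 := cutoff_nonneg (δ := δ) x
    have h4 := cutoff_le_one (δ := δ) x
    have h5 := fderiv_cutoff_self_nonpos (δ := δ) x
    have h6 := hfθ x h
    rw [fderiv_truncation hq hd, truncation]
    simp only [add_apply, smul_apply, sub_apply, smul_eq_mul]
    have e1 : 0 ≤ (f x - M * ‖x‖ ^ q) * fderiv ℝ (cutoff δ) x x :=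
      mul_nonneg_of_nonpos_of_nonpos (sub_nonpos.2 h2) h5
    have e2 := mul_le_mul_of_nonneg_left h6 h3
    have e3 := mul_le_mul_of_nonneg_left hG (sub_nonneg.2 h4)
    nlinarith
  · rw [truncation_eq_of_le hδ (by linarith),
      (truncation_eventuallyEq_of_lt hδ (by linarith)).fderiv_eq]
    exact hG

end Truncation

/-! ### Carathéodory property of the weight and of the truncation -/

section Caratheodory
variable {N : ℕ} {T : ℝ}

theorem norm_gradient_eq {E : Type*} [NormedAddCommGroup E] [InnerProductSpace ℝ E]
    [CompleteSpace E] (f : E → ℝ) (x : E) : ‖gradient f x‖ = ‖fderiv ℝ f x‖ := by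
  rw [gradient, LinearIsometryEquiv.norm_map]

theorem inner_gradient_eq {E : Type*} [NormedAddCommGroup E] [InnerProductSpace ℝ E]
    [CompleteSpace E] (f : E → ℝ) (x v : E) : inner ℝ (gradient f x) v = fderiv ℝ f x v := by
  rw [gradient, InnerProductSpace.toDual_symm_apply]

theorem exists_fderiv_bound {E : Type*} [NormedAddCommGroup E] [InnerProductSpace ℝ E]
    [FiniteDimensional ℝ E] {f : E → ℝ} (hf : ContDiff ℝ 1 f) (R : ℝ) :
    ∃ C, 0 ≤ C ∧ ∀ x, ‖x‖ ≤ R → |f x| ≤ C ∧ ‖fderiv ℝ f x‖ ≤ C := by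
  obtain ⟨C₁, h1⟩ := (isCompact_closedBall (0 : E) R).exists_bound_of_continuousOn
    hf.continuous.continuousOn
  obtain ⟨C₂, h2⟩ := (isCompact_closedBall (0 : E) R).exists_bound_of_continuousOn
    (hf.continuous_fderiv (by simp)).continuousOn
  refine ⟨max 0 (max C₁ C₂), le_max_left _ _, fun x hx => ⟨?_, ?_⟩⟩
  · exact (h1 x (mem_closedBall_zero_iff.2 hx)).trans ((le_max_left _ _).trans (le_max_right _ _))
  · exact (h2 x (mem_closedBall_zero_iff.2 hx)).trans ((le_max_right _ _).trans (le_max_right _ _))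

theorem isCaratheodory_mul {V : ℝ → ℝ} (hV : ContinuousOn V (Icc 0 T))
    {f : EuclideanSpace ℝ (Fin N) → ℝ} (hf : ContDiff ℝ 1 f) :
    IsCaratheodory (volume.restrict (Icc 0 T)) fun t x => V t * f x where
  aemeasurable x := (hV.aestronglyMeasurable measurableSet_Icc).aemeasurable.mul_const _
  contDiff := Eventually.of_forall fun t => contDiff_const.mul hf
  bound R := by
    obtain ⟨C, hC, hb⟩ := exists_fderiv_bound hf R
    refine ⟨fun t => |V t| * C, (hV.integrableOn_Icc.abs).mul_const C,
      Eventually.of_forall fun t x hx => ⟨?_, ?_⟩⟩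
    · rw [abs_mul]
      exact mul_le_mul_of_nonneg_left (hb x hx).1 (abs_nonneg _)
    · rw [norm_gradient_eq, fderiv_const_mul (hf.differentiable (by simp) x), norm_smul,
        Real.norm_eq_abs]
      exact mul_le_mul_of_nonneg_left (hb x hx).2 (abs_nonneg _)

theorem isCaratheodory_truncation {δ M q : ℝ} (hδ : 0 < δ) (hq : 1 < q)
    {F : ℝ → EuclideanSpace ℝ (Fin N) → ℝ} (hF : HypH0 T δ F) :
    IsCaratheodory (volume.restrict (Icc 0 T)) fun t => truncation δ M q (F t) where
  aemeasurable x := by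
    rcases le_or_gt ‖x‖ δ with h | h
    · have h1 := hF.measurable x (mem_closedBall_zero_iff.2 h)
      exact ((h1.sub_const _).const_mul _).const_add _
    · simp_rw [truncation_eq_of_le hδ (by linarith : 3 * δ / 4 ≤ ‖x‖)]
      exact aemeasurable_const
  contDiff := hF.contDiff.mono fun t ht => contDiff_truncation hδ hq ht
  bound R := by
    obtain ⟨g, h, hgc, hg0, hh, hh0, hb⟩ := hF.growth
    obtain ⟨Cg, hCg⟩ := isCompact_Icc.exists_bound_of_continuousOn
      (hgc.mono (Icc_subset_Ici_self : Icc (0 : ℝ) δ ⊆ Ici 0))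
    obtain ⟨CG, hCG, hbG⟩ := exists_fderiv_bound
      (contDiff_mul_norm_rpow (E := EuclideanSpace ℝ (Fin N)) M hq) (max R δ)
    obtain ⟨Cη, hCη, hbη⟩ := exists_fderiv_bound
      (contDiff_cutoff (E := EuclideanSpace ℝ (Fin N)) δ) δ
    have hCg0 : 0 ≤ Cg := (norm_nonneg _).trans (hCg 0 ⟨le_rfl, hδ.le⟩)
    -- `CG` bounds M|x|^q and its derivative, `Cη` the derivative of the cutoff, and `Cg` the
    -- function g on [0,δ]. The product rule for η (F - M|x|^q) produces the factor 1 + `Cη`.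
    refine ⟨fun t => CG + (Cg * h t + CG) * (1 + Cη),
      (integrable_const _).add (((hh.const_mul Cg).add (integrable_const _)).mul_const _), ?_⟩
    filter_upwards [hb, hF.contDiff, ae_restrict_mem measurableSet_Icc] with t hbt hct ht x hx
    obtain ⟨g1, g2⟩ := hbG x (hx.trans (le_max_left _ _))
    have hht := hh0 t ht
    rcases lt_or_ge ‖x‖ δ with hxδ | hxδ
    · have hd : DifferentiableAt ℝ (F t) x :=
        (hct.contDiffAt (closedBall_mem_nhds_of_norm_lt hxδ)).differentiableAt (by simp)
      obtain ⟨f1, f2⟩ := hbt x (mem_closedBall_zero_iff.2 hxδ.le)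
      have hgx : g ‖x‖ ≤ Cg := (le_abs_self _).trans (hCg ‖x‖ ⟨norm_nonneg _, hxδ.le⟩)
      have hgh : g ‖x‖ * h t ≤ Cg * h t := by gcongr
      -- At interior points of the ball the relative gradient is the ordinary one. Boundary points
      -- play no role because the truncation no longer involves F there.
      have f3 : ‖fderiv ℝ (F t) x‖ ≤ Cg * h t := by
        rw [gradientWithin, LinearIsometryEquiv.norm_map,
          fderivWithin_of_mem_nhds (closedBall_mem_nhds_of_norm_lt hxδ)] at f2
        exact f2.trans hgh
      have f4 : |F t x| ≤ Cg * h t := f1.trans hgh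
      obtain ⟨-, e2⟩ := hbη x hxδ.le
      have e3 := cutoff_nonneg (δ := δ) x
      have e4 := cutoff_le_one (δ := δ) x
      have e5 : |F t x - M * ‖x‖ ^ q| ≤ Cg * h t + CG :=
        (abs_sub _ _).trans (add_le_add f4 g1)
      have e6 : 0 ≤ Cg * h t + CG := by positivity
      constructor
      · rw [truncation]
        refine (abs_add_le _ _).trans (add_le_add g1 ?_)
        rw [abs_mul, abs_of_nonneg e3]
        calc _ ≤ 1 * (Cg * h t + CG) := mul_le_mul e4 e5 (abs_nonneg _) one_pos.le
          _ ≤ _ := by nlinarith [mul_nonneg e6 hCη]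
      · rw [norm_gradient_eq, fderiv_truncation hq hd]
        refine (norm_add_le _ _).trans (add_le_add g2 ((norm_add_le _ _).trans ?_))
        rw [norm_smul, norm_smul, Real.norm_of_nonneg e3, Real.norm_eq_abs, mul_add, mul_one]
        refine add_le_add ?_ (mul_le_mul e5 e2 (norm_nonneg _) e6)
        calc _ ≤ 1 * (Cg * h t + CG) :=
              mul_le_mul e4 ((norm_sub_le _ _).trans (add_le_add f3 g2)) (norm_nonneg _) one_pos.le
          _ = _ := one_mul _
    · have e6 : CG ≤ CG + (Cg * h t + CG) * (1 + Cη) :=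
        le_add_of_nonneg_right (by positivity)
      constructor
      · rw [truncation_eq_of_le hδ (by linarith)]
        exact g1.trans e6
      · rw [norm_gradient_eq, (truncation_eventuallyEq_of_lt hδ (by linarith)).fderiv_eq]
        exact g2.trans e6

end Caratheodory

/-! ### Maximisation of the energy profile, and Wallis integrals -/

section RealAnalysis

/-- The maximum is attained at r₀ with r₀^(q-p) = R/(Mq). After scaling by r₀ the inequality is
Bernoulli's, 1 + (q/p)(z^p - 1) ≤ z^q, so no differentiation is required. -/
theorem rpow_mul_sub_le_max {p q M R r : ℝ} (hp : 0 < p) (hpq : p < q) (hM : 0 < M) (hR : 0 < R)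
    (hr : 0 ≤ r) :
    1 / p * R * r ^ p - M * r ^ q ≤
      (1 / (p * (M * q) ^ (p / (q - p))) - M / (M * q) ^ (q / (q - p))) * R ^ (q / (q - p)) := by
  have hq : 0 < q := hp.trans hpq
  have hqp : 0 < q - p := sub_pos.2 hpq
  set r₀ := (R / (M * q)) ^ (1 / (q - p)) with hr₀
  have hr₀pos : 0 < r₀ := by positivity
  have e1 : r₀ ^ p = R ^ (p / (q - p)) / (M * q) ^ (p / (q - p)) := by
    rw [hr₀, ← Real.rpow_mul (by positivity), Real.div_rpow hR.le (by positivity)]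
    congr 2 <;> ring
  have e2 : r₀ ^ q = R ^ (q / (q - p)) / (M * q) ^ (q / (q - p)) := by
    rw [hr₀, ← Real.rpow_mul (by positivity), Real.div_rpow hR.le (by positivity)]
    congr 2 <;> ring
  have e3 : R * R ^ (p / (q - p)) = R ^ (q / (q - p)) := by
    rw [show q / (q - p) = 1 + p / (q - p) by field_simp; ring, Real.rpow_add hR, Real.rpow_one]
  have e4 : M * q * r₀ ^ q = R * r₀ ^ p := by
    rw [e1, e2, show q / (q - p) = 1 + p / (q - p) by field_simp; ring, Real.rpow_add hR,
      Real.rpow_one, Real.rpow_add (by positivity), Real.rpow_one]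
    field_simp
  have hrhs : (1 / (p * (M * q) ^ (p / (q - p))) - M / (M * q) ^ (q / (q - p))) *
      R ^ (q / (q - p)) = 1 / p * R * r₀ ^ p - M * r₀ ^ q := by
    rw [e1, e2, ← e3]
    field_simp
  rw [hrhs]
  set z := r / r₀ with hz
  have hz0 : 0 ≤ z := by positivity
  have hrz : r = r₀ * z := by rw [hz]; field_simp
  have hber : 1 + q / p * (z ^ p - 1) ≤ z ^ q := by
    have h := one_add_mul_self_le_rpow_one_add (s := z ^ p - 1)
      (by linarith [Real.rpow_nonneg hz0 p]) (p := q / p) (by rw [le_div_iff₀ hp]; linarith)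
    rw [add_sub_cancel, ← Real.rpow_mul hz0, mul_div_cancel₀ _ hp.ne'] at h
    exact h
  rw [hrz, Real.mul_rpow hr₀pos.le hz0, Real.mul_rpow hr₀pos.le hz0]
  have e5 : 1 / p * R * (r₀ ^ p * z ^ p) = q / p * (M * r₀ ^ q) * z ^ p := by
    linear_combination -(1 / p) * z ^ p * e4
  have e6 : 1 / p * R * r₀ ^ p = q / p * (M * r₀ ^ q) := by
    linear_combination -(1 / p) * e4
  rw [e5, e6]
  have e7 : 0 < M * r₀ ^ q := by positivity
  nlinarith [mul_le_mul_of_nonneg_left hber e7.le]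

/-- The substitution r = s (Qλ)^(1/q) removes λ from the subtracted term and leaves the coefficient
R = Y Q^(-p/q) λ^(-(p-1)/q) in front of r^p. Raising R to the power q/(q-p) produces the decay rate
λ^(-(p-1)/(q-p)). -/
theorem energy_profile_le {p q M Y Q lam s : ℝ} (hp : 0 < p) (hpq : p < q) (hM : 0 < M)
    (hY : 0 < Y) (hQ : 0 < Q) (hlam : 0 < lam) (hs : 0 ≤ s) :
    1 / p * (s ^ p * Y) * lam ^ (1 / q) - lam * (M * (s ^ q * Q)) ≤
      (1 / (p * (M * q) ^ (p / (q - p))) - M / (M * q) ^ (q / (q - p))) *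
        (Y / Q ^ (p / q)) ^ (q / (q - p)) * lam ^ (-((p - 1) / (q - p))) := by
  have hq : 0 < q := hp.trans hpq
  have hqp : 0 < q - p := sub_pos.2 hpq
  have h := rpow_mul_sub_le_max hp hpq hM (R := Y / Q ^ (p / q) * lam ^ (-((p - 1) / q)))
    (by positivity) (r := s * (Q * lam) ^ (1 / q)) (by positivity)
  have e1 : (s * (Q * lam) ^ (1 / q)) ^ q = s ^ q * (Q * lam) := by
    rw [Real.mul_rpow hs (by positivity), ← Real.rpow_mul (by positivity),
      one_div_mul_cancel hq.ne', Real.rpow_one]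
  have e2 : (s * (Q * lam) ^ (1 / q)) ^ p = s ^ p * (Q ^ (p / q) * lam ^ (p / q)) := by
    rw [Real.mul_rpow hs (by positivity), ← Real.rpow_mul (by positivity),
      Real.mul_rpow hQ.le hlam.le]
    congr 3 <;> ring
  have e3 : lam ^ (-((p - 1) / q)) * lam ^ (p / q) = lam ^ (1 / q) := by
    rw [← Real.rpow_add hlam]; congr 1; ring
  have e4 : (Y / Q ^ (p / q) * lam ^ (-((p - 1) / q))) ^ (q / (q - p)) =
      (Y / Q ^ (p / q)) ^ (q / (q - p)) * lam ^ (-((p - 1) / (q - p))) := by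
    rw [Real.mul_rpow (by positivity) (by positivity), ← Real.rpow_mul hlam.le]
    congr 2; field_simp
  rw [e1, e2, e4] at h
  have e5 : 1 / p * (Y / Q ^ (p / q) * lam ^ (-((p - 1) / q))) *
      (s ^ p * (Q ^ (p / q) * lam ^ (p / q))) = 1 / p * (s ^ p * Y) * lam ^ (1 / q) := by
    rw [← e3]; field_simp
  rw [e5] at h
  calc _ = 1 / p * (s ^ p * Y) * lam ^ (1 / q) - M * (s ^ q * (Q * lam)) := by ring
    _ ≤ _ := h
    _ = _ := by ring

theorem integral_sin_pow_zero_pi (n : ℕ) : ∫ x in (0 : ℝ)..Real.pi, Real.sin x ^ n =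
    (if Odd n then 2 else Real.pi) *
      ((Nat.doubleFactorial (n - 1) : ℝ) / (Nat.doubleFactorial n : ℝ)) := by
  induction n using Nat.strong_induction_on with
  | _ n ih =>
    match n with
    | 0 => simp
    | 1 => simp; norm_num
    | m + 2 =>
      rw [integral_sin_pow, ih m (by omega)]
      have hodd : Odd (m + 2) ↔ Odd m := by
        simp [Nat.odd_add]
      have h2 : ((m + 2).doubleFactorial : ℝ) = (m + 2) * (m.doubleFactorial : ℝ) := by
        rw [Nat.doubleFactorial_add_two]; push_cast; ring
      have h1 : ((m + 1).doubleFactorial : ℝ) = (m + 1) * ((m - 1).doubleFactorial : ℝ) := by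
        -- For m = 0 truncated subtraction gives (0 - 1)‼ = 0‼ = 1, which is the value the formula
        -- needs.
        rcases m with _ | m
        · simp
        · rw [Nat.doubleFactorial_add_two, Nat.add_sub_cancel]; push_cast; ring
      have hpos : (0 : ℝ) < (m.doubleFactorial : ℝ) := by
        exact_mod_cast Nat.doubleFactorial_pos m
      rw [show m + 2 - 1 = m + 1 by omega, h1, h2]
      simp only [hodd, Real.sin_zero, Real.sin_pi]
      field_simp
      simp

end RealAnalysis

/-! ### The sine test function and the constants D and G -/

section Sine
variable {N : ℕ} {T α : ℝ}

/-- The test function `(T/π) sin(π t/T)` in the first coordinate direction. -/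
noncomputable def sineTest (hN : 0 < N) (T t : ℝ) : EuclideanSpace ℝ (Fin N) :=
  (T / Real.pi * Real.sin (Real.pi / T * t)) • EuclideanSpace.single ⟨0, hN⟩ 1

theorem isTestFunction_sineTest (hN : 0 < N) (hT : 0 < T) : IsTestFunction T (sineTest hN T) := by
  refine ⟨?_, ?_, ?_⟩
  · unfold sineTest
    have : ContDiff ℝ (⊤ : ℕ∞) fun t : ℝ => T / Real.pi * Real.sin (Real.pi / T * t) :=
      contDiff_const.mul (Real.contDiff_sin.comp (contDiff_const.mul contDiff_id))
    exact (this.smul contDiff_const).contDiffOn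
  · simp [sineTest]
  · simp [sineTest, hT.ne']

/-- The normalisation T/π makes the derivative cos(π t/T), so the bound on D^α of this function
carries no extra constant. -/
theorem norm_derivWithin_sineTest_le (hN : 0 < N) (hT : 0 < T) {t : ℝ} (ht : t ∈ Icc 0 T) :
    ‖derivWithin (sineTest hN T) (Icc 0 T) t‖ ≤ 1 := by
  have h1 : HasDerivAt (fun t : ℝ => T / Real.pi * Real.sin (Real.pi / T * t))
      (Real.cos (Real.pi / T * t)) t := by
    have h2 : HasDerivAt (fun t : ℝ => Real.pi / T * t) (Real.pi / T) t := by
      simpa using (hasDerivAt_id t).const_mul (Real.pi / T)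
    have h3 := h2.sin.const_mul (T / Real.pi)
    refine h3.congr_deriv ?_
    have := Real.pi_pos.ne'
    field_simp
  have h2 := (h1.smul_const (EuclideanSpace.single (⟨0, hN⟩ : Fin N) (1 : ℝ))).hasDerivWithinAt
    (s := Icc 0 T)
  have h3 : derivWithin (sineTest hN T) (Icc 0 T) t = _ :=
    h2.derivWithin (uniqueDiffOn_Icc hT t ht)
  rw [h3, norm_smul]
  simpa using Real.abs_cos_le_one _

theorem integral_sineTest_pow (hN : 0 < N) (hT : 0 < T) (n : ℕ) :
    ∫ t in Icc 0 T, ‖sineTest hN T t‖ ^ n =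
      (T / Real.pi) ^ (n + 1) * ∫ x in (0 : ℝ)..Real.pi, Real.sin x ^ n := by
  have hπ := Real.pi_pos
  have h1 : ∫ t in Icc 0 T, ‖sineTest hN T t‖ ^ n =
      ∫ t in (0 : ℝ)..T, (T / Real.pi) ^ n * Real.sin (Real.pi / T * t) ^ n := by
    rw [intervalIntegral.integral_of_le hT.le, ← integral_Icc_eq_integral_Ioc]
    refine setIntegral_congr_fun measurableSet_Icc fun t ht => ?_
    have h2 : 0 ≤ Real.sin (Real.pi / T * t) := by
      refine Real.sin_nonneg_of_nonneg_of_le_pi (mul_nonneg (by positivity) ht.1) ?_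
      rw [div_mul_eq_mul_div, div_le_iff₀ hT]
      exact mul_le_mul_of_nonneg_left ht.2 hπ.le
    simp only [sineTest]
    rw [norm_smul, Real.norm_of_nonneg (by positivity), PiLp.norm_single, norm_one,
      mul_one, mul_pow]
  rw [h1, intervalIntegral.integral_const_mul,
    intervalIntegral.integral_comp_mul_left (fun x => Real.sin x ^ n) (by positivity), mul_zero,
    div_mul_cancel₀ _ hT.ne', smul_eq_mul, pow_succ]
  field_simp

/-- Both parity branches in the definition of D are the Wallis formula for this integral: D is the
L^p norm of the sine test function. -/
theorem constD_pow (hT : 0 < T) (p : ℕ) (hp : p ≠ 0) : constD T p ^ p =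
    (T / Real.pi) ^ (p + 1) * ∫ x in (0 : ℝ)..Real.pi, Real.sin x ^ p := by
  have hπ := Real.pi_pos
  rw [integral_sin_pow_zero_pi]
  unfold constD
  split_ifs with h
  · rw [one_div, Real.rpow_inv_natCast_pow (by positivity) hp, div_pow]
    ring
  · rw [one_div, Real.rpow_inv_natCast_pow (by positivity) hp, div_pow, pow_succ Real.pi]
    field_simp

theorem constD_pos (hT : 0 < T) (p : ℕ) : 0 < constD T p := by
  have hπ := Real.pi_pos
  have h1 : (0 : ℝ) < (p.doubleFactorial : ℝ) := by exact_mod_cast Nat.doubleFactorial_pos p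
  have h2 : (0 : ℝ) < ((p - 1).doubleFactorial : ℝ) := by
    exact_mod_cast Nat.doubleFactorial_pos _
  unfold constD
  split_ifs <;> positivity

theorem constG_pos {p : ℝ} (hT : 0 < T) (hp : 0 < p) (hα1 : α ≤ 1) : 0 < constG T α p := by
  have hΓ : 0 < Real.Gamma (2 - α) := Real.Gamma_pos_of_pos (by linarith)
  have h : 0 < p + 1 - p * α := by nlinarith
  unfold constG
  positivity

theorem constG_rpow {p : ℝ} (hT : 0 < T) (hp : 0 < p) (hα1 : α ≤ 1) : constG T α p ^ p =
    T ^ (p + 1 - p * α) / (Real.Gamma (2 - α) ^ p * (p + 1 - p * α)) := by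
  have hΓ : 0 < Real.Gamma (2 - α) := Real.Gamma_pos_of_pos (by linarith)
  have h : 0 < p + 1 - p * α := by nlinarith
  unfold constG
  rw [← Real.rpow_mul (by positivity), one_div_mul_cancel hp.ne', Real.rpow_one]

/-- The function of the mountain pass geometry and the constants `D` and `G`. -/
theorem exists_sine_mem_derivSpace {k : ℕ} (hN : 0 < N) (hT : 0 < T) (hα : 1 / expo k < α)
    (hα1 : α ≤ 1) :
    ∃ w ∈ derivSpace N hT (one_lt_expo k) hα, ‖w‖ ≤ constG T α (expo k) ∧
      ∫ t in Icc 0 T, ‖rlIntegral α w t‖ ^ (k + 2) = constD T (k + 2) ^ (k + 2) := by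
  have hp := one_lt_expo k
  have hp0 := expo_pos k
  have hα0 : 0 < α := lt_trans (by positivity) hα
  have hφ := isTestFunction_sineTest hN hT
  obtain ⟨g, hgm, hgb, hg⟩ := hφ.exists_eq_rlIntegral hT hα0 hα1
    fun t ht => norm_derivWithin_sineTest_le hN hT ht
  simp only [one_mul] at hgb
  have hΓ : 0 < Real.Gamma (2 - α) := Real.Gamma_pos_of_pos (by linarith)
  have hgLp : MemLp g (ENNReal.ofReal (expo k)) (volume.restrict (Icc 0 T)) := by
    refine memLp_of_bounded (C := T ^ (1 - α) / Real.Gamma (2 - α)) hgm fun t ht =>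
      (hgb t ht).trans ?_
    have := Real.rpow_le_rpow ht.1 ht.2 (sub_nonneg.2 hα1)
    gcongr
  let w : LpI N T (expo k) := hgLp.toLp g
  have hw : w =ᵐ[volume.restrict (Icc 0 T)] g := hgLp.coeFn_toLp
  have hwφ : ∀ t ∈ Icc 0 T, rlIntegral α w t = sineTest hN T t := fun t ht => by
    rw [hg t ht, rlIntegral_congr hw ht]
  refine ⟨w, Submodule.le_topologicalClosure _ (hφ.congr hT.le hwφ), ?_, ?_⟩
  · have h1 : 0 < expo k * (1 - α) + 1 := by nlinarith [mul_nonneg hp0.le (sub_nonneg.2 hα1)]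
    have hint : IntegrableOn (fun t : ℝ => t ^ (expo k * (1 - α))) (Icc 0 T) :=
      (intervalIntegrable_iff_integrableOn_Icc_of_le hT.le (by simp)).1
        (intervalIntegral.intervalIntegrable_rpow' (by linarith))
    rw [← Real.rpow_le_rpow_iff (norm_nonneg _) (constG_pos hT hp0 hα1).le hp0,
      constG_rpow hT hp0 hα1, norm_lpI_rpow hp]
    -- Integrating the p-th power of the pointwise bound t^(1-α)/Γ(2-α) gives exactly G^p.
    calc ∫ s in Icc 0 T, ‖w s‖ ^ expo k
        ≤ ∫ t in Icc 0 T, t ^ (expo k * (1 - α)) / Real.Gamma (2 - α) ^ expo k := by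
          refine integral_mono_of_nonneg (Eventually.of_forall fun s => by positivity)
            (hint.div_const _) ?_
          filter_upwards [hw, ae_restrict_mem measurableSet_Icc] with t h2 ht
          rw [h2, mul_comm (expo k), Real.rpow_mul ht.1, ← Real.div_rpow
            (Real.rpow_nonneg ht.1 _) hΓ.le]
          exact Real.rpow_le_rpow (norm_nonneg _) (hgb t ht) hp0.le
      _ = _ := by
          rw [integral_div, integral_Icc_eq_integral_Ioc, ← intervalIntegral.integral_of_le hT.le,
            integral_rpow (Or.inl (by linarith)), Real.zero_rpow h1.ne', sub_zero, div_div,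
            mul_comm (Real.Gamma (2 - α) ^ expo k)]
          congr 2 <;> ring
  · rw [constD_pow hT _ (by omega), ← integral_sineTest_pow hN hT]
    exact setIntegral_congr_fun measurableSet_Icc fun t ht => by simp only [hwφ t ht]

end Sine

/-! ### The weighted term V|x|^p and a reverse Hölder inequality -/

section Weight
variable {N k : ℕ} {T α : ℝ} {V : ℝ → ℝ}

/-- The integrand `V(t)|x|^p`. -/
noncomputable def weight (k : ℕ) (V : ℝ → ℝ) (t : ℝ) (x : EuclideanSpace ℝ (Fin N)) : ℝ :=
  V t * ‖x‖ ^ (k + 2)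

theorem contDiff_norm_pow (k : ℕ) :
    ContDiff ℝ 1 fun x : EuclideanSpace ℝ (Fin N) => ‖x‖ ^ (k + 2) := by
  have := contDiff_norm_rpow (E := EuclideanSpace ℝ (Fin N)) (one_lt_expo k)
  simpa only [Real.rpow_natCast] using this

theorem isCaratheodory_weight (hV : ContinuousOn V (Icc 0 T)) :
    IsCaratheodory (volume.restrict (Icc 0 T)) (weight (N := N) k V) :=
  isCaratheodory_mul hV (contDiff_norm_pow k)

theorem inner_gradient_weight (t : ℝ) (x v : EuclideanSpace ℝ (Fin N)) :
    inner ℝ (gradient (weight k V t) x) v = (k + 2) * (V t * inner ℝ (‖x‖ ^ k • x) v) := by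
  rw [inner_gradient_eq]
  refine fderiv_apply_eq_of_hasDerivAt
    ((contDiff_const.mul (contDiff_norm_pow k)).differentiable (n := 1) (by simp) x) ?_
  have h := (hasDerivAt_norm_pow k x v 0).const_mul (V t)
  refine h.congr_deriv ?_
  rw [zero_smul, add_zero]; ring

theorem integralFunctional_weight_nonneg (hV : ∀ t ∈ Icc 0 T, 0 < V t) (w : LpI N T (expo k)) :
    0 ≤ integralFunctional α (weight k V) w :=
  setIntegral_nonneg measurableSet_Icc fun t ht => mul_nonneg (hV t ht).le (by positivity)

theorem integralFunctional_weight_smul (c : ℝ) (w : LpI N T (expo k)) :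
    integralFunctional α (weight k V) (c • w) =
      |c| ^ (k + 2) * integralFunctional α (weight k V) w := by
  unfold integralFunctional
  rw [← integral_const_mul]
  refine setIntegral_congr_fun measurableSet_Icc fun t ht => ?_
  simp only [weight]
  rw [rlIntegral_lpI_smul ht, norm_smul, mul_pow, Real.norm_eq_abs]; ring

theorem integralFunctionalDeriv_weight (w v : LpI N T (expo k)) :
    integralFunctionalDeriv α (weight k V) w v = (k + 2) * ∫ t in Icc 0 T,
      V t * inner ℝ (‖rlIntegral α w t‖ ^ k • rlIntegral α w t) (rlIntegral α v t) := by
  unfold integralFunctionalDeriv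
  rw [← integral_const_mul]
  simp_rw [inner_gradient_weight]

theorem integralFunctionalDeriv_weight_self (w : LpI N T (expo k)) :
    integralFunctionalDeriv α (weight k V) w w =
      (k + 2) * integralFunctional α (weight k V) w := by
  rw [integralFunctionalDeriv_weight, integralFunctional]
  congr 1
  refine setIntegral_congr_fun measurableSet_Icc fun t _ => ?_
  simp only [weight]
  rw [real_inner_smul_left, real_inner_self_eq_norm_sq, ← pow_add]

theorem potential_weight_smul (c : ℝ) (w : LpI N T (expo k)) :
    potential α (weight k V) (c • w) = |c| ^ (k + 2) * potential α (weight k V) w := by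
  rw [potential, potential, integralFunctional_weight_smul, norm_smul, mul_pow, Real.norm_eq_abs]
  ring

theorem le_Vmax (hV : ContinuousOn V (Icc 0 T)) {t : ℝ} (ht : t ∈ Icc 0 T) : V t ≤ Vmax T V :=
  le_csSup (isCompact_Icc.image_of_continuousOn hV).bddAbove ⟨t, ht, rfl⟩

theorem potential_weight_le (hT : 0 < T) (hα : 1 / expo k < α) (hV : ContinuousOn V (Icc 0 T))
    {w : LpI N T (expo k)} {D G : ℝ} (hG : ‖w‖ ≤ G)
    (hD : ∫ t in Icc 0 T, ‖rlIntegral α w t‖ ^ (k + 2) = D ^ (k + 2)) :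
    potential α (weight k V) w ≤ max 1 (Vmax T V) * (D ^ (k + 2) + G ^ (k + 2)) := by
  have h1 : integralFunctional α (weight k V) w ≤
      ∫ t in Icc 0 T, max 1 (Vmax T V) * ‖rlIntegral α w t‖ ^ (k + 2) := by
    have hi := integrable_integralFunctional (isCaratheodory_weight (N := N) (k := k) hV) hT
      (one_lt_expo k) hα w
    have hone := integrable_integralFunctional (isCaratheodory_weight (N := N) (k := k)
      (V := fun _ => 1) (T := T) continuousOn_const) hT (one_lt_expo k) hα w
    simp only [weight, one_mul] at hone
    refine setIntegral_mono_on hi (hone.const_mul _) measurableSet_Icc fun t ht => ?_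
    exact mul_le_mul_of_nonneg_right ((le_Vmax hV ht).trans (le_max_right _ _)) (by positivity)
  rw [integral_const_mul, hD] at h1
  have h2 : ‖w‖ ^ (k + 2) ≤ G ^ (k + 2) := by gcongr
  have h3 : (1 : ℝ) ≤ max 1 (Vmax T V) := le_max_left _ _
  have h4 : 0 ≤ ‖w‖ ^ (k + 2) := by positivity
  rw [potential]
  nlinarith

/-- Reverse Hölder inequality on `[0,T]`. -/
theorem rpow_mul_le_integral_rpow {f : ℝ → ℝ} (hT : 0 < T) {C q D : ℝ} {n : ℕ}
    (hnq : (n : ℝ) < q) (hn : 0 < n)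
    (hf : AEStronglyMeasurable f (volume.restrict (Icc 0 T))) (hf0 : ∀ t, 0 ≤ f t)
    (hC : ∀ t ∈ Icc 0 T, f t ≤ C) (hD0 : 0 < D) (hD : ∫ t in Icc 0 T, f t ^ n = D ^ n) :
    T ^ (1 - q / n) * D ^ q ≤ ∫ t in Icc 0 T, f t ^ q := by
  have hn' : (0 : ℝ) < n := by exact_mod_cast hn
  have hq : 0 < q := hn'.trans hnq
  have hm : 1 < q / n := (one_lt_div hn').2 hnq
  have hpq := conjExp_holderConjugate hm
  have hbd : ∀ᵐ t ∂(volume.restrict (Icc 0 T)), ‖f t ^ n‖ ≤ C ^ n := by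
    filter_upwards [ae_restrict_mem measurableSet_Icc] with t ht
    rw [Real.norm_of_nonneg (pow_nonneg (hf0 t) n)]
    exact pow_le_pow_left₀ (hf0 t) (hC t ht) n
  -- Hölder's inequality for f^n against the constant 1 with exponent q/n. Raising it to the power
  -- q/n isolates ∫ f^q.
  have h := integral_mul_le_Lp_mul_Lq_of_nonneg (μ := volume.restrict (Icc 0 T)) hpq
    (f := fun t => f t ^ n) (g := fun _ => 1)
    (Eventually.of_forall fun t => pow_nonneg (hf0 t) n)
    (Eventually.of_forall fun _ => zero_le_one) (MemLp.of_bound (hf.pow n) _ hbd)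
    (memLp_const _)
  have h1 : ∀ t, (f t ^ n) ^ (q / n) = f t ^ q := fun t => by
    rw [← Real.rpow_natCast, ← Real.rpow_mul (hf0 t), mul_div_cancel₀ _ hn'.ne']
  simp only [mul_one, h1, Real.one_rpow] at h
  rw [hD] at h
  have h2 : ∫ _ in Icc 0 T, (1 : ℝ) = T := by simp [hT.le]
  rw [h2] at h
  have hI : 0 ≤ ∫ t in Icc 0 T, f t ^ q := integral_nonneg fun t => Real.rpow_nonneg (hf0 t) _
  have h3 := Real.rpow_le_rpow (by positivity) h (by positivity : 0 ≤ q / n)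
  rw [Real.mul_rpow (by positivity) (by positivity), ← Real.rpow_mul hI,
    ← Real.rpow_mul hT.le, one_div_mul_cancel (by positivity), Real.rpow_one,
    ← Real.rpow_natCast, ← Real.rpow_mul hD0.le, mul_div_cancel₀ _ hn'.ne'] at h3
  have h4 : 1 / conjExp (q / n) * (q / n) = q / n - 1 := by
    rw [conjExp]
    have : q / n - 1 ≠ 0 := by linarith
    field_simp
  rw [h4] at h3
  have h5 : T ^ (1 - q / n) * T ^ (q / n - 1) = 1 := by
    rw [← Real.rpow_add hT]; simp
  calc T ^ (1 - q / n) * D ^ q ≤ T ^ (1 - q / n) *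
        ((∫ t in Icc 0 T, f t ^ q) * T ^ (q / n - 1)) := by gcongr
    _ = (T ^ (1 - q / n) * T ^ (q / n - 1)) * ∫ t in Icc 0 T, f t ^ q := by ring
    _ = _ := by rw [h5, one_mul]

end Weight

/-! ### Estimates for the truncated nonlinear term -/

section Nonlinearity
variable {N k : ℕ} {T α δ β q₁ q₂ M₁ M₂ : ℝ} {F : ℝ → EuclideanSpace ℝ (Fin N) → ℝ}

theorem integralFunctional_truncation_le (hT : 0 < T) (hα : 1 / expo k < α) (hδ : 0 < δ)
    (hq : 1 < q₂) (hM₂ : 0 ≤ M₂) (h0 : HypH0 T δ F)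
    (hF : ∀ᵐ t ∂(volume.restrict (Icc 0 T)), ∀ x ∈ Metric.closedBall 0 δ,
      0 ≤ F t x ∧ F t x ≤ M₂ * ‖x‖ ^ q₂) (w : LpI N T (expo k)) :
    integralFunctional α (fun t => truncation δ M₂ q₂ (F t)) w ≤
      T * M₂ * embConst T α (expo k) ^ q₂ * ‖w‖ ^ q₂ := by
  have hK := embConst_pos hT (one_lt_expo k) hα
  have hi := integrable_integralFunctional
    (isCaratheodory_truncation (M := M₂) hδ hq h0) hT (one_lt_expo k) hα w
  have h1 : integralFunctional α (fun t => truncation δ M₂ q₂ (F t)) w ≤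
      ∫ _ in Icc 0 T, M₂ * (embConst T α (expo k) * ‖w‖) ^ q₂ := by
    refine integral_mono_ae hi (integrable_const _) ?_
    filter_upwards [hF, ae_restrict_mem measurableSet_Icc] with t ht htI
    refine (truncation_bounds hδ hM₂ ht _).2.trans ?_
    have := norm_rlIntegral_lpI_le (one_lt_expo k) hα htI w
    gcongr
  refine h1.trans_eq ?_
  rw [setIntegral_const, Real.mul_rpow hK.le (norm_nonneg _)]
  simp [hT.le]
  ring

theorem mul_integralFunctional_truncation_le (hT : 0 < T) (hα : 1 / expo k < α) (hδ : 0 < δ)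
    (hq : 1 < q₂) (hM₂ : 0 ≤ M₂) (h0 : HypH0 T δ F) {θ : ℝ} (hθq : θ ≤ q₂) (hθβ : θ ≤ β)
    (hF : ∀ᵐ t ∂(volume.restrict (Icc 0 T)), ∀ x ∈ Metric.closedBall 0 δ,
      0 ≤ F t x ∧ F t x ≤ M₂ * ‖x‖ ^ q₂) (h2 : HypH2 T δ β F) (w : LpI N T (expo k)) :
    θ * integralFunctional α (fun t => truncation δ M₂ q₂ (F t)) w ≤
      integralFunctionalDeriv α (fun t => truncation δ M₂ q₂ (F t)) w w := by
  have hC := isCaratheodory_truncation (M := M₂) hδ hq h0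
  unfold integralFunctional integralFunctionalDeriv
  rw [← integral_const_mul]
  refine integral_mono_ae
    ((integrable_integralFunctional hC hT (one_lt_expo k) hα w).const_mul θ)
    (integrable_integralFunctionalDeriv hC hT (one_lt_expo k) hα w w) ?_
  filter_upwards [hF, h2, h0.contDiff] with t h3 h4 h5
  rw [inner_gradient_eq]
  refine mul_truncation_le_fderiv hδ hM₂ hq hθq h5 h3 (fun x hx => ?_) _
  have h6 := (h4 x (mem_closedBall_zero_iff.2 hx.le)).2
  rw [gradientWithin, fderivWithin_of_mem_nhds (closedBall_mem_nhds_of_norm_lt hx),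
    InnerProductSpace.toDual_symm_apply] at h6
  -- Passing from β to the smaller θ uses F ≥ 0.
  exact (mul_le_mul_of_nonneg_right hθβ (h3 x (mem_closedBall_zero_iff.2 hx.le)).1).trans h6

theorem integralFunctional_truncation_zero (hT : 0 < T) (hα : 1 / expo k < α) (hδ : 0 < δ)
    (hq : 1 < q₂) (hM₂ : 0 ≤ M₂) (h0 : HypH0 T δ F)
    (hF : ∀ᵐ t ∂(volume.restrict (Icc 0 T)), ∀ x ∈ Metric.closedBall 0 δ,
      0 ≤ F t x ∧ F t x ≤ M₂ * ‖x‖ ^ q₂) :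
    integralFunctional α (fun t => truncation δ M₂ q₂ (F t)) (0 : LpI N T (expo k)) = 0 := by
  refine le_antisymm ?_ ?_
  · have := integralFunctional_truncation_le hT hα hδ hq hM₂ h0 hF (0 : LpI N T (expo k))
    rwa [norm_zero, Real.zero_rpow (by linarith), mul_zero] at this
  · refine integral_nonneg_of_ae ?_
    filter_upwards [hF] with t ht
    exact (truncation_bounds hδ hM₂ ht _).1

/-- Mixing f with the larger function M₂|x|^q₂ can only increase it, so the lower bound is inherited
from f. -/
theorem le_truncation {f : EuclideanSpace ℝ (Fin N) → ℝ} {x : EuclideanSpace ℝ (Fin N)}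
    (hf : M₁ * ‖x‖ ^ q₁ ≤ f x ∧ f x ≤ M₂ * ‖x‖ ^ q₂) :
    M₁ * ‖x‖ ^ q₁ ≤ truncation δ M₂ q₂ f x := by
  have h3 := cutoff_nonneg (δ := δ) x
  have h4 := cutoff_le_one (δ := δ) x
  rw [truncation]
  nlinarith [mul_nonneg (sub_nonneg.2 h4) (sub_nonneg.2 hf.2)]

/-- Lower bound of the nonlinear term along a ray. -/
theorem le_integralFunctional_truncation (hT : 0 < T) (hα : 1 / expo k < α) (hα1 : α ≤ 1)
    (hδ : 0 < δ) (hq : 1 < q₂) (hM₁ : 0 ≤ M₁) (hq₁ : expo k < q₁) (h0 : HypH0 T δ F)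
    (h1 : HypH1 T δ q₁ q₂ M₁ M₂ F) {w : LpI N T (expo k)} {D c : ℝ} (hD0 : 0 < D)
    (hD : ∫ t in Icc 0 T, ‖rlIntegral α w t‖ ^ (k + 2) = D ^ (k + 2)) (hc : 0 ≤ c)
    (hcw : c * (embConst T α (expo k) * ‖w‖) ≤ δ) :
    M₁ * (c ^ q₁ * (T ^ (1 - q₁ / expo k) * D ^ q₁)) ≤
      integralFunctional α (fun t => truncation δ M₂ q₂ (F t)) (c • w) := by
  have hp := one_lt_expo k
  have hi := integrable_integralFunctional
    (isCaratheodory_truncation (M := M₂) hδ hq h0) hT hp hα (c • w)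
  have hm := aestronglyMeasurable_rlIntegral_lpI (α := α) hp w
  have hR := rpow_mul_le_integral_rpow (n := k + 2) hT hq₁ (by omega) hm.norm
    (fun t => norm_nonneg _) (fun t ht => norm_rlIntegral_lpI_le hp hα ht w) hD0 hD
  have hq0 : 0 < q₁ := (expo_pos k).trans hq₁
  have hcont : ContinuousOn (fun t => ‖rlIntegral α w t‖ ^ q₁) (Icc 0 T) :=
    (continuousOn_rlIntegral hp hα hα1 (Lp.memLp w)).norm.rpow_const fun _ _ => Or.inr hq0.le
  calc _ ≤ M₁ * (c ^ q₁ * ∫ t in Icc 0 T, ‖rlIntegral α w t‖ ^ q₁) := by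
        have := Real.rpow_nonneg hc q₁
        gcongr
    _ = ∫ t in Icc 0 T, M₁ * (c ^ q₁ * ‖rlIntegral α w t‖ ^ q₁) := by
        rw [integral_const_mul, integral_const_mul]
    _ ≤ _ := by
        refine integral_mono_ae ((hcont.integrableOn_Icc.const_mul _).const_mul _) hi ?_
        filter_upwards [h1, ae_restrict_mem measurableSet_Icc] with t ht htI
        have e1 : rlIntegral α (c • w : LpI N T (expo k)) t = c • rlIntegral α w t :=
          rlIntegral_lpI_smul htI c w
        have e2 : ‖c • rlIntegral α w t‖ = c * ‖rlIntegral α w t‖ := by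
          rw [norm_smul, Real.norm_of_nonneg hc]
        -- The polynomial lower bound is available only for |x| ≤ δ. The hypothesis on c keeps the
        -- whole function in that ball.
        have e3 : ‖c • rlIntegral α w t‖ ≤ δ := by
          rw [e2]
          exact (mul_le_mul_of_nonneg_left (norm_rlIntegral_lpI_le hp hα htI w) hc).trans hcw
        have e4 := le_truncation (δ := δ) (ht _ (mem_closedBall_zero_iff.2 e3))
        rw [e1, ← Real.mul_rpow hc (norm_nonneg _), ← e2]
        exact e4

end Nonlinearity

/-! ### The thresholds Λ₁, Λ₂ and the constant C_* as scalar inequalities -/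

section Scalars
variable {k : ℕ} {a b M q lam Y Q X I s : ℝ}

theorem expo_sub_one (k : ℕ) : expo k - 1 = ((k + 1 : ℕ) : ℝ) := by
  simp only [expo]; push_cast; ring

/-- Here X is the potential and I the nonlinear integral at the far endpoint. The condition on λ is
the one encoded in the second entry of Λ₁, and it makes the nonlinear term win. -/
theorem kirchhoff_profile_neg (ha : 0 < a) (hb : 0 < b) (hMQ : 0 < M * Q) (hX0 : 0 ≤ X)
    (hX : X ≤ Y) (hI : M * Q ≤ I) (hlam0 : 0 < lam)
    (hlam : 1 / (b * ((k : ℝ) + 2) ^ 2) * (a + b * Y) ^ (k + 2) / (M * Q) < lam) :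
    ((a + b * X) ^ (k + 2) - a ^ (k + 2)) / (b * ((k : ℝ) + 2) ^ 2) - lam * I < 0 := by
  rw [div_lt_iff₀ hMQ] at hlam
  have h1 : (a + b * X) ^ (k + 2) ≤ (a + b * Y) ^ (k + 2) := by gcongr
  have h2 : ((a + b * X) ^ (k + 2) - a ^ (k + 2)) / (b * ((k : ℝ) + 2) ^ 2) ≤
      1 / (b * ((k : ℝ) + 2) ^ 2) * (a + b * Y) ^ (k + 2) := by
    rw [one_div_mul_eq_div]
    have := pow_pos ha (k + 2)
    gcongr
    linarith
  have h3 : lam * (M * Q) ≤ lam * I := by gcongr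
  linarith

/-- The threshold Λ₂ says that (a + bY)^(p-1) ≤ λ^(1/q). The nonlocal coefficient on the ray is thus
replaced by λ^(1/q), and the energy is reduced to a difference of two powers of s. -/
theorem kirchhoff_profile_le (ha : 0 < a) (hb : 0 < b) (hM : 0 < M) (hY : 0 < Y) (hQ : 0 < Q)
    (hq : expo k < q) (hX0 : 0 ≤ X) (hX : X ≤ s ^ (k + 2) * Y) (hI : M * (s ^ q * Q) ≤ I)
    (hs : s ∈ Icc (0 : ℝ) 1) (hlam : (a + b * Y) ^ (q * (expo k - 1)) ≤ lam) :
    ((a + b * X) ^ (k + 2) - a ^ (k + 2)) / (b * ((k : ℝ) + 2) ^ 2) - lam * I ≤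
      (1 / (expo k * (M * q) ^ (expo k / (q - expo k))) - M / (M * q) ^ (q / (q - expo k))) *
        (Y / Q ^ (expo k / q)) ^ (q / (q - expo k)) *
          lam ^ (-((expo k - 1) / (q - expo k))) := by
  have hp := expo_pos k
  have hq0 : 0 < q := hp.trans hq
  have hab : 0 < a + b * Y := by positivity
  have hlam0 : 0 < lam := lt_of_lt_of_le (by positivity) hlam
  refine le_trans ?_ (energy_profile_le hp hq hM hY hQ hlam0 hs.1)
  have hXY : X ≤ Y := hX.trans (mul_le_of_le_one_left hY.le (pow_le_one₀ hs.1 hs.2))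
  have h1 : (a + b * Y) ^ (k + 1) ≤ lam ^ (1 / q) := by
    have := Real.rpow_le_rpow (by positivity) hlam (by positivity : 0 ≤ 1 / q)
    rwa [← Real.rpow_mul hab.le, mul_comm q, mul_assoc, mul_one_div_cancel hq0.ne', mul_one,
      expo_sub_one, Real.rpow_natCast] at this
  have h2 := add_pow_sub_le ha.le (mul_nonneg hb.le hX0) (k + 1)
  have h3 : (a + b * X) ^ (k + 1) ≤ lam ^ (1 / q) := le_trans (by gcongr) h1
  have h4 : (a + b * X) ^ (k + 2) - a ^ (k + 2) ≤
      (k + 2) * (b * (s ^ (k + 2) * Y)) * lam ^ (1 / q) := by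
    refine h2.trans ?_
    push_cast
    have : (k : ℝ) + 1 + 1 = k + 2 := by ring
    rw [this]
    have hs0 := hs.1
    gcongr
  have h5 : ((a + b * X) ^ (k + 2) - a ^ (k + 2)) / (b * ((k : ℝ) + 2) ^ 2) ≤
      1 / expo k * (s ^ expo k * Y) * lam ^ (1 / q) := by
    rw [div_le_iff₀ (by positivity), Real.rpow_natCast]
    refine h4.trans_eq ?_
    simp only [expo]; push_cast
    field_simp
  have h6 : lam * (M * (s ^ q * Q)) ≤ lam * I := by gcongr
  linarith

/-- Numerator and denominator both scale like c^p, so the length c of the ray cancels. This is why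
C_* involves neither δ nor G₀. -/
theorem scaled_ratio_rpow {T c m S D p : ℝ} (hT : 0 < T) (hc : 0 < c) (hm : 0 < m) (hS : 0 < S)
    (hD : 0 < D) (hp : 0 < p) (hq : p < q) :
    (c ^ p * m * S / (c ^ q * (T ^ (1 - q / p) * D ^ q)) ^ (p / q)) ^ (q / (q - p)) =
      (m ^ (1 / p) * S ^ (1 / p) / (T ^ (1 / q - 1 / p) * D)) ^ (p * q / (q - p)) := by
  have hq0 : 0 < q := hp.trans hq
  have e : ∀ {x : ℝ}, 0 < x → (x ^ q) ^ (p / q) = x ^ p := fun hx => by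
    rw [← Real.rpow_mul hx.le, mul_div_cancel₀ _ hq0.ne']
  have e' : ∀ {x : ℝ}, 0 < x → (x ^ (1 / p)) ^ p = x := fun hx => by
    rw [← Real.rpow_mul hx.le, one_div_mul_cancel hp.ne', Real.rpow_one]
  rw [mul_div_assoc p, Real.rpow_mul (by positivity)]
  congr 1
  rw [Real.div_rpow (by positivity) (by positivity),
    Real.mul_rpow (by positivity) (by positivity), Real.mul_rpow (by positivity) (by positivity),
    Real.mul_rpow (by positivity) (by positivity), Real.mul_rpow (by positivity) (by positivity),
    e' hm, e' hS, e hc, e hD, ← Real.rpow_mul hT.le, ← Real.rpow_mul hT.le]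
  have h1 : (1 - q / p) * (p / q) = (1 / q - 1 / p) * p := by field_simp
  have hcp : 0 < c ^ p := by positivity
  rw [h1]
  field_simp

end Scalars

/-! ### Translation between u = I^α w and w -/

section Representation
variable {N k : ℕ} {T α a b : ℝ} {V : ℝ → ℝ}

theorem supNorm_le (hT : 0 < T) {u : ℝ → EuclideanSpace ℝ (Fin N)} {C : ℝ}
    (h : ∀ t ∈ Icc 0 T, ‖u t‖ ≤ C) : supNorm T u ≤ C := by
  refine csSup_le ⟨_, 0, ⟨le_rfl, hT.le⟩, rfl⟩ ?_
  rintro _ ⟨t, ht, rfl⟩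
  exact h t ht

theorem supNorm_nonneg (u : ℝ → EuclideanSpace ℝ (Fin N)) : 0 ≤ supNorm T u := by
  refine Real.sSup_nonneg ?_
  rintro _ ⟨t, ht, rfl⟩
  exact norm_nonneg _

theorem intervalIntegral_eq_setIntegral_Icc {E : Type*} [NormedAddCommGroup E] [NormedSpace ℝ E]
    (hT : 0 < T) (f : ℝ → E) : ∫ t in (0 : ℝ)..T, f t = ∫ t in Icc 0 T, f t := by
  rw [intervalIntegral.integral_of_le hT.le, integral_Icc_eq_integral_Ioc]

theorem integrable_norm_lpI_pow (w : LpI N T (expo k)) :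
    Integrable (fun t => ‖w t‖ ^ (k + 2)) (volume.restrict (Icc 0 T)) := by
  refine (integrable_powPairing w w).congr (Eventually.of_forall fun t => ?_)
  simp only
  rw [real_inner_smul_left, real_inner_self_eq_norm_sq, ← pow_add]

theorem integral_norm_rlDeriv_pow (hT : 0 < T) (hα : 1 / expo k < α) (hα1 : α ≤ 1)
    (w : LpI N T (expo k)) :
    ∫ t in (0 : ℝ)..T, ‖rlDeriv α (rlIntegral α w) t‖ ^ expo k = ‖w‖ ^ (k + 2) := by
  rw [intervalIntegral_eq_setIntegral_Icc hT, norm_lpI_pow]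
  refine integral_congr_ae ?_
  filter_upwards [rlDeriv_rlIntegral_lpI (one_lt_expo k) hα hα1 w] with t ht
  rw [ht, Real.rpow_natCast]

theorem normV_rlIntegral_pow (hT : 0 < T) (hα : 1 / expo k < α) (hα1 : α ≤ 1)
    (hV : ∀ t ∈ Icc 0 T, 0 < V t) (w : LpI N T (expo k)) :
    normV T α (expo k) V (rlIntegral α w) ^ (k + 2) = potential α (weight k V) w := by
  have h1 : ∫ t in (0 : ℝ)..T, V t * ‖rlIntegral α w t‖ ^ expo k =
      integralFunctional α (weight k V) w := by
    rw [intervalIntegral_eq_setIntegral_Icc hT]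
    simp only [Real.rpow_natCast]
    rfl
  have h2 := integralFunctional_weight_nonneg (α := α) hV w
  rw [normV, h1, integral_norm_rlDeriv_pow hT hα hα1, one_div,
    Real.rpow_inv_natCast_pow (by positivity) (by omega), potential]

theorem kirchhoffCoeff_rlIntegral (hT : 0 < T) (hα : 1 / expo k < α) (hα1 : α ≤ 1)
    (hV : ContinuousOn V (Icc 0 T)) (w : LpI N T (expo k)) :
    kirchhoffCoeff T α (expo k) a b V (rlIntegral α w) =
      (a + b * potential α (weight k V) w) ^ (k + 1) := by
  have h1 : ∫ t in (0 : ℝ)..T, (‖rlDeriv α (rlIntegral α w) t‖ ^ expo k +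
      V t * ‖rlIntegral α w t‖ ^ expo k) = potential α (weight k V) w := by
    have hi := integrable_integralFunctional (isCaratheodory_weight (N := N) (k := k) hV) hT
      (one_lt_expo k) hα w
    rw [intervalIntegral_eq_setIntegral_Icc hT, potential, norm_lpI_pow, integralFunctional,
      ← integral_add (integrable_norm_lpI_pow w) hi]
    refine integral_congr_ae ?_
    filter_upwards [rlDeriv_rlIntegral_lpI (one_lt_expo k) hα hα1 w] with t ht
    rw [ht, Real.rpow_natCast, Real.rpow_natCast, weight]
  rw [kirchhoffCoeff, h1, expo_sub_one, Real.rpow_natCast]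

theorem phi_expo (x : EuclideanSpace ℝ (Fin N)) : phi (expo k) x = ‖x‖ ^ k • x := by
  have : expo k - 2 = (k : ℝ) := by simp only [expo]; push_cast; ring
  rw [phi, this, Real.rpow_natCast]

/-- I^α is injective: D^α of the zero function is almost everywhere w, and almost everywhere 0 as
well. -/
theorem eq_zero_of_rlIntegral_eq_zero (hα : 1 / expo k < α) (hα1 : α ≤ 1)
    {w : LpI N T (expo k)} (h : ∀ t ∈ Icc 0 T, rlIntegral α w t = 0) : w = 0 := by
  have hα0 : 0 < α := lt_trans (one_div_pos.2 (expo_pos k)) hα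
  have h1 := rlDeriv_eq_of_eq_rlIntegral hα0 hα1
    (memLp_integrableOn (one_lt_expo k) (Lp.memLp w)) (u := fun _ => 0)
    (fun t ht => (h t ht).symm)
  have h2 := rlDeriv_eq_of_eq_rlIntegral hα0 hα1
    (memLp_integrableOn (one_lt_expo k) (Lp.memLp (0 : LpI N T (expo k)))) (u := fun _ => 0)
    (fun t ht => (rlIntegral_lpI_zero ht).symm)
  refine Lp.ext ?_
  filter_upwards [h1, h2] with t e1 e2
  rw [← e1, e2]

end Representation

/-! ### From critical points to small weak solutions -/

section Solution
variable {N k : ℕ} {T α a b lam δ β q₁ q₂ M₁ M₂ : ℝ} {V : ℝ → ℝ}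
  {F : ℝ → EuclideanSpace ℝ (Fin N) → ℝ}

/-- A small critical point of the truncated energy is a weak solution. -/
theorem isWeakSolution_rlIntegral (hT : 0 < T) (hα : 1 / expo k < α) (hα1 : α ≤ 1)
    (hV : ContinuousOn V (Icc 0 T)) (hδ : 0 < δ) (hq : 1 < q₂) (h0 : HypH0 T δ F)
    {w : LpI N T (expo k)} (hw : w ∈ derivSpace N hT (one_lt_expo k) hα)
    (hsmall : ∀ t ∈ Icc 0 T, ‖rlIntegral α w t‖ < δ / 2)
    (hcrit : ∀ v ∈ derivSpace N hT (one_lt_expo k) hα,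
      energyDeriv α a b lam (weight k V) (fun t => truncation δ M₂ q₂ (F t)) w v = 0) :
    IsWeakSolution T α (expo k) a b lam V F (rlIntegral α w) := by
  have hp := one_lt_expo k
  have hC := isCaratheodory_truncation (M := M₂) hδ hq h0
  -- The strict inequality |u| < δ/2 makes the truncation equal to F in a neighbourhood of u(t), so
  -- the gradients agree as well.
  have hgrad : ∀ {t}, t ∈ Icc 0 T →
      gradient (truncation δ M₂ q₂ (F t)) (rlIntegral α w t) =
        gradient (F t) (rlIntegral α w t) := fun ht =>
    (truncation_eventuallyEq hδ (hsmall _ ht)).gradient_eq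
  have hinner : ∀ (v : ℝ → EuclideanSpace ℝ (Fin N)) (v' : LpI N T (expo k)),
      (∀ t ∈ Icc 0 T, v t = rlIntegral α v' t) → ∀ t ∈ Icc 0 T,
      inner ℝ (gradient (truncation δ M₂ q₂ (F t)) (rlIntegral α w t)) (rlIntegral α v' t) =
        inner ℝ (gradient (F t) (rlIntegral α w t)) (v t) := fun v v' hv t ht => by
    rw [hgrad ht, hv t ht]
  refine ⟨memE0_rlIntegral hα1 hw, (rlIntegral_boundary hw).1, (rlIntegral_boundary hw).2,
    ?_, fun v hv => ?_, fun v hv => ?_⟩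
  · filter_upwards [h0.contDiff, ae_restrict_mem measurableSet_Icc] with t h1 ht
    refine (h1.differentiableOn one_ne_zero).differentiableAt
      (closedBall_mem_nhds_of_norm_lt ((hsmall t ht).trans (half_lt_self hδ)))
  · obtain ⟨v', -, -, hv'⟩ := hv.exists_eq_rlIntegral hT hp hα hα1
    rw [intervalIntegrable_iff_integrableOn_Icc_of_le hT.le]
    exact (integrable_integralFunctionalDeriv hC hT hp hα w v').congr_fun
      (hinner v v' hv') measurableSet_Icc
  · obtain ⟨v', hv'S, hv'D, hv'⟩ := hv.exists_eq_rlIntegral hT hp hα hα1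
    have h1 : ∫ t in (0 : ℝ)..T, inner ℝ (gradient (F t) (rlIntegral α w t)) (v t) =
        integralFunctionalDeriv α (fun t => truncation δ M₂ q₂ (F t)) w v' := by
      rw [intervalIntegral_eq_setIntegral_Icc hT]
      exact (setIntegral_congr_fun measurableSet_Icc (hinner v v' hv')).symm
    have h2 : ∫ t in (0 : ℝ)..T,
        inner ℝ (phi (expo k) (rlDeriv α (rlIntegral α w) t)) (rlDeriv α v t) =
          powPairing w v' := by
      rw [intervalIntegral_eq_setIntegral_Icc hT]
      refine integral_congr_ae ?_
      filter_upwards [rlDeriv_rlIntegral_lpI hp hα hα1 w, hv'D] with t e1 e2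
      rw [e1, e2, phi_expo]
    have h3 : ((k : ℝ) + 2) * ∫ t in (0 : ℝ)..T,
        V t * inner ℝ (phi (expo k) (rlIntegral α w t)) (v t) =
          integralFunctionalDeriv α (weight k V) w v' := by
      rw [intervalIntegral_eq_setIntegral_Icc hT, integralFunctionalDeriv_weight]
      congr 1
      refine setIntegral_congr_fun measurableSet_Icc fun t ht => ?_
      rw [phi_expo, hv' t ht]
    have h4 := hcrit v' hv'S
    rw [energyDeriv, potentialDeriv, ← h1, ← h2, ← h3] at h4
    rw [kirchhoffCoeff_rlIntegral hT hα hα1 hV]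
    have hk : (k : ℝ) + 2 ≠ 0 := by positivity
    -- The factor p from differentiating the p-th powers cancels the 1/p in the derivative of the
    -- energy.
    rw [← mul_add, one_div, inv_mul_cancel_left₀ hk] at h4
    linarith

theorem embConst_rpow (hT : 0 < T) :
    embConst T α (expo k) ^ (k + 2) =
      T ^ (expo k * α - 1) / gammaConst α (expo k) ^ (k + 2) := by
  have hp := expo_pos k
  rw [embConst, div_pow, ← Real.rpow_natCast (T ^ _), ← Real.rpow_mul hT.le]
  congr 2
  change (α - 1 / expo k) * expo k = _
  field_simp

/-- Existence of a small solution, with the energy estimate, for one value of the parameter. -/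
theorem exists_solution (hN : 0 < N) (hT : 0 < T) (hα : 1 / expo k < α) (hα1 : α ≤ 1)
    (ha : 0 < a) (hb : 0 < b) (hV : ContinuousOn V (Icc 0 T)) (hVpos : ∀ t ∈ Icc 0 T, 0 < V t)
    (hδ : 0 < δ) (hq₂ : expo k ^ 2 < q₂) (hq₁ : q₂ < q₁) (hM₁ : 0 < M₁) (hM₂ : 0 < M₂)
    (hβ : expo k ^ 2 < β) (h0 : HypH0 T δ F) (h1 : HypH1 T δ q₁ q₂ M₁ M₂ F)
    (h2 : HypH2 T δ β F)
    (hlam : lambdaStar T α (k + 2) a b δ q₁ q₂ M₁ M₂ β V < lam) :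
    ∃ u : ℝ → EuclideanSpace ℝ (Fin N), IsWeakSolution T α (expo k) a b lam V F u ∧
      (∃ t ∈ Icc 0 T, u t ≠ 0) ∧
      normV T α (expo k) V u ^ (k + 2) ≤ boundConst T α (k + 2) a q₁ q₂ M₁ β V *
        lam ^ (-((expo k - 1) / (q₁ - expo k))) ∧
      supNorm T u ≤ embConst T α (expo k) * (boundConst T α (k + 2) a q₁ q₂ M₁ β V *
        lam ^ (-((expo k - 1) / (q₁ - expo k)))) ^ (1 / expo k) ∧
      0 ≤ boundConst T α (k + 2) a q₁ q₂ M₁ β V := by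
  have hp := one_lt_expo k
  have hp0 := expo_pos k
  have hpp : expo k < expo k ^ 2 := by nlinarith
  have hpq₂ : expo k < q₂ := hpp.trans hq₂
  have hpq₁ : expo k < q₁ := hpq₂.trans hq₁
  have hq₂1 : 1 < q₂ := hp.trans hpq₂
  have hk2 : (k : ℝ) + 2 = expo k := by simp only [expo]; push_cast; ring
  have hD := constD_pos hT (k + 2)
  have hG := constG_pos (p := expo k) hT hp0 hα1
  have hK := embConst_pos hT hp hα
  have hG0 : 0 < constG0 T α (expo k) := mul_pos hK hG
  set m := max 1 (Vmax T V) with hm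
  have hm1 : 1 ≤ m := le_max_left _ _
  set D := constD T (k + 2) with hDdef
  set G := constG T α (expo k) with hGdef
  -- The sine function e has sup norm at most K G = G₀, so c e stays in the ball of radius δ. Y
  -- bounds the potential at c e, and M₁ Q bounds its nonlinear term from below.
  set c := δ / constG0 T α (expo k) with hc
  have hc0 : 0 < c := by positivity
  set Y := c ^ (k + 2) * m * (D ^ (k + 2) + G ^ (k + 2)) with hY
  have hY0 : 0 < Y := by positivity
  set Q := c ^ q₁ * (T ^ (1 - q₁ / expo k) * D ^ q₁) with hQ
  have hQ0 : 0 < Q := by positivity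
  simp only [lambdaStar, Lambda1, max_lt_iff] at hlam
  obtain ⟨⟨⟨-, hlam1⟩, hlam2⟩, hlam3⟩ := hlam
  have hlam1' : 1 / (b * ((k : ℝ) + 2) ^ 2) * (a + b * Y) ^ (k + 2) / (M₁ * Q) < lam := by
    refine lt_of_eq_of_lt ?_ hlam1
    rw [hk2, hY, hQ, hc, div_pow, Real.div_rpow hδ.le hG0.le]
    congr 1
    · congr 3; ring
    · ring
  have hlam2' : (a + b * Y) ^ (q₁ * (expo k - 1)) < lam := by
    refine lt_of_le_of_lt ?_ hlam2
    -- Λ₂ contains the p-th power of max{1, V^∞} where the estimate needs only the first. The power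
    -- is larger because the base is at least 1.
    have hmm : m ≤ m ^ (k + 2) := le_self_pow₀ hm1 (by omega)
    rw [Lambda2, ← div_pow]
    refine Real.rpow_le_rpow (by positivity) ?_ (by nlinarith)
    have e : b * Y = b * m * c ^ (k + 2) * (D ^ (k + 2) + G ^ (k + 2)) := by rw [hY]; ring
    rw [e]
    gcongr
  have hlam0 : 0 < lam := lt_trans (by positivity) hlam2'
  have hF : ∀ᵐ t ∂(volume.restrict (Icc 0 T)), ∀ x ∈ Metric.closedBall 0 δ,
      0 ≤ F t x ∧ F t x ≤ M₂ * ‖x‖ ^ q₂ := by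
    filter_upwards [h1] with t ht x hx
    exact ⟨le_trans (by positivity) (ht x hx).1, (ht x hx).2⟩
  obtain ⟨e, heS, heG, heD⟩ := exists_sine_mem_derivSpace (k := k) hN hT hα hα1
  have hpot := potential_weight_le hT hα hV heG heD
  have hpot0 : ∀ w : LpI N T (expo k), 0 ≤ potential α (weight k V) w := fun w =>
    potential_nonneg (integralFunctional_weight_nonneg hVpos w)
  have hray : ∀ s ∈ Icc (0 : ℝ) 1,
      potential α (weight k V) (s • c • e) ≤ s ^ (k + 2) * Y ∧
      M₁ * (s ^ q₁ * Q) ≤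
        integralFunctional α (fun t => truncation δ M₂ q₂ (F t)) (s • c • e) := by
    intro s hs
    have hsc : 0 ≤ s * c := mul_nonneg hs.1 hc0.le
    rw [smul_smul]
    constructor
    · rw [potential_weight_smul, abs_of_nonneg hsc, mul_pow, mul_assoc, hY, mul_assoc]
      have := hs.1
      gcongr
    · have hcw : s * c * (embConst T α (expo k) * ‖e‖) ≤ δ := by
        calc s * c * (embConst T α (expo k) * ‖e‖) ≤
              1 * c * (embConst T α (expo k) * G) := by
              have := hs.2
              gcongr
          _ = δ := by
              rw [hc, one_mul, constG0, div_mul_cancel₀]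
              positivity
      have := le_integralFunctional_truncation hT hα hα1 hδ hq₂1 hM₁.le hpq₁ h0 h1 hD heD hsc hcw
      rwa [Real.mul_rpow hs.1 hc0.le, mul_assoc (s ^ q₁)] at this
  have hneg : energy α a b lam (weight k V) (fun t => truncation δ M₂ q₂ (F t)) (c • e) < 0 := by
    have := hray 1 ⟨zero_le_one, le_rfl⟩
    rw [one_smul, one_pow, one_mul, Real.one_rpow, one_mul] at this
    exact kirchhoff_profile_neg ha hb (by positivity) (hpot0 _) this.1 this.2 hlam0 hlam1'
  have hle : ∀ s ∈ Icc (0 : ℝ) 1,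
      energy α a b lam (weight k V) (fun t => truncation δ M₂ q₂ (F t)) (s • c • e) ≤
        Cstar T α (k + 2) q₁ M₁ V * lam ^ (-((expo k - 1) / (q₁ - expo k))) := fun s hs => by
    refine (kirchhoff_profile_le ha hb hM₁ hY0 hQ0 hpq₁ (hpot0 _) (hray s hs).1 (hray s hs).2 hs
      hlam2'.le).trans_eq ?_
    -- This identifies the maximum of the scalar profile with C_*.
    have := scaled_ratio_rpow (q := q₁) (p := expo k) (m := m)
      (S := D ^ (k + 2) + G ^ (k + 2)) hT hc0 (by positivity) (by positivity) hD hp0 hpq₁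
    rw [Real.rpow_natCast c] at this
    rw [hY, hQ, this, Cstar]
  set θ := min β q₂ with hθ
  have hθ2 : expo k ^ 2 < θ := lt_min hβ hq₂
  have hθk : ((k : ℝ) + 2) ^ 2 < θ := by rwa [hk2]
  have hθ0 : 0 < θ := lt_trans (by positivity) hθ2
  have hAR := mul_integralFunctional_truncation_le hT hα hδ hq₂1 hM₂.le h0
    (min_le_right β q₂) (min_le_left β q₂) hF h2
  have hz := integralFunctional_truncation_zero (α := α) (k := k) hT hα hδ hq₂1 hM₂.le h0 hF
  have hz1 : integralFunctional α (weight k V) (0 : LpI N T (expo k)) = 0 := by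
    have := integralFunctional_weight_smul (α := α) (V := V) 0 (0 : LpI N T (expo k))
    rw [zero_smul] at this
    rw [this]; simp
  obtain ⟨w, hwS, hw0, hwC, hcrit⟩ := exists_critical_point (a := a) (b := b)
    (isCaratheodory_weight hV) (isCaratheodory_truncation (M := M₂) hδ hq₂1 h0) hT hα hα1 ha hb
    hlam0.le hθk (integralFunctional_weight_nonneg hVpos) hz1
    integralFunctionalDeriv_weight_self hAR hz hpq₂
    (integralFunctional_truncation_le hT hα hδ hq₂1 hM₂.le h0 hF)
    (Submodule.isClosed_topologicalClosure _) (Submodule.smul_mem _ c heS) hneg hle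
  set R := boundConst T α (k + 2) a q₁ q₂ M₁ β V *
        lam ^ (-((expo k - 1) / (q₁ - expo k))) with hR
  -- At a critical point the derivative term of the Ambrosetti-Rabinowitz estimate vanishes.
  -- Dividing the level C_* λ^(...) by (1/p² - 1/θ) a^(p-1) gives the prefactor in B.
  have hwR : potential α (weight k V) w ≤ R := by
    have h := potential_le_energy_sub (a := a) (b := b) ha hb hlam0.le hθk
      (integralFunctional_weight_nonneg hVpos w) (integralFunctionalDeriv_weight_self w) (hAR w)
    rw [hcrit w hwS, mul_zero, sub_zero, hk2] at h
    have h := h.trans hwC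
    have hd : 0 < θ - expo k ^ 2 := sub_pos.2 hθ2
    have hf : 0 < (1 / expo k ^ 2 - 1 / θ) * a ^ (k + 1) := by
      have : 1 / θ < 1 / expo k ^ 2 := one_div_lt_one_div_of_lt (by positivity) hθ2
      have := sub_pos.2 this
      positivity
    rw [← le_div_iff₀' hf] at h
    refine h.trans_eq ?_
    rw [hR, boundConst, ← hθ, show ((k + 2 : ℕ) : ℝ) - 1 = _ from expo_sub_one k,
      Real.rpow_natCast]
    change _ / ((1 / expo k ^ 2 - 1 / θ) * a ^ (k + 1)) =
      expo k ^ 2 * θ / (a ^ (k + 1) * (θ - expo k ^ 2)) * _ * _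
    field_simp
  have hR0 : 0 ≤ R := (hpot0 w).trans hwR
  -- The sign of B is read off from 0 ≤ ‖u‖_V^p ≤ B λ^(...), which avoids analysing the formula for
  -- C_*.
  have hB0 : 0 ≤ boundConst T α (k + 2) a q₁ q₂ M₁ β V :=
    nonneg_of_mul_nonneg_left hR0 (by positivity)
  have hwn : ‖w‖ ≤ R ^ (1 / expo k) := by
    rw [one_div, Real.le_rpow_inv_iff_of_pos (norm_nonneg _) hR0 hp0, Real.rpow_natCast]
    exact (norm_pow_le_potential (integralFunctional_weight_nonneg hVpos w)).trans hwR
  have hsup : ∀ t ∈ Icc 0 T, ‖rlIntegral α w t‖ ≤ embConst T α (expo k) * R ^ (1 / expo k) :=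
    fun t ht => (norm_rlIntegral_lpI_le hp hα ht w).trans (by gcongr)
  -- After raising to the p-th power this is K^p B λ^(-(p-1)/(q₁-p)) < (δ/2)^p, that is, λ > Λ₃ with
  -- the exponent moved to the other side.
  have hsmall : embConst T α (expo k) * R ^ (1 / expo k) < δ / 2 := by
    refine lt_of_pow_lt_pow_left₀ (k + 2) (by positivity) ?_
    rw [mul_pow, one_div, Real.rpow_inv_natCast_pow hR0 (by omega), div_pow, embConst_rpow hT]
    set L := T ^ (expo k * α - 1) / gammaConst α (expo k) ^ (k + 2) with hL
    have hL0 : 0 < L := by rw [hL, ← embConst_rpow hT]; positivity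
    have hq : 0 < q₁ - expo k := sub_pos.2 hpq₁
    have hp1 : 0 < expo k - 1 := sub_pos.2 hp
    have h3 : L * boundConst T α (k + 2) a q₁ q₂ M₁ β V * (2 ^ (k + 2) / δ ^ (k + 2)) <
        lam ^ ((expo k - 1) / (q₁ - expo k)) := by
      have h := Real.rpow_lt_rpow (by rw [Lambda3]; positivity) hlam3 (div_pos hp1 hq)
      refine lt_of_eq_of_lt ?_ h
      rw [Lambda3, ← Real.rpow_mul (by positivity), div_mul_div_cancel₀ hp1.ne', div_self hq.ne',
        Real.rpow_one]
    rw [hR, Real.rpow_neg hlam0.le]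
    have hl : 0 < lam ^ ((expo k - 1) / (q₁ - expo k)) := by positivity
    rw [← mul_div_assoc, div_lt_iff₀ (by positivity)] at h3
    rw [lt_div_iff₀ (by positivity), ← mul_assoc, ← div_eq_mul_inv, div_mul_eq_mul_div,
      div_lt_iff₀ hl]
    linarith
  refine ⟨rlIntegral α w, ?_, ?_, ?_, supNorm_le hT hsup, hB0⟩
  · exact isWeakSolution_rlIntegral hT hα hα1 hV hδ hq₂1 h0 hwS
      (fun t ht => (hsup t ht).trans_lt hsmall) hcrit
  -- If u vanished identically then w = 0, whose energy is 0, contrary to the positive mountain pass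
  -- level.
  · by_contra! hcon
    rw [eq_zero_of_rlIntegral_eq_zero hα hα1 hcon, energy, potential, hz1, hz] at hw0
    simp at hw0
  · rwa [normV_rlIntegral_pow hT hα hα1 hVpos]

theorem normV_nonneg {p : ℝ} (hT : 0 < T) (hV : ∀ t ∈ Icc 0 T, 0 < V t)
    (u : ℝ → EuclideanSpace ℝ (Fin N)) : 0 ≤ normV T α p V u := by
  refine Real.rpow_nonneg (add_nonneg
    (intervalIntegral.integral_nonneg hT.le fun t _ => by positivity)
    (intervalIntegral.integral_nonneg hT.le fun t ht => ?_)) _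
  exact mul_nonneg (hV t ht).le (by positivity)

end Solution

end FracKirchhoff

/-! ### The family of solutions and its limit -/

theorem theorem1p1 (N p : ℕ) (hN : 0 < N) (hp : 1 < p)
    (T α a b : ℝ) (hT : 0 < T) (hα : 1 / (p : ℝ) < α) (hα1 : α ≤ 1) (ha : 0 < a) (hb : 0 < b)
    (V : ℝ → ℝ) (hV : ContinuousOn V (Icc 0 T)) (hVpos : ∀ t ∈ Icc 0 T, 0 < V t)
    (F : ℝ → EuclideanSpace ℝ (Fin N) → ℝ)
    (δ q₁ q₂ M₁ M₂ β : ℝ) (hδ : 0 < δ)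
    (hq₂ : (p : ℝ) ^ 2 < q₂) (hq₁ : q₂ < q₁) (hM₁ : 0 < M₁) (hM₂ : 0 < M₂)
    (hβ : (p : ℝ) ^ 2 < β)
    (h0 : HypH0 T δ F) (h1 : HypH1 T δ q₁ q₂ M₁ M₂ F) (h2 : HypH2 T δ β F) :
    ∃ u : ℝ → ℝ → EuclideanSpace ℝ (Fin N),
      (∀ lam : ℝ, lambdaStar T α p a b δ q₁ q₂ M₁ M₂ β V < lam →
        IsWeakSolution T α p a b lam V F (u lam) ∧
        (∃ t ∈ Icc 0 T, u lam t ≠ 0) ∧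
        normV T α p V (u lam) ^ p ≤
          boundConst T α p a q₁ q₂ M₁ β V * lam ^ (-(((p : ℝ) - 1) / (q₁ - p))) ∧
        boundConst T α p a q₁ q₂ M₁ β V * lam ^ (-(((p : ℝ) - 1) / (q₁ - p))) ≤
          boundConst T α p a q₁ q₂ M₁ β V *
            lambdaStar T α p a b δ q₁ q₂ M₁ M₂ β V ^ (-(((p : ℝ) - 1) / (q₁ - p))) ∧
        supNorm T (u lam) ≤
          embConst T α p * (boundConst T α p a q₁ q₂ M₁ β V *
            lam ^ (-(((p : ℝ) - 1) / (q₁ - p)))) ^ (1 / (p : ℝ)) ∧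
        embConst T α p * (boundConst T α p a q₁ q₂ M₁ β V *
            lam ^ (-(((p : ℝ) - 1) / (q₁ - p)))) ^ (1 / (p : ℝ)) ≤
          embConst T α p * (boundConst T α p a q₁ q₂ M₁ β V *
            lambdaStar T α p a b δ q₁ q₂ M₁ M₂ β V ^ (-(((p : ℝ) - 1) / (q₁ - p)))) ^
              (1 / (p : ℝ))) ∧
      Tendsto (fun lam => normV T α p V (u lam)) atTop (𝓝 0) ∧
      Tendsto (fun lam => supNorm T (u lam)) atTop (𝓝 0) := by
  -- Writing p = k + 2 turns the exponents p - 1 and p - 2 into the natural numbers k + 1 and k.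
  obtain ⟨k, rfl⟩ : ∃ k, p = k + 2 := ⟨p - 2, by omega⟩
  have hp0 := expo_pos k
  have hpq₁ : expo k < q₁ := by
    have := one_lt_expo k
    have h : expo k ^ 2 < q₂ := hq₂
    nlinarith
  have hm : 0 < (expo k - 1) / (q₁ - expo k) :=
    div_pos (sub_pos.2 (one_lt_expo k)) (sub_pos.2 hpq₁)
  have hK := embConst_pos hT (one_lt_expo k) hα
  have hsol : ∀ lam, lambdaStar T α (k + 2) a b δ q₁ q₂ M₁ M₂ β V < lam → _ := fun lam hlam =>
    exists_solution hN hT hα hα1 ha hb hV hVpos hδ hq₂ hq₁ hM₁ hM₂ hβ h0 h1 h2 hlam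
  -- The choice extends to all real λ with arbitrary values for λ ≤ λ^*. The limits at infinity do
  -- not see them.
  choose! u hu hu0 huV hus hB using hsol
  have hstar : 0 < lambdaStar T α (k + 2) a b δ q₁ q₂ M₁ M₂ β V := by
    have hG := constG_pos (p := expo k) hT hp0 hα1
    have hG0 : 0 < constG0 T α (expo k) := mul_pos hK hG
    have hD := constD_pos hT (k + 2)
    -- Positivity of λ^* comes from Λ₂, a real power of a positive number. It is needed for
    -- monotonicity of the negative power of λ.
    refine lt_of_lt_of_le ?_ ((le_max_right _ _).trans (le_max_left _ _))
    have : 0 < max 1 (Vmax T V) := lt_of_lt_of_le one_pos (le_max_left _ _)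
    rw [Lambda2]
    positivity
  have hlim : Tendsto (fun lam : ℝ => (boundConst T α (k + 2) a q₁ q₂ M₁ β V *
      lam ^ (-((expo k - 1) / (q₁ - expo k)))) ^ (1 / expo k)) atTop (𝓝 0) := by
    have h := ((tendsto_rpow_neg_atTop hm).const_mul
      (boundConst T α (k + 2) a q₁ q₂ M₁ β V)).rpow_const (p := 1 / expo k)
      (Or.inr (by positivity))
    rwa [mul_zero, Real.zero_rpow (by positivity)] at h
  refine ⟨u, fun lam hlam => ?_, ?_, ?_⟩
  · have hB0 := hB lam hlam
    have hle : boundConst T α (k + 2) a q₁ q₂ M₁ β V * lam ^ (-((expo k - 1) / (q₁ - expo k))) ≤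
        boundConst T α (k + 2) a q₁ q₂ M₁ β V *
          lambdaStar T α (k + 2) a b δ q₁ q₂ M₁ M₂ β V ^ (-((expo k - 1) / (q₁ - expo k))) :=
      mul_le_mul_of_nonneg_left
        (Real.rpow_le_rpow_of_nonpos hstar hlam.le (neg_nonpos.2 hm.le)) hB0
    have hlam0 : 0 < lam := hstar.trans hlam
    refine ⟨hu lam hlam, hu0 lam hlam, huV lam hlam, hle, hus lam hlam, ?_⟩
    exact mul_le_mul_of_nonneg_left
      (Real.rpow_le_rpow (by positivity) hle (by positivity)) hK.le
  · refine tendsto_of_tendsto_of_tendsto_of_le_of_le' tendsto_const_nhds hlim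
      (Eventually.of_forall fun lam => normV_nonneg hT hVpos _) ?_
    filter_upwards [eventually_gt_atTop (lambdaStar T α (k + 2) a b δ q₁ q₂ M₁ M₂ β V)]
      with lam hlam
    have hB0 := hB lam hlam
    have hlam0 : 0 < lam := hstar.trans hlam
    rw [one_div, Real.le_rpow_inv_iff_of_pos (normV_nonneg hT hVpos _) (by positivity) hp0,
      Real.rpow_natCast]
    exact huV lam hlam
  · have h := hlim.const_mul (embConst T α (expo k))
    rw [mul_zero] at h
    refine tendsto_of_tendsto_of_tendsto_of_le_of_le' tendsto_const_nhds h
      (Eventually.of_forall fun lam => supNorm_nonneg _) ?_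
    filter_upwards [eventually_gt_atTop (lambdaStar T α (k + 2) a b δ q₁ q₂ M₁ M₂ β V)]
      with lam hlam
    exact hus lam hlam
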